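/- **Setting.** Let $X$ be a complete connected Riemannian manifold with distance $d$, carrying an effective, cocompact, properly discontinuous, isometric action of a countable discrete group $\Gamma$, and let $\mu$ be a $\Gamma$-invariant Borel measure on $X$, finite on compact sets and positive on non-empty open sets (for example the Riemannian measure). Write $L^2(X)=L^2(X,\mu)$, $(U_\gamma w)(x)=w(\gamma x)$, $d(x,\emptyset)=\infty$ and $B_R(A)=\{x\in X: d(x,A)\le R\}$. An operator $A$ on $L^2$ is *locally compact* if $Af$ and $fA$ are compact for all $f\in C_c$, and has *finite propagation* if for some $R\ge 0$ one has $fAg=0$ whenever $f,g\in C_0$ have supports at least $R$ apart. A *half-space* is a closed set $W\subset X$ with $\mu(\partial W)=0$ and $x\mapsto d(x,X\setminus W)$ unbounded. Let $\Pi_W:L^2(X)\to L^2(W)$ be the restriction, $\Pi_W^*$ the extension by zero, and $T_\gamma=\Pi_WU_\gamma\Pi_W^*$. Consider the following C*-algebras. * $C^*(X,\Gamma)\subset\mathcal B(L^2(X))$: the norm closure of the locally compact, finite propagation operators commuting with all $U_\gamma$. * $Q^*(W,\Gamma)\subset\mathcal B(L^2(W))$: the norm closure of the algebra $\mathscr Q_0(W,\Gamma)$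 of locally compact, finite propagation operators $A$ for which there is $R\ge0$ such that $T_\gamma Aw=AT_\gamma w$ whenever $w\in C_c(W)$ and $\gamma\in\Gamma$ are such that the supports of $\Pi_W^*w$ and of $U_\gamma\Pi_W^*w$ both lie in $W$ at distance at least $R$ from $\partial W$. * $C^*_W(\partial W)\subset Q^*(W,\Gamma)$: the norm closure of the locally compact, finite propagation operators $A$ on $L^2(W)$ for which there is $R\ge0$ with $Aw=0$ for all $w\in C_c(W)$ whose support has distance at least $R$ from $\partial W$. The *periodization map* $\varpi:Q^*(W,\Gamma)\to C^*(X,\Gamma)$ is the unique $*$-homomorphism such that for each $A\in\mathscr Q_0(W,\Gamma)$ there is $R\ge 0$ with $\varpi(A)\Pi_W^*w=\Pi_W^*Aw$ for all $w\in C_c(W)$ whose support has distance at least $R$ from $\partial W$. With $A^+$ denoting the unitization and $s(p)$ the scalar part of $p$, the *exponential map* $\mathrm{Exp}_W:K_0(C^*(X,\Gamma))\to K_1(C^*_W(\partial W))$ of the extension $C^*_W(\partial W)\to Q^*(W,\Gamma)\xrightarrow{\varpi}C^*(X,\Gamma)$ is the homomorphism $[p]-[s(p)]\mapsto[\exp(-2\pi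 i a)]$, where $p\in M_n(C^*(X,\Gamma)^+)$ is a projection and $a\in M_n(Q^*(W,\Gamma)^+)$ is a self-adjoint lift of $p$. For $Z\subset W$ put $Z^\perp=\overline{W\setminus Z}$ (closure in $W$). A subset $W_+\subset W$ of a half-space is *admissible* if, with $W_-:=W_+^\perp$ and $N:=W_+\cap W_-$: it is regular closed in $W$, i.e. $W_+=(W_+^\perp)^\perp$; for each $R\ge0$ there is $S\ge0$ with $B_R(W_+)\cap B_R(W_-)\subset B_S(N)$; for each $R\ge0$ the set $B_R(X\setminus W)\cap B_R(N)$ is bounded; and $\mu(N)=0$. Then $\theta_{W;W_+}:K_1(C^*_W(\partial W))\to\mathbb Z$ is the homomorphism $[u]\mapsto\mathrm{Index}\,(\Pi_{W_+}u\,\Pi_{W_+}^*)$, the Fredholm index of the compression to $L^2(W_+)^n$ of a unitary $u\in M_n(C^*_W(\partial W)^+)$. **Theorem.** Let $W,W'\subset X$ be half-spaces, and let $W_+\subset W$ and $W_+'\subset W'$ be admissible, with regular complements $W_-$ in $W$ and $W_-'$ in $W'$, such that $$N:=W_+\cap W_-=W_+\cap W_-'=W_+'\cap W_-'=W_+'\cap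 W_- .$$ Suppose further that $W_1:=W_+\cup W_-'$ is a half-space and that $W_+$ is admissible in $W_1$. Then the maps $\varpi$, $\mathrm{Exp}$ and $\theta$ above exist and are uniquely determined (for $W_+\subset W$ and for $W'_+\subset W'$), and $$\theta_{W;W_+}\circ\mathrm{Exp}_W=\theta_{W';W_+'}\circ\mathrm{Exp}_{W'}$$ as homomorphisms $K_0(C^*(X,\Gamma))\to\mathbb Z$. -/

import Mathlib

open MeasureTheory Bundle
open scoped ENNReal Manifold ContDiff CompactlySupported ZeroAtInfty

noncomputable section

/-! ### K-theory of C*-algebras by generators and relations -/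

section KTheory

/-- The block diagonal sum `a ⊕ b` of two square matrices. -/
def blockSum {R : Type*} [Zero R] {m n : ℕ} (a : Matrix (Fin m) (Fin m) R)
    (b : Matrix (Fin n) (Fin n) R) : Matrix (Fin (m + n)) (Fin (m + n)) R :=
  Matrix.reindex finSumFinEquiv finSumFinEquiv (Matrix.fromBlocks a 0 0 b)

/-- A square matrix of any size over `R` belonging to `P`: the generators. -/
structure MatGen (R : Type*) (P : ∀ n : ℕ, Set (Matrix (Fin n) (Fin n) R)) where
  /-- the size -/
  size : ℕ
  /-- the matrix -/
  mat : {a : Matrix (Fin size) (Fin size) R // a ∈ P size}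

/-- The relations of K-theory among the generators: path components within `P` are identified,
block sums are sums, and the trivial elements `e n` vanish. -/
def kRel (R : Type*) [Zero R] [TopologicalSpace R] (P : ∀ n : ℕ, Set (Matrix (Fin n) (Fin n) R))
    (e : ∀ n : ℕ, Matrix (Fin n) (Fin n) R) : Set (FreeAbelianGroup (MatGen R P)) :=
  {x | ∃ (n : ℕ) (a b : {a : Matrix (Fin n) (Fin n) R // a ∈ P n}), JoinedIn (P n) a.1 b.1 ∧
        x = FreeAbelianGroup.of ⟨n, a⟩ - FreeAbelianGroup.of ⟨n, b⟩} ∪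
  {x | ∃ (m n : ℕ) (a : {a : Matrix (Fin m) (Fin m) R // a ∈ P m})
        (b : {a : Matrix (Fin n) (Fin n) R // a ∈ P n})
        (c : {a : Matrix (Fin (m + n)) (Fin (m + n)) R // a ∈ P (m + n)}),
        c.1 = blockSum a.1 b.1 ∧
        x = FreeAbelianGroup.of ⟨m + n, c⟩
          - (FreeAbelianGroup.of ⟨m, a⟩ + FreeAbelianGroup.of ⟨n, b⟩)} ∪
  {x | ∃ (n : ℕ) (a : {a : Matrix (Fin n) (Fin n) R // a ∈ P n}), a.1 = e n ∧
        x = FreeAbelianGroup.of ⟨n, a⟩}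

/-- The projections in `M_n(R)`. -/
def projMat (R : Type*) [Ring R] [StarRing R] (n : ℕ) : Set (Matrix (Fin n) (Fin n) R) :=
  {p | IsStarProjection p}

/-- The unitaries in `M_n(R)`. -/
def unitaryMat (R : Type*) [Ring R] [StarRing R] (n : ℕ) : Set (Matrix (Fin n) (Fin n) R) :=
  {u | u ∈ unitary (Matrix (Fin n) (Fin n) R)}

/-- `K₀` of a unital C*-algebra: the abelian group generated by the projections in all matrix
algebras, modulo homotopy of projections, `[p ⊕ q] = [p] + [q]` and `[0] = 0`. -/
abbrev K0Unital (R : Type*) [Ring R] [StarRing R] [TopologicalSpace R] : Type _ :=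
  FreeAbelianGroup (MatGen R (projMat R)) ⧸
    AddSubgroup.closure (kRel R (projMat R) (fun _ => 0))

/-- `K₁` of a unital C*-algebra: the abelian group generated by the unitaries in all matrix
algebras, modulo homotopy of unitaries, `[u ⊕ v] = [u] + [v]` and `[1] = 0`. -/
abbrev K1Unital (R : Type*) [Ring R] [StarRing R] [TopologicalSpace R] : Type _ :=
  FreeAbelianGroup (MatGen R (unitaryMat R)) ⧸
    AddSubgroup.closure (kRel R (unitaryMat R) (fun _ => 1))

/-- The class `[p]` of a projection. -/
def K0Unital.mk {R : Type*} [Ring R] [StarRing R] [TopologicalSpace R] {n : ℕ}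
    (p : Matrix (Fin n) (Fin n) R) (hp : IsStarProjection p) : K0Unital R :=
  QuotientAddGroup.mk (FreeAbelianGroup.of ⟨n, ⟨p, hp⟩⟩)

/-- The class `[u]` of a unitary. -/
def K1Unital.mk {R : Type*} [Ring R] [StarRing R] [TopologicalSpace R] {n : ℕ}
    (u : Matrix (Fin n) (Fin n) R) (hu : u ∈ unitary (Matrix (Fin n) (Fin n) R)) :
    K1Unital R :=
  QuotientAddGroup.mk (FreeAbelianGroup.of ⟨n, ⟨u, hu⟩⟩)

lemma isStarProjection_map {R S : Type*} [Ring R] [StarRing R] [Algebra ℂ R]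
    [Ring S] [StarRing S] [Algebra ℂ S] (φ : R →⋆ₐ[ℂ] S) {n : ℕ}
    {p : Matrix (Fin n) (Fin n) R} (hp : IsStarProjection p) : IsStarProjection (p.map φ) := by
  refine ⟨?_, ?_⟩
  · have h := hp.isIdempotentElem.eq
    change p.map φ * p.map φ = p.map φ
    conv_rhs => rw [← h]
    exact (Matrix.map_mul (f := (φ : R →+* S))).symm
  · have h := hp.isSelfAdjoint.star_eq
    change (p.map φ).conjTranspose = p.map φ
    conv_rhs => rw [← h]
    ext i j
    exact (map_star φ (p j i)).symm

lemma map_blockSum {R S : Type*} [Ring R] [StarRing R] [Algebra ℂ R]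
    [Ring S] [StarRing S] [Algebra ℂ S] (φ : R →⋆ₐ[ℂ] S) {m n : ℕ}
    (a : Matrix (Fin m) (Fin m) R) (b : Matrix (Fin n) (Fin n) R) :
    (blockSum a b).map φ = blockSum (a.map φ) (b.map φ) := by
  ext i j
  simp only [blockSum, Matrix.reindex_apply, Matrix.submatrix_apply, Matrix.map_apply]
  rcases finSumFinEquiv.symm i with i | i <;> rcases finSumFinEquiv.symm j with j | j <;> simp

/-- The homomorphism induced on `K₀` by a continuous unital *-homomorphism. -/
def K0Unital.map {R S : Type*} [Ring R] [StarRing R] [Algebra ℂ R] [TopologicalSpace R]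
    [Ring S] [StarRing S] [Algebra ℂ S] [TopologicalSpace S] (φ : R →⋆ₐ[ℂ] S)
    (hφ : Continuous φ) : K0Unital R →+ K0Unital S :=
  QuotientAddGroup.lift _
    (FreeAbelianGroup.lift fun g : MatGen R (projMat R) =>
      K0Unital.mk (g.mat.1.map φ) (isStarProjection_map φ g.mat.2)) (by
    rw [AddSubgroup.closure_le]
    rintro x ((⟨n, a, b, hab, rfl⟩ | ⟨m, n, a, b, c, hc, rfl⟩) | ⟨n, a, ha, rfl⟩)
    · rw [SetLike.mem_coe, AddMonoidHom.mem_ker, map_sub, FreeAbelianGroup.lift_apply_of,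
        FreeAbelianGroup.lift_apply_of, sub_eq_zero]
      refine (QuotientAddGroup.eq_iff_sub_mem).2 (AddSubgroup.subset_closure ?_)
      refine Or.inl (Or.inl ⟨n, ⟨_, isStarProjection_map φ a.2⟩,
        ⟨_, isStarProjection_map φ b.2⟩, ?_, rfl⟩)
      obtain ⟨γ, hγ⟩ := hab
      exact ⟨γ.map (f := fun M : Matrix (Fin n) (Fin n) R => M.map φ)
        (continuous_id.matrix_map hφ), fun t => isStarProjection_map φ (hγ t)⟩
    · rw [SetLike.mem_coe, AddMonoidHom.mem_ker, map_sub, map_add,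
        FreeAbelianGroup.lift_apply_of, FreeAbelianGroup.lift_apply_of,
        FreeAbelianGroup.lift_apply_of, sub_eq_zero]
      refine (QuotientAddGroup.eq_iff_sub_mem).2 (AddSubgroup.subset_closure ?_)
      refine Or.inl (Or.inr ⟨m, n, ⟨_, isStarProjection_map φ a.2⟩,
        ⟨_, isStarProjection_map φ b.2⟩, ⟨_, isStarProjection_map φ c.2⟩, ?_, rfl⟩)
      change c.1.map φ = _
      rw [hc, map_blockSum]
    · rw [SetLike.mem_coe, AddMonoidHom.mem_ker, FreeAbelianGroup.lift_apply_of]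
      refine (QuotientAddGroup.eq_zero_iff _).2 (AddSubgroup.subset_closure ?_)
      refine Or.inr ⟨n, ⟨_, isStarProjection_map φ a.2⟩, ?_, rfl⟩
      change a.1.map φ = 0
      rw [ha]
      ext i j
      simp)

variable (A : Type*) [NonUnitalCStarAlgebra A]

/-- The scalar part `A⁺ → ℂ` of the unitization `A⁺ = A ⊕ ℂ`. -/
def scalarPart : Unitization ℂ A →⋆ₐ[ℂ] ℂ where
  toAlgHom := Unitization.fstHom ℂ A
  map_star' := fun _ => rfl

lemma continuous_scalarPart : Continuous (scalarPart A) :=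
  Unitization.continuous_fst

/-- `K₀(A) = ker (K₀(A⁺) → K₀(ℂ))`. -/
def K0 : AddSubgroup (K0Unital (Unitization ℂ A)) :=
  (K0Unital.map (scalarPart A) (continuous_scalarPart A)).ker

/-- `K₁(A) = K₁(A⁺)`: the kernel of `K₁(A⁺) → K₁(ℂ)` is everything as `K₁(ℂ) = 0`. -/
abbrev K1 : Type _ := K1Unital (Unitization ℂ A)

variable {A}

/-- The scalar matrix `s(p)`, seen again as a matrix over `A⁺`. -/
def scalarMat {n : ℕ} (p : Matrix (Fin n) (Fin n) (Unitization ℂ A)) :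
    Matrix (Fin n) (Fin n) (Unitization ℂ A) :=
  p.map ((StarAlgHom.ofId ℂ (Unitization ℂ A)).comp (scalarPart A))

/-- `E : K₀(B) → K₁(J)` is the exponential map of the extension
`J --ι--> Q --q--> B` of C*-algebras: for a projection `p ∈ M_n(B⁺)` with a self-adjoint lift
`a ∈ M_n(Q⁺)` and the unitary `u ∈ M_n(J⁺)` with `ι⁺(u) = exp(-2πi a)`, it maps
`[p] - [s(p)]` to `[u]`. Its graph is required to consist of exactly these pairs. -/
def IsExponentialMap {J Q B : Type*} [NonUnitalCStarAlgebra J] [NonUnitalCStarAlgebra Q]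
    [NonUnitalCStarAlgebra B] (ι : J →⋆ₙₐ[ℂ] Q) (q : Q →⋆ₙₐ[ℂ] B) (E : K0 B →+ K1 J) : Prop :=
  ∀ (x : K0 B) (y : K1 J), E x = y ↔
    ∃ (n : ℕ) (p : Matrix (Fin n) (Fin n) (Unitization ℂ B)) (hp : IsStarProjection p)
      (a : Matrix (Fin n) (Fin n) (Unitization ℂ Q))
      (u : Matrix (Fin n) (Fin n) (Unitization ℂ J))
      (hu : u ∈ unitary (Matrix (Fin n) (Fin n) (Unitization ℂ J))),
      IsSelfAdjoint a ∧ a.map (Unitization.starMap q) = p ∧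
      u.map (Unitization.starMap ι) =
        NormedSpace.exp ((-(2 * Real.pi * Complex.I) : ℂ) • a) ∧
      (x : K0Unital (Unitization ℂ B)) =
        K0Unital.mk p hp -
          K0Unital.mk (scalarMat p) (isStarProjection_map _ hp) ∧
      y = K1Unital.mk u hu

end KTheory

/-! ### Fredholm index -/

/-- The index `dim ker T - dim coker T` of a Fredholm operator. -/
def fredholmIndex {H : Type*} [AddCommGroup H] [Module ℂ H] [TopologicalSpace H]
    (T : H →L[ℂ] H) : ℤ :=
  (Module.finrank ℂ (LinearMap.ker T.toLinearMap) : ℤ) -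
    Module.finrank ℂ (H ⧸ LinearMap.range T.toLinearMap)

/-! ### Operators on `L²` -/

section Operators

variable {X : Type*} [MetricSpace X] [MeasurableSpace X] [BorelSpace X]

/-- The Hilbert space `L²(X, ν)`. With `ν = μ.restrict W` this is `L²(W)`. -/
abbrev L2 (ν : Measure X) : Type _ := Lp ℂ 2 ν

/-- The bounded operators on `L²(X, ν)`. -/
abbrev BL2 (ν : Measure X) : Type _ := L2 ν →L[ℂ] L2 ν

lemma memLp_top (ν : Measure X) (f : C₀(X, ℂ)) : MemLp f ∞ ν :=
  memLp_top_of_bound (map_continuous f).aestronglyMeasurable ‖f.toBCF‖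
    (Filter.Eventually.of_forall fun x => f.toBCF.norm_coe_le_norm x)

/-- The operator of multiplication by `f ∈ C₀(X)` on `L²(X, ν)`. -/
def mulOp (ν : Measure X) (f : C₀(X, ℂ)) : BL2 ν :=
  (ContinuousLinearMap.mul ℂ ℂ).holderL ν ∞ 2 2 ((memLp_top ν f).toLp f)

/-- Local compactness. When `ν = μ.restrict W` with `W` closed, the functions in `C_c(W)` are the
restrictions of those in `C_c(X)`. -/
def IsLocCompact (ν : Measure X) (A : BL2 ν) : Prop :=
  ∀ f : C₀(X, ℂ), HasCompactSupport f →
    IsCompactOperator (A ∘L mulOp ν f) ∧ IsCompactOperator (mulOp ν f ∘L A)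

/-- Finite propagation. When `ν = μ.restrict W` with `W` closed, functions in `C₀(W)` extend to `X`
with arbitrarily small enlargement of their supports. -/
def HasFinPropagation (ν : Measure X) (A : BL2 ν) : Prop :=
  ∃ R : ℝ, 0 ≤ R ∧ ∀ f g : C₀(X, ℂ),
    (∀ x ∈ tsupport f, ∀ y ∈ tsupport g, R ≤ dist x y) → mulOp ν f ∘L A ∘L mulOp ν g = 0

/-- The class in `L²(X, ν)` of a compactly supported continuous function. -/
def ccToL2 (ν : Measure X) [IsFiniteMeasureOnCompacts ν] (f : C_c(X, ℂ)) : L2 ν :=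
  (f.continuous.memLp_of_hasCompactSupport f.hasCompactSupport).toLp f

/-- `Π_W : L²(X) → L²(W)`, restriction to `W`. -/
def restrictOp (ν : Measure X) (W : Set X) : L2 ν →L[ℂ] L2 (ν.restrict W) :=
  LpToLpRestrictCLM X ℂ ℂ ν 2 W

/-- `Π_W^* : L²(W) → L²(X)`, extension by zero. -/
def extendOp (ν : Measure X) (W : Set X) : L2 (ν.restrict W) →L[ℂ] L2 ν :=
  ContinuousLinearMap.adjoint (restrictOp ν W)

/-- The support of `f` lies in `W` and has distance at least `R` from `∂W`. For `R > 0`, extension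
by zero identifies these `f ∈ C_c(X)` with the functions in `C_c(W)` whose support has distance
at least `R` from `∂W`. -/
def IsDeepIn (W : Set X) (R : ℝ) (f : X → ℂ) : Prop :=
  ∀ x, f x ≠ 0 → x ∈ W ∧ ENNReal.ofReal R ≤ Metric.infEDist x (frontier W)

variable (Γ : Type*) [Group Γ] [MulAction Γ X] [IsIsometricSMul Γ X]
variable (μ : Measure X) [SMulInvariantMeasure Γ X μ]

/-- The unitary `U_γ w = γ^* w`, i.e. `(U_γ w)(x) = w(γ x)`, on `L²(X)`. -/
def translateOp {Γ : Type*} [Group Γ] [MulAction Γ X] [IsIsometricSMul Γ X]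
    (μ : Measure X) [SMulInvariantMeasure Γ X μ] (γ : Γ) : BL2 μ :=
  (Lp.compMeasurePreservingₗᵢ ℂ (fun x : X => γ • x)
    (measurePreserving_smul γ μ)).toContinuousLinearMap

/-- The compressed translation `T_γ = Π_W U_γ Π_W^*`. -/
def compTranslateOp {Γ : Type*} [Group Γ] [MulAction Γ X] [IsIsometricSMul Γ X]
    (μ : Measure X) [SMulInvariantMeasure Γ X μ] (W : Set X) (γ : Γ) : BL2 (μ.restrict W) :=
  restrictOp μ W ∘L translateOp μ γ ∘L extendOp μ W

/-- The `Γ`-invariant, locally compact operators of finite propagation on `L²(X)`. -/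
def equivariantRoeSet : Set (BL2 μ) :=
  {A | IsLocCompact μ A ∧ HasFinPropagation μ A ∧
    ∀ γ : Γ, translateOp μ γ ∘L A = A ∘L translateOp μ γ}

/-- The equivariant Roe algebra `C^*(X, Γ)`. (Here and below the generating set is already a
*-algebra, so that `adjoin` adds no new elements.) -/
def equivariantRoe : NonUnitalStarSubalgebra ℂ (BL2 μ) :=
  (NonUnitalStarAlgebra.adjoin ℂ (equivariantRoeSet Γ μ)).topologicalClosure

variable [IsFiniteMeasureOnCompacts μ] (W : Set X)

/-- The locally compact operators of finite propagation on `L²(W)` that commute with translations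
far away from `∂W`: `T_γ A w = A T_γ w` if the supports of `w` and of `U_γ w` both lie in `W`, at
distance at least `R` from `∂W`. -/
def quasiEquivariantSet : Set (BL2 (μ.restrict W)) :=
  {A | IsLocCompact (μ.restrict W) A ∧ HasFinPropagation (μ.restrict W) A ∧
    ∃ R : ℝ, 0 ≤ R ∧ ∀ (γ : Γ) (f : C_c(X, ℂ)),
      IsDeepIn W R f → IsDeepIn W R (fun x => f (γ • x)) →
        compTranslateOp μ W γ (A (ccToL2 (μ.restrict W) f)) =
          A (compTranslateOp μ W γ (ccToL2 (μ.restrict W) f))}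

/-- The quasi-equivariant Roe algebra `Q^*(W, Γ)`. -/
def quasiEquivariantRoe : NonUnitalStarSubalgebra ℂ (BL2 (μ.restrict W)) :=
  (NonUnitalStarAlgebra.adjoin ℂ (quasiEquivariantSet Γ μ W)).topologicalClosure

/-- The locally compact operators of finite propagation on `L²(W)` supported near `∂W`. -/
def localizedSet : Set (BL2 (μ.restrict W)) :=
  {A | IsLocCompact (μ.restrict W) A ∧ HasFinPropagation (μ.restrict W) A ∧
    ∃ R : ℝ, 0 ≤ R ∧ ∀ f : C_c(X, ℂ), IsDeepIn W R f → A (ccToL2 (μ.restrict W) f) = 0}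

/-- The Roe algebra `C^*_W(∂W)` of `W` localised at `∂W`. -/
def localizedRoe : NonUnitalStarSubalgebra ℂ (BL2 (μ.restrict W)) :=
  (NonUnitalStarAlgebra.adjoin ℂ (localizedSet μ W)).topologicalClosure

instance : IsClosed (equivariantRoe Γ μ : Set (BL2 μ)) :=
  NonUnitalStarSubalgebra.isClosed_topologicalClosure _

instance : IsClosed (quasiEquivariantRoe Γ μ W : Set (BL2 (μ.restrict W))) :=
  NonUnitalStarSubalgebra.isClosed_topologicalClosure _

instance : IsClosed (localizedRoe μ W : Set (BL2 (μ.restrict W))) :=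
  NonUnitalStarSubalgebra.isClosed_topologicalClosure _

lemma ccToL2_coeFn (ν : Measure X) [IsFiniteMeasureOnCompacts ν] (f : C_c(X, ℂ)) :
    ccToL2 ν f =ᵐ[ν] f :=
  MemLp.coeFn_toLp _

lemma restrictOp_ccToL2 (f : C_c(X, ℂ)) :
    restrictOp μ W (ccToL2 μ f) = ccToL2 (μ.restrict W) f := by
  apply Lp.ext
  refine (LpToLpRestrictCLM_coeFn ℂ W _).trans ?_
  have h : ccToL2 μ f =ᵐ[μ.restrict W] f := ae_restrict_of_ae (ccToL2_coeFn μ f)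
  exact h.trans (ccToL2_coeFn _ f).symm

variable {W} in
lemma extendOp_ccToL2 (f : C_c(X, ℂ)) (hf : ∀ x, f x ≠ 0 → x ∈ W) :
    extendOp μ W (ccToL2 (μ.restrict W) f) = ccToL2 μ f := by
  refine ext_inner_right ℂ fun v => ?_
  rw [extendOp, ContinuousLinearMap.adjoint_inner_left, L2.inner_def, L2.inner_def]
  have h1 : ∫ x, inner ℂ (ccToL2 (μ.restrict W) f x) (restrictOp μ W v x) ∂(μ.restrict W) =
      ∫ x in W, inner ℂ (f x) (v x) ∂μ := by
    refine integral_congr_ae ?_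
    filter_upwards [ccToL2_coeFn (μ.restrict W) f, LpToLpRestrictCLM_coeFn ℂ W v] with x h h'
    rw [h, restrictOp, h']
  have h2 : ∫ x, inner ℂ (ccToL2 μ f x) (v x) ∂μ = ∫ x, inner ℂ (f x) (v x) ∂μ := by
    refine integral_congr_ae ?_
    filter_upwards [ccToL2_coeFn μ f] with x h
    rw [h]
  rw [h1, h2]
  refine setIntegral_eq_integral_of_forall_compl_eq_zero fun x hx => ?_
  have : f x = 0 := by
    by_contra h
    exact hx (hf x h)
  rw [this, inner_zero_left]

variable {Γ} {W} in
lemma compTranslateOp_ccToL2 (γ : Γ) (f g : C_c(X, ℂ))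
    (hg : ∀ x, g x = f (γ • x)) (hf : ∀ x, f x ≠ 0 → x ∈ W) :
    compTranslateOp μ W γ (ccToL2 (μ.restrict W) f) = ccToL2 (μ.restrict W) g := by
  have h : translateOp μ γ (ccToL2 μ f) = ccToL2 μ g := by
    apply Lp.ext
    refine (Lp.coeFn_compMeasurePreserving _ (measurePreserving_smul γ μ)).trans ?_
    refine ((measurePreserving_smul γ μ).quasiMeasurePreserving.ae_eq_comp
      (ccToL2_coeFn μ f)).trans ?_
    filter_upwards [ccToL2_coeFn μ g] with x hx
    rw [hx, hg]
    rfl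
  rw [compTranslateOp, ContinuousLinearMap.comp_apply, ContinuousLinearMap.comp_apply,
    extendOp_ccToL2 μ f hf, h, restrictOp_ccToL2]

/-- The translate `x ↦ f (γ x)` of a compactly supported continuous function. -/
def translateCc {Γ : Type*} [Group Γ] [MulAction Γ X] [IsIsometricSMul Γ X] (γ : Γ)
    (f : C_c(X, ℂ)) : C_c(X, ℂ) where
  toFun x := f (γ • x)
  continuous_toFun := f.continuous.comp (continuous_const_smul γ)
  hasCompactSupport' := f.hasCompactSupport.comp_homeomorph (Homeomorph.smul γ)

lemma localizedRoe_le :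
    localizedRoe μ W ≤ quasiEquivariantRoe Γ μ W := by
  refine NonUnitalStarSubalgebra.topologicalClosure_mono (NonUnitalStarAlgebra.adjoin_mono ?_)
  rintro A ⟨h1, h2, R, hR, h3⟩
  refine ⟨h1, h2, R, hR, fun γ f hf hf' => ?_⟩
  rw [h3 f hf, map_zero, compTranslateOp_ccToL2 μ γ f (translateCc γ f) (fun _ => rfl)
    (fun x hx => (hf x hx).1), h3 (translateCc γ f) hf']

/-- The inclusion `C^*_W(∂W) → Q^*(W, Γ)`. -/
def localizedIncl :
    localizedRoe μ W →⋆ₙₐ[ℂ] quasiEquivariantRoe Γ μ W :=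
  NonUnitalStarSubalgebra.inclusion (localizedRoe_le Γ μ W)

/-- `ϖ : Q^*(W, Γ) → C^*(X, Γ)` is the periodization map: for each quasi-equivariant, locally
compact `A` of finite propagation, `ϖ(A) Π_W^* w = Π_W^* A w` for `w ∈ C_c(W)` supported
sufficiently far away from `∂W`. -/
def IsPeriodization (ϖ : quasiEquivariantRoe Γ μ W →⋆ₙₐ[ℂ] equivariantRoe Γ μ) : Prop :=
  ∀ A : quasiEquivariantRoe Γ μ W, (A : BL2 (μ.restrict W)) ∈ quasiEquivariantSet Γ μ W →
    ∃ R : ℝ, 0 ≤ R ∧ ∀ f : C_c(X, ℂ), IsDeepIn W R f →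
      (ϖ A : BL2 μ) (extendOp μ W (ccToL2 (μ.restrict W) f)) =
        extendOp μ W ((A : BL2 (μ.restrict W)) (ccToL2 (μ.restrict W) f))

/-- For `u ∈ M_n(C^*_W(∂W)⁺)` the compression `T_u = Π_{W₊} u Π_{W₊}^*` on `L²(W₊)^n`.
Here an element `c + A` of the unitization acts on `L²(W)` as `c • 1 + A`. -/
def compression (Wp : Set X) {n : ℕ}
    (u : Matrix (Fin n) (Fin n) (Unitization ℂ (localizedRoe μ W))) :
    (Fin n → L2 ((μ.restrict W).restrict Wp)) →L[ℂ] (Fin n → L2 ((μ.restrict W).restrict Wp)) :=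
  ContinuousLinearMap.pi fun i => ∑ j,
    (restrictOp (μ.restrict W) Wp ∘L
      ((u i j).fst • (1 : BL2 (μ.restrict W)) + ((u i j).snd : BL2 (μ.restrict W))) ∘L
      extendOp (μ.restrict W) Wp) ∘L ContinuousLinearMap.proj j

/-- `θ : K₁(C^*_W(∂W)) → ℤ` is the index homomorphism `θ_{W;W₊}`: for every unitary `u` the
compression `T_u` is Fredholm and `θ[u] = Index T_u`. -/
def IsIndexHom (Wp : Set X) (θ : K1 (localizedRoe μ W) →+ ℤ) : Prop :=
  ∀ (n : ℕ) (u : Matrix (Fin n) (Fin n) (Unitization ℂ (localizedRoe μ W)))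
    (hu : u ∈ unitary (Matrix (Fin n) (Fin n) (Unitization ℂ (localizedRoe μ W)))),
    (compression μ W Wp u).IsFredholm ∧
      θ (K1Unital.mk u hu) = fredholmIndex (compression μ W Wp u)

end Operators

/-! ### Half-spaces and admissible partitions -/

section Partitions

variable {X : Type*} [MetricSpace X] [MeasurableSpace X]

/-- A half-space of `X`: a closed set with boundary of measure zero such that `d(x, X \ W)` is
unbounded. -/
structure IsHalfSpace (μ : Measure X) (W : Set X) : Prop where
  isClosed : IsClosed W
  measure_frontier : μ (frontier W) = 0
  unbounded : ∀ r : ℝ, ∃ x : X, ENNReal.ofReal r ≤ Metric.infEDist x Wᶜ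

/-- The regular complement `Z^⊥`, the closure of `W \ Z` in the space `W`. -/
def regCompl (W Z : Set X) : Set X := W ∩ closure (W \ Z)

/-- `Z` is an admissible subset of the half-space `W`. With `Z = W₊`, `regCompl W Z` is `W₋`, and
`Z ∩ regCompl W Z` is `N`. The closed neighbourhood `B_R(A) = {x ∈ X | d(x, A) ≤ R}` is
`Metric.cthickening R A`. -/
structure IsAdmissible (μ : Measure X) (W Z : Set X) : Prop where
  isHalfSpace : IsHalfSpace μ W
  subset : Z ⊆ W
  /-- `Z` is regular closed in `W`, i.e. `Z = (Z^⊥)^⊥` is the closure of its interior in `W` -/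
  regular : regCompl W (regCompl W Z) = Z
  excisive : ∀ R : ℝ, 0 ≤ R → ∃ S : ℝ, 0 ≤ S ∧
    Metric.cthickening R Z ∩ Metric.cthickening R (regCompl W Z) ⊆
      Metric.cthickening S (Z ∩ regCompl W Z)
  transverse : ∀ R : ℝ, 0 ≤ R →
    Bornology.IsBounded (Metric.cthickening R Wᶜ ∩ Metric.cthickening R (Z ∩ regCompl W Z))
  measure_zero : μ (Z ∩ regCompl W Z) = 0

end Partitions

/-- `a` is the one and only object satisfying `P`. -/
def IsUnique {α : Type*} (P : α → Prop) (a : α) : Prop := P a ∧ ∀ b, P b → b = a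

end

/-! Write a projection over `C^*(X, Γ)⁺` as `p = s + C` with scalar part `s`, and let `E` be the
indicator of `W`. Compression is a section of the periodization, so `a = s + E C E` is a
self-adjoint lift of `p`, and `Exp_W` sends `[p] - [s(p)]` to the class of `exp(-2πi a)`. The index
is thus that of `D exp(-2πi a) D`, where `D` is the indicator of an admissible `Z ⊆ W`.

The heart of the matter is `IsAdmissible.index_congr`: this index depends on `Z` and not on the
half-space around it, as long as `Z` is admissible in both half-spaces with the same interface `N`.
The defect `a - a * a` equals `E C (1 - E) C E`, so it only sees paths that leave `W` and return.
The recursion `a^(k+2) = a^(k+1) - (a - a * a) a^k` then compares `D a^k D` for the two half-spaces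
by induction. Each error term involves a crossing between `Z` and its complement together with a
visit near `X \ W`. By excisiveness such crossings happen near `N`, by transversality they stay in a
bounded set, and local compactness makes the term compact. Summing the exponential series preserves
equality modulo compact operators, and hence the index (`matApprox_compress_exp_compressed`).

Secondly, `exp(-2πi a)` commutes with the indicator of `W`, so the indices for `Z` and `Z^⊥` add up
to zero (`IsAdmissible.index_add_index_compl`). With `W₁ = W₊ ∪ W'₋`, in which `W'₋` is the regular
complement of `W₊`, this gives `ind(W, W₊) = ind(W₁, W₊) = -ind(W₁, W'₋) = -ind(W', W'₋) = ind(W',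
W'₊)`, which is `IsAdmissible.index_eq`.

Existence of the maps rests on three facts. Cocompactness provides translations that push any ball
arbitrarily deep into a half-space, and the periodization is the strong limit of the corresponding
conjugates (`exists_strongLim`). Its kernel is `C^*_W(∂W)` (`isExtension_periodization`), so the
exponential map is that of a genuine extension (`IsExtension.isExponentialMap`). Finally, operators
in `C^*_W(∂W)` commute with the indicator of `W₊` modulo compact operators
(`IsAdmissible.isApproximable_commutator`), so compressions of unitaries are Fredholm. -/

noncomputable section

set_option linter.unusedSectionVars false

/-! ### Length spaces: distance to the boundary, cocompactness, properness. -/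

section LengthSpaces

/-- Any two points are joined by paths that are almost geodesic. -/
def HasAlmostGeodesics (X : Type*) [MetricSpace X] : Prop :=
  ∀ (x y : X) (ε : ℝ), 0 < ε → ∃ γ : Path x y, ∀ t, dist x (γ t) + dist (γ t) y ≤ dist x y + ε

-- A curve of length less than `d(x, y) + ε` works: its two pieces at time `t` bound the two
-- distances. Only this consequence of the Riemannian structure is used afterwards.
open Manifold in
lemma hasAlmostGeodesics_of_isRiemannianManifold {d : ℕ} {X : Type*} [MetricSpace X]
    [ChartedSpace (EuclideanSpace ℝ (Fin d)) X] [IsManifold (𝓡 d) ∞ X]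
    [RiemannianBundle (fun x : X => TangentSpace (𝓡 d) x)]
    [IsContMDiffRiemannianBundle (𝓡 d) ∞ (EuclideanSpace ℝ (Fin d))
      (fun x : X => TangentSpace (𝓡 d) x)]
    [IsRiemannianManifold (𝓡 d) X] : HasAlmostGeodesics X := by
  intro x y ε hε
  have h1 : riemannianEDist (𝓡 d) x y < edist x y + ENNReal.ofReal ε := by
    rw [← IsRiemannianManifold.out (I := 𝓡 d) x y]
    exact ENNReal.lt_add_right (edist_ne_top x y) (by simpa using hε)
  obtain ⟨γ, h0, h1', hγ, hlen⟩ := exists_lt_of_riemannianEDist_lt h1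
  let p : Path x y :=
    ⟨⟨fun t : unitInterval => γ t, hγ.continuousOn.comp_continuous continuous_subtype_val
      (fun t => t.2)⟩, by simpa using h0, by simpa using h1'⟩
  refine ⟨p, fun t => ?_⟩
  have ht := t.2
  have e1 : edist x (γ t) ≤ pathELength (𝓡 d) γ 0 t := by
    rw [IsRiemannianManifold.out (I := 𝓡 d) x (γ t)]
    exact riemannianEDist_le_pathELength (hγ.mono (Set.Icc_subset_Icc le_rfl ht.2)) h0 rfl ht.1
  have e2 : edist (γ t) y ≤ pathELength (𝓡 d) γ t 1 := by
    rw [IsRiemannianManifold.out (I := 𝓡 d) (γ t) y]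
    exact riemannianEDist_le_pathELength (hγ.mono (Set.Icc_subset_Icc ht.1 le_rfl)) rfl h1' ht.2
  have e3 : edist x (γ t) + edist (γ t) y ≤ edist x y + ENNReal.ofReal ε :=
    (add_le_add e1 e2).trans ((pathELength_add ht.1 ht.2).trans_le hlen.le)
  rw [edist_dist, edist_dist, edist_dist, ← ENNReal.ofReal_add dist_nonneg dist_nonneg,
    ← ENNReal.ofReal_add dist_nonneg hε.le, ENNReal.ofReal_le_ofReal_iff (by positivity)] at e3
  exact e3

variable {X : Type*} [MetricSpace X]

/-- An almost geodesic from `x` to a point outside `W` has to cross the frontier, at distance at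
most `d(x, y) + ε` from `x`. This allows depth in `W` to be measured from `Wᶜ`, where it behaves
well under thickening. -/
lemma infEDist_frontier_eq (hX : HasAlmostGeodesics X) {W : Set X} {x : X} (hx : x ∈ W) :
    Metric.infEDist x (frontier W) = Metric.infEDist x Wᶜ := by
  apply le_antisymm
  · refine Metric.le_infEDist.2 fun y hy => ?_
    refine ENNReal.le_of_forall_pos_le_add fun ε hε _ => ?_
    obtain ⟨γ, hγ⟩ := hX x y ε hε
    obtain ⟨t, ht⟩ : ∃ t, γ t ∈ frontier W := by
      -- A path avoiding the frontier would make the preimage of `W` clopen in the unit interval,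
      -- although it contains `0` and misses `1`.
      by_contra! h
      have := frontier_eq_empty_iff (s := γ ⁻¹' W) |>.1 (Set.eq_empty_of_forall_notMem fun t ht =>
          h t (γ.continuous.frontier_preimage_subset W ht))
      rcases this with h' | h'
      · exact h'.le (show γ 0 ∈ W by rwa [γ.source])
      · exact hy (by simpa [γ.target] using h'.ge (Set.mem_univ (1 : unitInterval)))
    refine (Metric.infEDist_le_edist_of_mem ht).trans ?_
    have h1 : dist x (γ t) ≤ dist x y + ε := by
      have := hγ t
      have := dist_nonneg (x := γ t) (y := y)
      linarith
    rw [edist_dist, edist_dist]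
    refine (ENNReal.ofReal_le_ofReal h1).trans ?_
    rw [ENNReal.ofReal_add (by positivity) (by positivity), ENNReal.ofReal_coe_nnreal]
  · rw [← Metric.infEDist_closure (s := Wᶜ)]
    refine Metric.infEDist_anti ?_
    rw [frontier_eq_closure_inter_closure]
    exact Set.inter_subset_right

variable {Γ : Type*} [Group Γ] [MulAction Γ X] [IsIsometricSMul Γ X]

/-- The quotient map is open, so the images of the balls about one point form an increasing open
cover of the compact quotient, and a single ball of radius `n` meets every orbit. Bringing both
points into that ball gives the constant `n + n`. -/
lemma exists_dist_smul_le [LocallyCompactSpace X]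
    [CompactSpace (MulAction.orbitRel.Quotient Γ X)] [Nonempty X] :
    ∃ (D : ℝ), 0 ≤ D ∧ ∀ x y : X, ∃ γ : Γ, dist (γ • x) y ≤ D := by
  obtain ⟨x₀⟩ := ‹Nonempty X›
  let pr : X → MulAction.orbitRel.Quotient Γ X := Quotient.mk _
  have hpr : IsOpenMap pr := isOpenMap_quotient_mk'_mul
  obtain ⟨n, hn⟩ : ∃ n : ℕ, pr '' Metric.ball x₀ n = Set.univ := by
    obtain ⟨t, ht⟩ := isCompact_univ.elim_directed_cover (fun n : ℕ => pr '' Metric.ball x₀ n)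
      (fun n => hpr _ Metric.isOpen_ball) (fun z _ => by
        obtain ⟨x, rfl⟩ := Quotient.exists_rep z
        obtain ⟨n, hn⟩ := exists_nat_gt (dist x x₀)
        exact Set.mem_iUnion.2 ⟨n, x, hn, rfl⟩)
      (directed_of_isDirected_le fun m n h =>
        Set.image_mono (Metric.ball_subset_ball (by exact_mod_cast h)))
    exact ⟨t, Set.univ_subset_iff.1 ht⟩
  have key : ∀ x : X, ∃ γ : Γ, dist (γ • x) x₀ ≤ n := by
    intro x
    have : pr x ∈ pr '' Metric.ball x₀ n := hn ▸ Set.mem_univ _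
    obtain ⟨y, hy, hxy⟩ := this
    obtain ⟨γ, rfl⟩ := Quotient.exact hxy
    exact ⟨γ, (Metric.mem_ball.1 hy).le⟩
  refine ⟨n + n, by positivity, fun x y => ?_⟩
  obtain ⟨γ, hγ⟩ := key x
  obtain ⟨δ, hδ⟩ := key y
  refine ⟨δ⁻¹ * γ, ?_⟩
  have : dist ((δ⁻¹ * γ) • x) y = dist (γ • x) (δ • y) := by
    rw [← dist_smul δ, smul_smul, mul_inv_cancel_left]
  rw [this]
  refine (dist_triangle_right _ _ x₀).trans (add_le_add hγ hδ)

/-- A Hopf–Rinow argument in which cocompactness replaces completeness: all closed balls of some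
fixed radius `r` are compact, and compactness of a ball propagates outwards in steps of `r / 2`. -/
lemma properSpace_of_cocompact (Γ : Type*) [Group Γ] [MulAction Γ X] [IsIsometricSMul Γ X]
    (hX : HasAlmostGeodesics X) [LocallyCompactSpace X]
    [CompactSpace (MulAction.orbitRel.Quotient Γ X)] : ProperSpace X := by
  rcases isEmpty_or_nonempty X with hE | hE
  · exact ⟨fun x => (IsEmpty.false x).elim⟩
  let pr : X → MulAction.orbitRel.Quotient Γ X := Quotient.mk _
  have hpr : IsOpenMap pr := isOpenMap_quotient_mk'_mul
  -- a uniform radius of compactness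
  obtain ⟨r, hr, hcomp⟩ : ∃ r > 0, ∀ x : X, IsCompact (Metric.closedBall x r) := by
    have hloc : ∀ x : X, ∃ r > 0, IsCompact (Metric.closedBall x (2 * r)) := by
      intro x
      obtain ⟨K, hK, hxK⟩ := exists_compact_mem_nhds x
      obtain ⟨ε, hε, hεK⟩ := Metric.nhds_basis_closedBall.mem_iff.1 hxK
      refine ⟨ε / 2, by positivity, hK.of_isClosed_subset Metric.isClosed_closedBall ?_⟩
      convert hεK using 2
      ring
    choose ρ hρ hρc using hloc
    obtain ⟨t, ht⟩ := isCompact_univ.elim_finite_subcover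
      (fun x : X => pr '' Metric.ball x (ρ x)) (fun x => hpr _ Metric.isOpen_ball) (fun z _ => by
        obtain ⟨x, rfl⟩ := Quotient.exists_rep z
        exact Set.mem_iUnion.2 ⟨x, x, Metric.mem_ball_self (hρ x), rfl⟩)
    have htne : t.Nonempty := by
      by_contra h
      rw [Finset.not_nonempty_iff_eq_empty] at h
      obtain ⟨x⟩ := hE
      have := ht (Set.mem_univ (pr x))
      simp [h] at this
    refine ⟨t.inf' htne ρ, (Finset.lt_inf'_iff htne).2 fun i _ => hρ i, fun x => ?_⟩
    have := ht (Set.mem_univ (pr x))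
    simp only [Set.mem_iUnion] at this
    obtain ⟨z, hz, y, hy, hxy⟩ := this
    obtain ⟨γ, rfl⟩ := Quotient.exact hxy
    have h1 : IsCompact (Metric.closedBall (γ • x) (t.inf' htne ρ)) := by
      refine (hρc z).of_isClosed_subset Metric.isClosed_closedBall
        (Metric.closedBall_subset_closedBall' ?_)
      have h2 := Finset.inf'_le ρ hz
      have h3 := Metric.mem_ball.1 hy
      change _ + dist (γ • x) z ≤ _
      change dist (γ • x) z < _ at h3
      linarith
    have h4 := h1.image (f := fun y : X => γ⁻¹ • y) (continuous_const_smul _)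
    rwa [Set.image_smul, Metric.smul_closedBall, inv_smul_smul] at h4
  -- A point `z` with `s < d(x, z) ≤ s + r/2` lies within `r/2 + r/8` of a point on the sphere of
  -- radius `s`, which is within `r/4` of a centre of the finite cover. The total `7r/8` is below
  -- `r`.
  have step : ∀ (x : X) (s : ℝ), 0 ≤ s → IsCompact (Metric.closedBall x s) →
      IsCompact (Metric.closedBall x (s + r / 2)) := by
    intro x s hs0 hs
    obtain ⟨t, ht⟩ := hs.elim_finite_subcover (fun y : X => Metric.ball y (r / 4))
      (fun y => Metric.isOpen_ball) (fun y _ => Set.mem_iUnion.2 ⟨y, Metric.mem_ball_self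
        (by positivity)⟩)
    have hK : IsCompact (Metric.closedBall x s ∪ ⋃ y ∈ t, Metric.closedBall y r) :=
      hs.union (t.isCompact_biUnion fun y _ => hcomp y)
    refine hK.of_isClosed_subset Metric.isClosed_closedBall fun z hz => ?_
    rcases le_or_gt (dist z x) s with hzs | hzs
    · exact Or.inl hzs
    right
    have hz' : dist x z ≤ s + r / 2 := by rw [dist_comm]; exact hz
    obtain ⟨γ, hγ⟩ := hX x z (r / 8) (by positivity)
    obtain ⟨u, hu⟩ : ∃ u, dist x (γ u) = s := by
      have hc : Continuous fun u => dist x (γ u) := continuous_const.dist γ.continuous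
      have := intermediate_value_univ (0 : unitInterval) 1 hc
      refine this ⟨by simpa using hs0, ?_⟩
      rw [γ.target, dist_comm]; exact hzs.le
    have hu' : γ u ∈ Metric.closedBall x s := by rw [Metric.mem_closedBall, dist_comm, hu]
    have := ht hu'
    simp only [Set.mem_iUnion] at this ⊢
    obtain ⟨y, hy, hyu⟩ := this
    refine ⟨y, hy, ?_⟩
    have h1 := hγ u
    have h2 : dist (γ u) y < r / 4 := hyu
    have h3 := dist_triangle_left z y (γ u)
    rw [Metric.mem_closedBall]
    linarith
  refine ⟨fun x s => ?_⟩
  have hn : ∀ n : ℕ, IsCompact (Metric.closedBall x (n * (r / 2))) := by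
    intro n
    induction n with
    | zero => simp
    | succ n ih =>
      have := step x _ (by positivity) ih
      convert this using 2
      push_cast; ring
  obtain ⟨n, hn'⟩ := exists_nat_gt (s / (r / 2))
  refine (hn n).of_isClosed_subset Metric.isClosed_closedBall
    (Metric.closedBall_subset_closedBall ?_)
  rw [div_lt_iff₀ (by positivity)] at hn'
  exact hn'.le

end LengthSpaces

/-! ### The index of linear maps. -/

section AlgebraicIndex

open LinearMap

variable {V W : Type*} [AddCommGroup V] [Module ℂ V] [AddCommGroup W] [Module ℂ W]

/-- Two endomorphisms intertwined by maps that are inverse to each other modulo the endomorphisms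
have the same index. -/
lemma index_eq_of_intertwine {F c : V →ₗ[ℂ] V} {T d : W →ₗ[ℂ] W} (a : V →ₗ[ℂ] W)
    (b : W →ₗ[ℂ] V) (haF : ∀ x, a (F x) = T (a x)) (hbT : ∀ y, b (T y) = F (b y))
    (hba : ∀ x, b (a x) = x - F (c x)) (hba' : ∀ x, b (a x) = x - c (F x))
    (hab : ∀ y, a (b y) = y - T (d y)) (hab' : ∀ y, a (b y) = y - d (T y)) :
    F.index = T.index := by
  -- On kernels the corrections `c ∘ F` and `d ∘ T` vanish, and modulo ranges so do `F ∘ c` and `T ∘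
  -- d`. Hence `a` and `b` induce mutually inverse isomorphisms of kernels and of cokernels, with no
  -- finiteness assumption.
  have ek : ker F ≃ₗ[ℂ] ker T :=
    LinearEquiv.ofLinearMap
      (a.restrict (p := ker F) (q := ker T) fun x hx => by
        rw [mem_ker] at hx ⊢; rw [← haF, hx, map_zero])
      (b.restrict (p := ker T) (q := ker F) fun x hx => by
        rw [mem_ker] at hx ⊢; rw [← hbT, hx, map_zero])
      (by
        ext ⟨y, hy⟩
        rw [mem_ker] at hy
        simp [LinearMap.restrict_apply, hab', hy])
      (by
        ext ⟨y, hy⟩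
        rw [mem_ker] at hy
        simp [LinearMap.restrict_apply, hba', hy])
  have ec : (V ⧸ range F) ≃ₗ[ℂ] (W ⧸ range T) :=
    LinearEquiv.ofLinearMap
      ((range F).mapQ (range T) a (by
        rintro _ ⟨x, rfl⟩; exact ⟨a x, (haF x).symm⟩))
      ((range T).mapQ (range F) b (by
        rintro _ ⟨x, rfl⟩; exact ⟨b x, (hbT x).symm⟩))
      (by
        apply Submodule.linearMap_qext
        ext y
        simp only [LinearMap.comp_apply, Submodule.mkQ_apply, Submodule.mapQ_apply, id_apply, hab]
        rw [Submodule.Quotient.eq]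
        exact ⟨-d y, by simp⟩)
      (by
        apply Submodule.linearMap_qext
        ext y
        simp only [LinearMap.comp_apply, Submodule.mkQ_apply, Submodule.mapQ_apply, id_apply, hba]
        rw [Submodule.Quotient.eq]
        exact ⟨-c y, by simp⟩)
  rw [index_eq_finrank_sub, index_eq_finrank_sub, ek.finrank_eq, ec.finrank_eq]

/-- `id + K` on `V` and on `range K` are intertwined by `K` and minus the inclusion, both
corrections being the identity. On the finite-dimensional space `range K` every index is zero. -/
lemma index_one_add_of_finite_range {K : V →ₗ[ℂ] V} (hK : K.HasFiniteRange) :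
    (LinearMap.id + K).index = 0 := by
  have hfin : FiniteDimensional ℂ (range K) := Module.Finite.of_fg hK.fg_range
  have h : (LinearMap.id + K).index =
      (LinearMap.id + K.rangeRestrict ∘ₗ (range K).subtype).index :=
    index_eq_of_intertwine (c := LinearMap.id) (d := LinearMap.id) K.rangeRestrict
      (-(range K).subtype) (fun x => by ext; simp) (fun y => by simp [add_comm]) (fun x => by simp)
      (fun x => by simp) (fun y => by ext; simp) (fun y => by ext; simp)
  rw [h, index_eq_of_finiteDimensional, sub_self]

end AlgebraicIndex

/-! ### Fredholm operators and stability of the index. -/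

section Fredholm

open LinearMap.FiniteRangeSetoid

variable {V W : Type*} [NormedAddCommGroup V] [NormedSpace ℂ V] [NormedAddCommGroup W]
  [NormedSpace ℂ W]

lemma fredholmIndex_eq_index (T : V →L[ℂ] V) : fredholmIndex T = T.toLinearMap.index := rfl

/-- Norm limits of operators of finite rank. -/
def IsApproximable (K : V →L[ℂ] W) : Prop :=
  K ∈ closure {F : V →L[ℂ] W | F.toLinearMap.HasFiniteRange}

lemma IsApproximable.add {K L : V →L[ℂ] W} (hK : IsApproximable K) (hL : IsApproximable L) :
    IsApproximable (K + L) :=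
  map_mem_closure₂ continuous_add hK hL fun _ ha _ hb => LinearMap.HasFiniteRange.add ha hb

lemma isApproximable_zero : IsApproximable (0 : V →L[ℂ] W) :=
  subset_closure LinearMap.HasFiniteRange.zero

lemma isApproximable_sum {ι : Type*} (s : Finset ι) {K : ι → V →L[ℂ] W}
    (hK : ∀ i ∈ s, IsApproximable (K i)) : IsApproximable (∑ i ∈ s, K i) :=
  Finset.sum_induction _ _ (fun _ _ => .add) isApproximable_zero hK

lemma IsApproximable.comp_left {U : Type*} [NormedAddCommGroup U] [NormedSpace ℂ U]
    {K : V →L[ℂ] W} (hK : IsApproximable K) (B : W →L[ℂ] U) : IsApproximable (B ∘L K) :=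
  map_mem_closure (ContinuousLinearMap.compL ℂ V W U B).continuous hK
    fun _ ha => LinearMap.HasFiniteRange.comp_left ha _

lemma IsApproximable.comp_right {U : Type*} [NormedAddCommGroup U] [NormedSpace ℂ U]
    {K : V →L[ℂ] W} (hK : IsApproximable K) (B : U →L[ℂ] V) : IsApproximable (K ∘L B) :=
  map_mem_closure (f := fun K : V →L[ℂ] W => K ∘L B)
    ((ContinuousLinearMap.compL ℂ U V W).flip B).continuous hK
    fun _ ha => LinearMap.HasFiniteRange.comp_right ha _

/-- A compact operator with values in a Hilbert space is a norm limit of operators of finite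
rank. -/
lemma IsCompactOperator.isApproximable {H : Type*} [NormedAddCommGroup H] [InnerProductSpace ℂ H]
    [CompleteSpace H] {K : V →L[ℂ] H} (hK : IsCompactOperator K) : IsApproximable K := by
  refine Metric.mem_closure_iff.2 fun ε hε => ?_
  have hc := hK.isCompact_closure_image_closedBall (f := K.toLinearMap) 1
  -- The approximation is `K` followed by the projection onto the span of a finite `ε/3`-net of the
  -- image of the unit ball; projecting costs at most twice the distance to the net.
  obtain ⟨t, ht, hcov⟩ := Metric.totallyBounded_iff.1 hc.totallyBounded (ε / 3) (by positivity)
  let S : Submodule ℂ H := Submodule.span ℂ t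
  have hS : FiniteDimensional ℂ S := FiniteDimensional.span_of_finite ℂ (ht)
  refine ⟨S.starProjection ∘L K, ?_, ?_⟩
  · have : (S.starProjection : H →L[ℂ] H).toLinearMap.HasFiniteRange := by
      rw [LinearMap.HasFiniteRange]
      have : LinearMap.range (S.starProjection : H →L[ℂ] H).toLinearMap = S :=
        Submodule.range_starProjection S
      rw [this]
      exact Submodule.FG.of_finite
    exact this.comp_right K.toLinearMap
  · rw [dist_eq_norm]
    refine lt_of_le_of_lt (ContinuousLinearMap.opNorm_le_of_unit_norm (C := 2 * ε / 3)
      (by positivity) fun x hx => ?_) (by linarith)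
    have hx' : K x ∈ closure (K.toLinearMap '' Metric.closedBall 0 1) :=
      subset_closure ⟨x, by simp [hx], rfl⟩
    have := hcov hx'
    simp only [Set.mem_iUnion] at this
    obtain ⟨y, hy, hxy⟩ := this
    have hyS : S.starProjection y = y :=
      Submodule.starProjection_eq_self_iff.2 (Submodule.subset_span hy)
    have e : (K - S.starProjection ∘L K) x = (K x - y) - S.starProjection (K x - y) := by
      simp [map_sub, hyS]
    rw [e]
    have h1 : ‖K x - y‖ < ε / 3 := by rw [← dist_eq_norm]; exact hxy
    have h2 : ‖S.starProjection (K x - y)‖ ≤ ‖K x - y‖ := S.norm_starProjection_apply_le _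
    refine (norm_sub_le _ _).trans ?_
    linarith

lemma ContinuousLinearMap.IsFredholm.finite_coker' {T : V →L[ℂ] W} (hT : T.IsFredholm) :
    FiniteDimensional ℂ (W ⧸ LinearMap.range T.toLinearMap) :=
  hT.finite_coker

lemma fredholmIndex_mul {S T : V →L[ℂ] V} (hS : S.IsFredholm) (hT : T.IsFredholm) :
    fredholmIndex (S * T) = fredholmIndex S + fredholmIndex T := by
  have := hS.finite_ker
  have := hT.finite_ker
  have := hS.finite_coker'
  have := hT.finite_coker'
  exact LinearMap.index_comp (f := T.toLinearMap) S.toLinearMap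

lemma isFredholm_mul {S T : V →L[ℂ] V} (hS : S.IsFredholm) (hT : T.IsFredholm) :
    (S * T).IsFredholm := by
  obtain ⟨S', hS'⟩ := hS.exists_isQuasiInverse
  obtain ⟨T', hT'⟩ := hT.exists_isQuasiInverse
  exact .of_isQuasiInverse (v := T' ∘L S') (LinearMap.IsQuasiInverse.comp hT' hS')

/-- A left and a right inverse modulo finite rank agree modulo finite rank, since both are congruent
to `A T B`. -/
lemma isFredholm_of_left_right {T A B : V →L[ℂ] V}
    (hA : A.toLinearMap ∘ₗ T.toLinearMap ≈ LinearMap.id)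
    (hB : T.toLinearMap ∘ₗ B.toLinearMap ≈ LinearMap.id) : T.IsFredholm := by
  refine .of_isQuasiInverse (v := A) ⟨hA, ?_⟩
  have h1 : A.toLinearMap ≈ B.toLinearMap := by
    have e1 : A.toLinearMap ≈ A.toLinearMap ∘ₗ (T.toLinearMap ∘ₗ B.toLinearMap) :=
      Setoid.symm (LinearMap.FiniteRangeSetoid.equiv_comp_left (u' := A.toLinearMap) hB)
    have e2 : (A.toLinearMap ∘ₗ T.toLinearMap) ∘ₗ B.toLinearMap ≈ B.toLinearMap :=
      LinearMap.FiniteRangeSetoid.equiv_comp_right (u := B.toLinearMap) hA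
    exact Setoid.trans e1 e2
  exact Setoid.trans (LinearMap.FiniteRangeSetoid.equiv_comp_left (u' := T.toLinearMap) h1) hB

lemma isFredholm_of_mul {T A B : V →L[ℂ] V} (hA : (A * T).IsFredholm) (hB : (T * B).IsFredholm) :
    T.IsFredholm := by
  obtain ⟨A', hA'⟩ := hA.exists_isQuasiInverse
  obtain ⟨B', hB'⟩ := hB.exists_isQuasiInverse
  exact isFredholm_of_left_right (A := A' * A) (B := B * B') hA'.1 hB'.2

lemma isFredholm_of_isUnit {T : V →L[ℂ] V} (hT : IsUnit T) : T.IsFredholm := by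
  obtain ⟨u, rfl⟩ := hT
  refine isFredholm_of_left_right (A := (↑u⁻¹ : V →L[ℂ] V)) (B := (↑u⁻¹ : V →L[ℂ] V)) ?_ ?_
  · have : (↑u⁻¹ : V →L[ℂ] V).toLinearMap ∘ₗ (↑u : V →L[ℂ] V).toLinearMap = LinearMap.id :=
      congrArg ContinuousLinearMap.toLinearMap u.inv_mul
    rw [this]
  · have : (↑u : V →L[ℂ] V).toLinearMap ∘ₗ (↑u⁻¹ : V →L[ℂ] V).toLinearMap = LinearMap.id :=
      congrArg ContinuousLinearMap.toLinearMap u.mul_inv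
    rw [this]

lemma fredholmIndex_one : fredholmIndex (1 : V →L[ℂ] V) = 0 :=
  LinearMap.index_id

lemma fredholmIndex_of_isUnit {T : V →L[ℂ] V} (hT : IsUnit T) : fredholmIndex T = 0 := by
  obtain ⟨u, rfl⟩ := hT
  have e : (↑u : V →L[ℂ] V).toLinearMap =
      (LinearEquiv.ofLinearMap (↑u : V →L[ℂ] V).toLinearMap (↑u⁻¹ : V →L[ℂ] V).toLinearMap
        (congrArg ContinuousLinearMap.toLinearMap u.mul_inv)
        (congrArg ContinuousLinearMap.toLinearMap u.inv_mul)).toLinearMap := rfl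
  rw [fredholmIndex_eq_index, e]
  exact LinearEquiv.index_eq_zero

lemma fredholmIndex_of_equiv_id {T : V →L[ℂ] V} (hT : T.toLinearMap ≈ LinearMap.id) :
    fredholmIndex T = 0 := by
  rw [LinearMap.FiniteRangeSetoid.equiv_iff_hasFiniteRange] at hT
  rw [fredholmIndex_eq_index, ← index_one_add_of_finite_range hT]
  congr 1
  abel

lemma fredholmIndex_eq_neg {S T : V →L[ℂ] V} (h : S.toLinearMap.IsQuasiInverse T.toLinearMap) :
    fredholmIndex T = - fredholmIndex S := by
  have h1 := fredholmIndex_of_equiv_id (T := S * T) h.1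
  rw [fredholmIndex_mul (.of_isQuasiInverse h.symm) (.of_isQuasiInverse h)] at h1
  omega

/-- Modulo finite rank, `S T'` is `1 + S (T' - T)`, which is invertible by the Neumann series;
likewise on the other side. So `T'` has a parametrix that differs from `S` by an invertible factor,
and the indices agree. -/
lemma fredholm_of_norm_lt [CompleteSpace V] {S T T' : V →L[ℂ] V}
    (h : S.toLinearMap.IsQuasiInverse T.toLinearMap) (hn : ‖S‖ * ‖T' - T‖ < 1) :
    T'.IsFredholm ∧ fredholmIndex T' = fredholmIndex T := by
  have hS : S.IsFredholm := .of_isQuasiInverse h.symm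
  obtain ⟨U, hU⟩ : IsUnit (1 + S * (T' - T)) := by
    have := isUnit_one_sub_of_norm_lt_one (x := -(S * (T' - T)))
      (by rw [norm_neg]; exact (norm_mul_le _ _).trans_lt hn)
    rwa [sub_neg_eq_add] at this
  obtain ⟨U', hU'⟩ : IsUnit (1 + (T' - T) * S) := by
    have := isUnit_one_sub_of_norm_lt_one (x := -((T' - T) * S))
      (by rw [norm_neg]; exact (norm_mul_le _ _).trans_lt (by rwa [mul_comm]))
    rwa [sub_neg_eq_add] at this
  have h1 : (S * T').toLinearMap ≈ (U : V →L[ℂ] V).toLinearMap := by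
    have := h.1
    change (S * T).toLinearMap ≈ LinearMap.id at this
    rw [LinearMap.FiniteRangeSetoid.equiv_iff_hasFiniteRange] at this ⊢
    convert this using 1
    rw [hU]
    ext x; simp; abel
  have h2 : (T' * S).toLinearMap ≈ (U' : V →L[ℂ] V).toLinearMap := by
    have := h.2
    change (T * S).toLinearMap ≈ LinearMap.id at this
    rw [LinearMap.FiniteRangeSetoid.equiv_iff_hasFiniteRange] at this ⊢
    convert this using 1
    rw [hU']
    ext x; simp; abel
  have hl : ((↑U⁻¹ * S) * T').toLinearMap ≈ LinearMap.id := by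
    have := LinearMap.FiniteRangeSetoid.equiv_comp_left (u' := (↑U⁻¹ : V →L[ℂ] V).toLinearMap) h1
    have e : (↑U⁻¹ : V →L[ℂ] V).toLinearMap ∘ₗ (U : V →L[ℂ] V).toLinearMap = LinearMap.id :=
      congrArg ContinuousLinearMap.toLinearMap U.inv_mul
    rwa [e] at this
  have hr : (T' * (S * ↑U'⁻¹)).toLinearMap ≈ LinearMap.id := by
    have := LinearMap.FiniteRangeSetoid.equiv_comp_right (u := (↑U'⁻¹ : V →L[ℂ] V).toLinearMap) h2
    have e : (U' : V →L[ℂ] V).toLinearMap ∘ₗ (↑U'⁻¹ : V →L[ℂ] V).toLinearMap = LinearMap.id :=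
      congrArg ContinuousLinearMap.toLinearMap U'.mul_inv
    rwa [e] at this
  have hT' : T'.IsFredholm := isFredholm_of_left_right (A := (↑U⁻¹ : V →L[ℂ] V) * S)
    (B := S * (↑U'⁻¹ : V →L[ℂ] V)) hl hr
  refine ⟨hT', ?_⟩
  have h3 := fredholmIndex_of_equiv_id hl
  rw [fredholmIndex_mul (isFredholm_mul (isFredholm_of_isUnit (Units.isUnit _)) hS) hT',
    fredholmIndex_mul (isFredholm_of_isUnit (Units.isUnit _)) hS,
    fredholmIndex_of_isUnit (Units.isUnit _)] at h3
  have h4 := fredholmIndex_eq_neg h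
  omega

/-- The Fredholm index is locally constant. -/
lemma eventually_fredholm [CompleteSpace V] {T : V →L[ℂ] V} (hT : T.IsFredholm) :
    ∀ᶠ T' in nhds T, T'.IsFredholm ∧ fredholmIndex T' = fredholmIndex T := by
  obtain ⟨S, hS⟩ := hT.exists_isQuasiInverse
  have hc : Continuous fun T' : V →L[ℂ] V => ‖S‖ * ‖T' - T‖ := by fun_prop
  have : ∀ᶠ T' in nhds T, ‖S‖ * ‖T' - T‖ < 1 :=
    hc.continuousAt.eventually_lt_const (by simp)
  exact this.mono fun T' h => fredholm_of_norm_lt hS h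

lemma fredholm_add_finite_rank {T F : V →L[ℂ] V} (hT : T.IsFredholm)
    (hF : F.toLinearMap.HasFiniteRange) :
    (T + F).IsFredholm ∧ fredholmIndex (T + F) = fredholmIndex T := by
  obtain ⟨S, hS⟩ := hT.exists_isQuasiInverse
  have h : S.toLinearMap.IsQuasiInverse (T + F).toLinearMap := by
    refine hS.congr (Setoid.refl _) ?_
    rw [LinearMap.FiniteRangeSetoid.equiv_iff_hasFiniteRange]
    simpa using hF
  exact ⟨.of_isQuasiInverse h, by rw [fredholmIndex_eq_neg h, fredholmIndex_eq_neg hS]⟩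

/-- Split `K` into a small part, absorbed by local constancy of the index, and a finite rank part.
The argument needs no inner product on `V`, which matters because it is applied to `Fin n → H` with
the sup norm. -/
lemma fredholm_add_approximable [CompleteSpace V] {T K : V →L[ℂ] V} (hT : T.IsFredholm)
    (hK : IsApproximable K) :
    (T + K).IsFredholm ∧ fredholmIndex (T + K) = fredholmIndex T := by
  have hc : Filter.Tendsto (fun F : V →L[ℂ] V => T + (K - F)) (nhds K) (nhds T) := by
    have : Continuous fun F : V →L[ℂ] V => T + (K - F) := by fun_prop
    simpa using this.tendsto K
  obtain ⟨F, ⟨h1, h2⟩, hF⟩ := mem_closure_iff_nhds.1 hK _ (hc.eventually (eventually_fredholm hT))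
  have := fredholm_add_finite_rank h1 hF
  rw [show T + (K - F) + F = T + K by abel] at this
  exact ⟨this.1, this.2.trans h2⟩

lemma isFredholm_of_mul_sub_one [CompleteSpace V] {T S : V →L[ℂ] V}
    (h1 : IsApproximable (S * T - 1)) (h2 : IsApproximable (T * S - 1)) : T.IsFredholm := by
  have ho : (1 : V →L[ℂ] V).IsFredholm := isFredholm_of_isUnit isUnit_one
  have e1 := (fredholm_add_approximable ho h1).1
  have e2 := (fredholm_add_approximable ho h2).1
  rw [add_sub_cancel] at e1 e2
  exact isFredholm_of_mul e1 e2

section Corner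

variable {v : V →L[ℂ] W} {w : W →L[ℂ] V}

/-- Extending an operator by the identity to a larger space does not change the index. -/
lemma fredholmIndex_corner (hwv : w ∘L v = 1) (T : V →L[ℂ] V) :
    fredholmIndex (1 - v ∘L w + v ∘L T ∘L w) = fredholmIndex T := by
  have h : ∀ x, w (v x) = x := fun x => congrArg (fun f : V →L[ℂ] V => f x) hwv
  rw [fredholmIndex_eq_index, fredholmIndex_eq_index]
  -- On the complement of the corner the operator is the identity, so the idempotent `1 - v w` is
  -- itself the correction term.
  refine index_eq_of_intertwine (c := (1 - v ∘L w).toLinearMap) (d := 0) w.toLinearMap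
    v.toLinearMap ?_ ?_ ?_ ?_ ?_ ?_
  all_goals intro x; simp [h]

lemma isFredholm_of_corner (hwv : w ∘L v = 1) {T : V →L[ℂ] V}
    (hT : (1 - v ∘L w + v ∘L T ∘L w).IsFredholm) : T.IsFredholm := by
  have h : ∀ x, w (v x) = x := fun x => congrArg (fun f : V →L[ℂ] V => f x) hwv
  obtain ⟨S, h1, h2⟩ := hT.exists_isQuasiInverse
  refine isFredholm_of_left_right (A := w ∘L S ∘L v) (B := w ∘L S ∘L v) ?_ ?_
  · have := LinearMap.FiniteRangeSetoid.equiv_comp_left (u' := w.toLinearMap)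
      (LinearMap.FiniteRangeSetoid.equiv_comp_right (u := v.toLinearMap) h1)
    rw [LinearMap.FiniteRangeSetoid.equiv_iff_hasFiniteRange] at this ⊢
    convert this using 1
    ext x
    simp [h]
  · have := LinearMap.FiniteRangeSetoid.equiv_comp_left (u' := w.toLinearMap)
      (LinearMap.FiniteRangeSetoid.equiv_comp_right (u := v.toLinearMap) h2)
    rw [LinearMap.FiniteRangeSetoid.equiv_iff_hasFiniteRange] at this ⊢
    convert this using 1
    ext x
    simp [h]

end Corner

end Fredholm

/-! ### Exponentials of idempotents and lifting of projections in C*-algebras. -/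

section CStar

variable {M N : Type*} [CStarAlgebra M] [CStarAlgebra N]

/-- The factor `-2πi` in the exponential map. -/
def expFactor : ℂ := -(2 * Real.pi * Complex.I)

lemma exp_expFactor : NormedSpace.exp expFactor = 1 := by
  rw [← Complex.exp_eq_exp_ℂ, expFactor, Complex.exp_neg, Complex.exp_two_pi_mul_I, inv_one]

/-- The idempotent defines a continuous homomorphism `(x, y) ↦ x (1 - p) + y p` from `ℂ × ℂ`, where
the exponential is computed in each coordinate. -/
lemma exp_smul_of_isIdempotentElem {p : M} (hp : p * p = p) :
    NormedSpace.exp (expFactor • p) = 1 := by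
  let _ : NormedAlgebra ℚ M := NormedAlgebra.restrictScalars ℚ ℂ M
  let φ : ℂ × ℂ →ₐ[ℂ] M := AlgHom.ofLinearMap
    ((LinearMap.toSpanSingleton ℂ M (1 - p)).coprod (LinearMap.toSpanSingleton ℂ M p))
    (by simp)
    (by
      rintro ⟨x, y⟩ ⟨x', y'⟩
      simp only [Prod.mk_mul_mk, LinearMap.coprod_apply, LinearMap.toSpanSingleton_apply,
        add_mul, mul_add, smul_mul_smul_comm, sub_mul, mul_sub, one_mul, mul_one, hp, sub_self,
        smul_zero, add_zero, zero_add, sub_zero])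
  have hφ : Continuous φ := by
    change Continuous fun x : ℂ × ℂ => x.1 • (1 - p) + x.2 • p
    fun_prop
  have h1 : φ (0, expFactor) = expFactor • p := by
    change (0 : ℂ) • (1 - p) + expFactor • p = _
    simp
  rw [← h1, ← NormedSpace.map_exp φ hφ]
  have h2 : NormedSpace.exp ((0, expFactor) : ℂ × ℂ) = 1 := by
    ext1
    · rw [Prod.fst_exp, NormedSpace.exp_zero]; rfl
    · rw [Prod.snd_exp, exp_expFactor]; rfl
  rw [h2, map_one]

lemma exp_smul_mem_unitary {a : M} (ha : IsSelfAdjoint a) :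
    NormedSpace.exp (expFactor • a) ∈ unitary M := by
  let _ : NormedAlgebra ℚ M := NormedAlgebra.restrictScalars ℚ ℂ M
  refine NormedSpace.exp_mem_unitary_of_mem_skewAdjoint (skewAdjoint.mem_iff.2 ?_)
  rw [star_smul, ha.star_eq, ← neg_smul]
  congr 1
  simp [expFactor]

/-- A continuous function that is `0` below `1/4` and `1` above `3/4`. -/
def spectralCut (x : ℝ) : ℝ := max 0 (min 1 (2 * x - 1 / 2))

lemma continuous_spectralCut : Continuous spectralCut := by
  unfold spectralCut
  fun_prop

/-- `t (1 - t)` takes the value `3/16` exactly at `1/4` and `3/4`. The norm bound therefore keeps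
the spectrum away from the interval where the cut-off is neither `0` nor `1`. -/
lemma spectrum_cut {x : M} (hx : IsSelfAdjoint x) (hn : ‖x * x - x‖ < 3 / 16) :
    ∀ t ∈ spectrum ℝ x, spectralCut t * spectralCut t = spectralCut t := by
  intro t ht
  have h1 : x * x - x = cfc (fun s : ℝ => s * s - s) x := by
    rw [cfc_sub .., cfc_mul .., cfc_id' ℝ x]
  have h2 : |t * t - t| < 3 / 16 := by
    refine lt_of_le_of_lt ?_ hn
    rw [h1]
    simpa using norm_apply_le_norm_cfc (fun s : ℝ => s * s - s) x ht
  rw [abs_lt] at h2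
  have h3 : t ≤ 1 / 4 ∨ 3 / 4 ≤ t := by
    by_contra! h
    nlinarith
  rcases h3 with h3 | h3
  · have : spectralCut t = 0 := by
      unfold spectralCut
      rw [max_eq_left]
      exact (min_le_right _ _).trans (by linarith)
    rw [this, mul_zero]
  · have : spectralCut t = 1 := by
      unfold spectralCut
      rw [min_eq_left (by linarith)]
      simp
    rw [this, mul_one]

lemma isStarProjection_cut {x : M} (hx : IsSelfAdjoint x) (hn : ‖x * x - x‖ < 3 / 16) :
    IsStarProjection (cfc spectralCut x) := by
  have hc := continuous_spectralCut
  refine ⟨?_, cfc_predicate _ _⟩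
  change _ * _ = _
  rw [← cfc_mul ..]
  exact cfc_congr (spectrum_cut hx hn)

lemma cut_of_isStarProjection {p : M} (hp : IsStarProjection p) : cfc spectralCut p = p := by
  conv_rhs => rw [← cfc_id' ℝ p hp.isSelfAdjoint]
  refine cfc_congr fun t ht => ?_
  have h1 : p * p - p = cfc (fun s : ℝ => s * s - s) p := by
    have := hp.isSelfAdjoint
    rw [cfc_sub .., cfc_mul .., cfc_id' ℝ p]
  have h2 : |t * t - t| ≤ 0 := by
    have := norm_apply_le_norm_cfc (fun s : ℝ => s * s - s) p ht
      (by fun_prop) hp.isSelfAdjoint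
    rw [← h1, hp.isIdempotentElem.eq, sub_self, norm_zero] at this
    simpa using this
  have h3 : t * (t - 1) = 0 := by
    have := abs_nonpos_iff.1 h2
    linarith
  rcases mul_eq_zero.1 h3 with h | h
  · simp [h, spectralCut]
  · have : t = 1 := by linarith
    subst this
    norm_num [spectralCut]

/-- Self-adjoint lifts of nearby projections are joined by a path of self-adjoint lifts of
projections, up to changing the lifts. -/
lemma exists_path_of_lifts (Φ : M →⋆ₐ[ℂ] N) {a b : M} (ha : IsSelfAdjoint a)
    (hb : IsSelfAdjoint b) (hpa : IsStarProjection (Φ a)) (hpb : IsStarProjection (Φ b))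
    (hab : ‖Φ b - Φ a‖ < 1 / 20) :
    ∃ c : unitInterval → M, Continuous c ∧ (∀ t, IsSelfAdjoint (c t)) ∧
      (∀ t, IsStarProjection (Φ (c t))) ∧ Φ (c 0) = Φ a ∧ Φ (c 1) = Φ b := by
  have hΦ : Continuous Φ := by
    exact AddMonoidHomClass.continuous_of_bound Φ 1
      (fun x => by simpa using NonUnitalStarAlgHom.norm_apply_le Φ x)
  -- The images of the segment are only almost projections. Applying the cut-off by functional
  -- calculus upstairs keeps the path self-adjoint and makes its image a path of projections; the
  -- end points may move, but not their images, which the cut-off fixes.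
  let x : unitInterval → M := fun t => a + (t : ℝ) • (b - a)
  have hxs : ∀ t, IsSelfAdjoint (x t) := fun t =>
    ha.add ((IsSelfAdjoint.all (t : ℝ)).smul (hb.sub ha))
  have hxc : Continuous x := by fun_prop
  have hΦx : ∀ t, Φ (x t) = Φ a + (t : ℝ) • (Φ b - Φ a) := by
    intro t
    have := map_smul Φ ((t : ℝ) : ℂ) (b - a)
    simp only [Complex.coe_smul] at this
    simp only [x, map_add, map_sub, this]
  have hcut := continuous_spectralCut
  have hmap : ∀ t, Φ (cfc spectralCut (x t)) = cfc spectralCut (Φ (x t)) := fun t =>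
    StarAlgHomClass.map_cfc (S := ℂ) Φ spectralCut (x t) hcut.continuousOn hΦ (hxs t)
      ((hxs t).map Φ)
  have hpan : ‖Φ a‖ ≤ 1 := hpa.norm_le
  refine ⟨fun t => cfc spectralCut (x t), ?_, fun t => cfc_predicate _ _, fun t => ?_, ?_, ?_⟩
  -- Continuity of the functional calculus along a path requires one compact set containing all the
  -- spectra.
  · obtain ⟨C, hC⟩ : ∃ C, ∀ t, ‖x t‖ ≤ C := by
      obtain ⟨C, hC⟩ := (isCompact_range hxc.norm).bddAbove
      exact ⟨C, fun t => hC ⟨t, rfl⟩⟩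
    refine Continuous.cfc' (s := Metric.closedBall 0 (C * ‖(1 : M)‖))
      (isCompact_closedBall _ _) spectralCut hxc (fun t => ?_) hcut.continuousOn hxs
    refine (spectrum.subset_closedBall_norm_mul (x t)).trans
      (Metric.closedBall_subset_closedBall ?_)
    gcongr
    exact hC t
  · rw [hmap]
    refine isStarProjection_cut ((hxs t).map Φ) ?_
    rw [hΦx]
    set p := Φ a
    set e := (t : ℝ) • (Φ b - p) with he
    have hen : ‖e‖ < 1 / 20 := by
      rw [he, norm_smul]
      refine lt_of_le_of_lt ?_ hab
      have h1 : ‖(t : ℝ)‖ ≤ 1 := by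
        rw [Real.norm_of_nonneg t.2.1]; exact t.2.2
      exact mul_le_of_le_one_left (norm_nonneg _) h1
    have hpp : p * p = p := hpa.isIdempotentElem
    -- With `‖e‖ < 1/20` the right-hand side has norm below `3/20 + 1/400 < 3/16`.
    have e1 : (p + e) * (p + e) - (p + e) = p * e + e * p + e * e - e := by
      simp only [add_mul, mul_add, hpp]
      abel
    rw [e1]
    have n1 : ‖p * e‖ ≤ 1 * ‖e‖ := (norm_mul_le _ _).trans (by gcongr)
    have n2 : ‖e * p‖ ≤ ‖e‖ * 1 := (norm_mul_le _ _).trans (by gcongr)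
    have n3 : ‖e * e‖ ≤ ‖e‖ * ‖e‖ := norm_mul_le _ _
    have n4 := norm_sub_le (p * e + e * p + e * e) e
    have n5 := norm_add_le (p * e + e * p) (e * e)
    have n6 := norm_add_le (p * e) (e * p)
    nlinarith [norm_nonneg e]
  · simp only [hmap, hΦx]
    simpa using cut_of_isStarProjection hpa
  · simp only [hmap, hΦx]
    simpa using cut_of_isStarProjection hpb

end CStar

/-! ### Transfer to matrices over C*-algebras. -/

section MatrixCStar

variable {A B : Type*} [CStarAlgebra A] [CStarAlgebra B] {n : ℕ}

/-- The C*-norm on matrices lives on the synonym `CStarMatrix`, with the same algebra and topology;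
results pass to `Matrix` by unfolding, once an order is chosen on the coefficients. -/
lemma matrix_exp_smul_of_isStarProjection {p : Matrix (Fin n) (Fin n) A}
    (hp : IsStarProjection p) : NormedSpace.exp (expFactor • p) = 1 := by
  let _ : PartialOrder A := CStarAlgebra.spectralOrder A
  have _ : StarOrderedRing A := CStarAlgebra.spectralOrderedRing A
  exact exp_smul_of_isIdempotentElem (M := CStarMatrix (Fin n) (Fin n) A) hp.isIdempotentElem

lemma matrix_exp_smul_mem_unitary {a : Matrix (Fin n) (Fin n) A} (ha : IsSelfAdjoint a) :
    NormedSpace.exp (expFactor • a) ∈ unitary (Matrix (Fin n) (Fin n) A) := by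
  let _ : PartialOrder A := CStarAlgebra.spectralOrder A
  have _ : StarOrderedRing A := CStarAlgebra.spectralOrderedRing A
  exact exp_smul_mem_unitary (M := CStarMatrix (Fin n) (Fin n) A) ha

lemma continuous_matrix_exp : Continuous
    (NormedSpace.exp : Matrix (Fin n) (Fin n) A → Matrix (Fin n) (Fin n) A) := by
  let _ : PartialOrder A := CStarAlgebra.spectralOrder A
  have _ : StarOrderedRing A := CStarAlgebra.spectralOrderedRing A
  let _ : NormedAlgebra ℚ (CStarMatrix (Fin n) (Fin n) A) := NormedAlgebra.restrictScalars ℚ ℂ _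
  exact NormedSpace.exp_continuous (𝔸 := CStarMatrix (Fin n) (Fin n) A)

/-- Entrywise application of a *-homomorphism to matrices. -/
def matrixStarMap (φ : A →⋆ₐ[ℂ] B) (n : ℕ)
    [PartialOrder A] [StarOrderedRing A] [PartialOrder B] [StarOrderedRing B] :
    CStarMatrix (Fin n) (Fin n) A →⋆ₐ[ℂ] CStarMatrix (Fin n) (Fin n) B where
  toFun a := Matrix.map a φ
  map_one' := Matrix.map_one φ (map_zero φ) (map_one φ)
  map_mul' a b := Matrix.map_mul (f := (φ : A →+* B))
  map_zero' := Matrix.map_zero φ (map_zero φ)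
  map_add' a b := Matrix.map_add φ (map_add φ) a b
  commutes' r := by
    ext i j
    have h := (φ : A →ₐ[ℂ] B).mapMatrix (m := Fin n) |>.commutes r
    exact congrFun (congrFun h i) j
  map_star' a := by
    ext i j
    exact map_star φ (a j i)

lemma matrix_map_star_exp (φ : A →⋆ₐ[ℂ] B) (a : Matrix (Fin n) (Fin n) A) :
    (NormedSpace.exp a).map φ = NormedSpace.exp (a.map φ) := by
  let _ : PartialOrder A := CStarAlgebra.spectralOrder A
  have _ : StarOrderedRing A := CStarAlgebra.spectralOrderedRing A
  let _ : PartialOrder B := CStarAlgebra.spectralOrder B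
  have _ : StarOrderedRing B := CStarAlgebra.spectralOrderedRing B
  let _ : NormedAlgebra ℚ (CStarMatrix (Fin n) (Fin n) A) := NormedAlgebra.restrictScalars ℚ ℂ _
  let _ : NormedAlgebra ℚ (CStarMatrix (Fin n) (Fin n) B) := NormedAlgebra.restrictScalars ℚ ℂ _
  exact NormedSpace.map_exp (𝔸 := CStarMatrix (Fin n) (Fin n) A) (matrixStarMap φ n)
    (map_continuous _) a

/-- The smallness condition of `exists_path_of_lifts` becomes a neighbourhood of `t₀`, so that the
statement only refers to the entrywise topology in which homotopies are taken. -/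
lemma matrix_exists_path_of_lifts (φ : A →⋆ₐ[ℂ] B)
    {p : unitInterval → Matrix (Fin n) (Fin n) B} (hp : Continuous p) (t₀ : unitInterval) :
    ∀ᶠ t in nhds t₀, ∀ a b : Matrix (Fin n) (Fin n) A, IsSelfAdjoint a → IsSelfAdjoint b →
      a.map φ = p t₀ → b.map φ = p t → IsStarProjection (p t₀) → IsStarProjection (p t) →
      ∃ c : unitInterval → Matrix (Fin n) (Fin n) A, Continuous c ∧ (∀ t, IsSelfAdjoint (c t)) ∧
      (∀ t, IsStarProjection ((c t).map φ)) ∧ (c 0).map φ = a.map φ ∧ (c 1).map φ = b.map φ := by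
  let _ : PartialOrder A := CStarAlgebra.spectralOrder A
  have _ : StarOrderedRing A := CStarAlgebra.spectralOrderedRing A
  let _ : PartialOrder B := CStarAlgebra.spectralOrder B
  have _ : StarOrderedRing B := CStarAlgebra.spectralOrderedRing B
  let p' : unitInterval → CStarMatrix (Fin n) (Fin n) B := p
  have hp' : Continuous p' := hp
  have h0 : Continuous fun t => ‖p' t - p' t₀‖ := by fun_prop
  have h1 : ∀ᶠ t in nhds t₀, ‖p' t - p' t₀‖ < 1 / 20 :=
    h0.continuousAt.eventually_lt_const (by simp)
  filter_upwards [h1] with t ht a b ha hb hpa hpb hqa hqb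
  refine exists_path_of_lifts (M := CStarMatrix (Fin n) (Fin n) A) (matrixStarMap φ n)
    (a := a) (b := b) ha hb ?_ ?_ ?_
  · change IsStarProjection (a.map φ); rwa [hpa]
  · change IsStarProjection (b.map φ); rwa [hpb]
  · have ea : matrixStarMap φ n a = p' t₀ := hpa
    have eb : matrixStarMap φ n b = p' t := hpb
    rwa [ea, eb]

end MatrixCStar

/-! ### Block sums and K-theory classes. -/

section BlockSums

variable {R : Type*} [Ring R] {m n : ℕ}

lemma blockSum_mul (a a' : Matrix (Fin m) (Fin m) R) (b b' : Matrix (Fin n) (Fin n) R) :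
    blockSum a b * blockSum a' b' = blockSum (a * a') (b * b') := by
  simp only [blockSum, Matrix.reindex_apply]
  rw [Matrix.submatrix_mul_equiv, Matrix.fromBlocks_multiply]
  simp

lemma blockSum_one : blockSum (1 : Matrix (Fin m) (Fin m) R) (1 : Matrix (Fin n) (Fin n) R) = 1 := by
  simp [blockSum, Matrix.fromBlocks_one]

lemma blockSum_add (a a' : Matrix (Fin m) (Fin m) R) (b b' : Matrix (Fin n) (Fin n) R) :
    blockSum (a + a') (b + b') = blockSum a b + blockSum a' b' := by
  ext i j
  simp only [blockSum, Matrix.reindex_apply, Matrix.submatrix_apply, Matrix.add_apply]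
  rcases finSumFinEquiv.symm i with i | i <;> rcases finSumFinEquiv.symm j with j | j <;> simp

lemma blockSum_zero : blockSum (0 : Matrix (Fin m) (Fin m) R) (0 : Matrix (Fin n) (Fin n) R) = 0 := by
  simp [blockSum, Matrix.fromBlocks_zero]

lemma blockSum_smul {A : Type*} [Ring A] [Algebra ℂ A] (z : ℂ) (a : Matrix (Fin m) (Fin m) A)
    (b : Matrix (Fin n) (Fin n) A) : z • blockSum a b = blockSum (z • a) (z • b) := by
  ext i j
  simp only [blockSum, Matrix.reindex_apply, Matrix.submatrix_apply, Matrix.smul_apply]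
  rcases finSumFinEquiv.symm i with i | i <;> rcases finSumFinEquiv.symm j with j | j <;> simp

variable [StarRing R]

lemma star_blockSum (a : Matrix (Fin m) (Fin m) R) (b : Matrix (Fin n) (Fin n) R) :
    star (blockSum a b) = blockSum (star a) (star b) := by
  simp only [blockSum, Matrix.star_eq_conjTranspose, Matrix.reindex_apply,
    Matrix.conjTranspose_submatrix, Matrix.fromBlocks_conjTranspose, Matrix.conjTranspose_zero]

lemma isSelfAdjoint_blockSum {a : Matrix (Fin m) (Fin m) R}
    {b : Matrix (Fin n) (Fin n) R} (ha : IsSelfAdjoint a) (hb : IsSelfAdjoint b) :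
    IsSelfAdjoint (blockSum a b) := by
  change star _ = _
  rw [star_blockSum, ha.star_eq, hb.star_eq]

lemma isStarProjection_blockSum {p : Matrix (Fin m) (Fin m) R} {q : Matrix (Fin n) (Fin n) R}
    (hp : IsStarProjection p) (hq : IsStarProjection q) : IsStarProjection (blockSum p q) := by
  refine ⟨?_, ?_⟩
  · change _ * _ = _
    rw [blockSum_mul, hp.isIdempotentElem.eq, hq.isIdempotentElem.eq]
  · change star _ = _
    rw [star_blockSum, hp.isSelfAdjoint.star_eq, hq.isSelfAdjoint.star_eq]

lemma blockSum_mem_unitary {u : Matrix (Fin m) (Fin m) R} {v : Matrix (Fin n) (Fin n) R}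
    (hu : u ∈ unitary (Matrix (Fin m) (Fin m) R)) (hv : v ∈ unitary (Matrix (Fin n) (Fin n) R)) :
    blockSum u v ∈ unitary (Matrix (Fin (m + n)) (Fin (m + n)) R) := by
  rw [Unitary.mem_iff] at hu hv ⊢
  rw [star_blockSum, blockSum_mul, blockSum_mul, hu.1, hu.2, hv.1, hv.2, blockSum_one]
  exact ⟨rfl, rfl⟩

end BlockSums

section KClasses

variable {R : Type*} [Ring R] [StarRing R] [TopologicalSpace R] {m n : ℕ}

lemma K0Unital.mk_eq_of_joinedIn {p p' : Matrix (Fin n) (Fin n) R} (h : JoinedIn (projMat R n) p p') :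
    K0Unital.mk p h.source_mem = K0Unital.mk p' h.target_mem :=
  (QuotientAddGroup.eq_iff_sub_mem).2 (AddSubgroup.subset_closure
    (Or.inl (Or.inl ⟨n, ⟨p, h.source_mem⟩, ⟨p', h.target_mem⟩, h, rfl⟩)))

lemma K1Unital.mk_eq_of_joinedIn {u u' : Matrix (Fin n) (Fin n) R}
    (h : JoinedIn (unitaryMat R n) u u') :
    K1Unital.mk u h.source_mem = K1Unital.mk u' h.target_mem :=
  (QuotientAddGroup.eq_iff_sub_mem).2 (AddSubgroup.subset_closure
    (Or.inl (Or.inl ⟨n, ⟨u, h.source_mem⟩, ⟨u', h.target_mem⟩, h, rfl⟩)))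

lemma K0Unital.mk_blockSum {p : Matrix (Fin m) (Fin m) R} {q : Matrix (Fin n) (Fin n) R}
    (hp : IsStarProjection p) (hq : IsStarProjection q) :
    K0Unital.mk (blockSum p q) (isStarProjection_blockSum hp hq) =
      K0Unital.mk p hp + K0Unital.mk q hq :=
  (QuotientAddGroup.eq_iff_sub_mem).2 (AddSubgroup.subset_closure
    (Or.inl (Or.inr ⟨m, n, ⟨p, hp⟩, ⟨q, hq⟩, ⟨_, isStarProjection_blockSum hp hq⟩, rfl, rfl⟩)))

lemma K1Unital.mk_blockSum {u : Matrix (Fin m) (Fin m) R} {v : Matrix (Fin n) (Fin n) R}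
    (hu : u ∈ unitary (Matrix (Fin m) (Fin m) R)) (hv : v ∈ unitary (Matrix (Fin n) (Fin n) R)) :
    K1Unital.mk (blockSum u v) (blockSum_mem_unitary hu hv) =
      K1Unital.mk u hu + K1Unital.mk v hv :=
  (QuotientAddGroup.eq_iff_sub_mem).2 (AddSubgroup.subset_closure
    (Or.inl (Or.inr ⟨m, n, ⟨u, hu⟩, ⟨v, hv⟩, ⟨_, blockSum_mem_unitary hu hv⟩, rfl, rfl⟩)))

lemma K0Unital.mk_zero (n : ℕ) :
    K0Unital.mk (0 : Matrix (Fin n) (Fin n) R) (.zero _) = 0 :=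
  (QuotientAddGroup.eq_zero_iff _).2 (AddSubgroup.subset_closure
    (Or.inr ⟨n, ⟨_, (.zero _)⟩, rfl, rfl⟩))

lemma K1Unital.mk_one (n : ℕ) :
    K1Unital.mk (1 : Matrix (Fin n) (Fin n) R) (one_mem (unitary _)) = 0 :=
  (QuotientAddGroup.eq_zero_iff _).2 (AddSubgroup.subset_closure
    (Or.inr ⟨n, ⟨_, one_mem (unitary _)⟩, rfl, rfl⟩))

variable [Algebra ℝ R] [StarModule ℝ R] [IsTopologicalRing R] [ContinuousSMul ℝ R]

/-- `p ⊕ (1 - p)` is homotopic to `1 ⊕ 0`. -/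
lemma K0Unital.mk_add_mk_one_sub {p : Matrix (Fin n) (Fin n) R} (hp : IsStarProjection p) :
    K0Unital.mk p hp + K0Unital.mk (1 - p) hp.one_sub = K0Unital.mk (n := n) 1 (.one _) := by
  have h1 : K0Unital.mk (1 : Matrix (Fin n) (Fin n) R) (.one _) =
      K0Unital.mk (1 : Matrix (Fin n) (Fin n) R) (.one _) +
        K0Unital.mk (0 : Matrix (Fin n) (Fin n) R) (.zero _) := by
    rw [K0Unital.mk_zero, add_zero]
  rw [h1, ← K0Unital.mk_blockSum, ← K0Unital.mk_blockSum]
  let c : unitInterval → ℝ := fun t => Real.cos (Real.pi / 2 * t)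
  let s : unitInterval → ℝ := fun t => Real.sin (Real.pi / 2 * t)
  have hcs : ∀ t, s t * s t + c t * c t = 1 := fun t => by
    have := Real.sin_sq_add_cos_sq (Real.pi / 2 * t)
    simp only [s, c]; nlinarith
  have hcc : Continuous c := by fun_prop
  have hsc : Continuous s := by fun_prop
  have hq := hp.one_sub
  set q := 1 - p with hqdef
  have hpp : p * p = p := hp.isIdempotentElem
  have hqq : q * q = q := hq.isIdempotentElem
  have hpq : p * q = 0 := by rw [hqdef, mul_sub, mul_one, hpp, sub_self]
  have hqp : q * p = 0 := by rw [hqdef, sub_mul, one_mul, hpp, sub_self]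
  -- The projection `q = 1 - p` is rotated from the second block into the first. It stays orthogonal
  -- to `p` throughout, so adding `p` in the first block keeps a projection.
  let F : unitInterval → Matrix (Fin (n + n)) (Fin (n + n)) R := fun t =>
    Matrix.reindex finSumFinEquiv finSumFinEquiv
      (Matrix.fromBlocks (p + (s t * s t) • q) ((s t * c t) • q) ((s t * c t) • q)
        ((c t * c t) • q))
  have hF : Continuous F := by
    simp only [F, Matrix.reindex_apply]
    exact (Continuous.matrix_fromBlocks (by fun_prop) (by fun_prop) (by fun_prop)
      (by fun_prop)).matrix_submatrix _ _
  have hFp : ∀ t, IsStarProjection (F t) := by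
    intro t
    refine ⟨?_, ?_⟩
    · change F t * F t = F t
      simp only [F, Matrix.reindex_apply]
      rw [Matrix.submatrix_mul_equiv, Matrix.fromBlocks_multiply]
      congr 2
      · simp only [add_mul, mul_add, smul_mul_assoc, mul_smul_comm, hpp, hqq, hpq, hqp, smul_zero,
          add_zero, smul_smul, zero_add, add_assoc]
        rw [← add_smul]
        congr 2
        linear_combination (s t * s t) * hcs t
      · simp only [add_mul, smul_mul_assoc, mul_smul_comm, hqq, hpq, smul_smul,
          zero_add]
        rw [← add_smul]
        congr 1
        linear_combination (s t * c t) * hcs t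
      · simp only [mul_add, smul_mul_assoc, mul_smul_comm, hqq, hqp, smul_zero,
          smul_smul, zero_add]
        rw [← add_smul]
        congr 1
        linear_combination (s t * c t) * hcs t
      · simp only [smul_mul_assoc, mul_smul_comm, hqq, smul_smul]
        rw [← add_smul]
        congr 1
        linear_combination (c t * c t) * hcs t
    · change star (F t) = F t
      have e1 : p.conjTranspose = p := hp.isSelfAdjoint
      have e2 : q.conjTranspose = q := hq.isSelfAdjoint
      simp only [F, Matrix.star_eq_conjTranspose, Matrix.reindex_apply,
        Matrix.conjTranspose_submatrix, Matrix.fromBlocks_conjTranspose,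
        Matrix.conjTranspose_add, Matrix.conjTranspose_smul, e1, e2, star_trivial]
  refine K0Unital.mk_eq_of_joinedIn ⟨⟨⟨F, hF⟩, ?_, ?_⟩, fun t => hFp t⟩
  · simp [F, c, s, blockSum]
    rfl
  · simp [F, c, s, blockSum, hqdef]

end KClasses

/-! ### The exponential map of an extension. -/

section ExponentialMap

variable {J Q B : Type*} [NonUnitalCStarAlgebra J] [NonUnitalCStarAlgebra Q]
  [NonUnitalCStarAlgebra B]

/-- Short exact sequences `J → Q → B`. -/
structure IsExtension (ι : J →⋆ₙₐ[ℂ] Q) (q : Q →⋆ₙₐ[ℂ] B) : Prop where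
  injective : Function.Injective ι
  surjective : Function.Surjective q
  exact : ∀ x, q x = 0 ↔ ∃ j, ι j = x

variable {ι : J →⋆ₙₐ[ℂ] Q} {q : Q →⋆ₙₐ[ℂ] B} {m n : ℕ}

/-- `a` is a self-adjoint lift of `p`, and `u` is the exponential of `-2πi a`. -/
structure IsExpLift (ι : J →⋆ₙₐ[ℂ] Q) (q : Q →⋆ₙₐ[ℂ] B)
    (p : Matrix (Fin n) (Fin n) (Unitization ℂ B)) (a : Matrix (Fin n) (Fin n) (Unitization ℂ Q))
    (u : Matrix (Fin n) (Fin n) (Unitization ℂ J)) : Prop where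
  isSelfAdjoint : IsSelfAdjoint a
  map_eq : a.map (Unitization.starMap q) = p
  exp_eq : u.map (Unitization.starMap ι) = NormedSpace.exp (expFactor • a)

lemma matrix_map_injective (h : Function.Injective ι) :
    Function.Injective fun u : Matrix (Fin n) (Fin n) (Unitization ℂ J) =>
      u.map (Unitization.starMap ι) :=
  Matrix.map_injective (Unitization.starMap_injective h)

lemma starMap_fst (φ : J →⋆ₙₐ[ℂ] Q) (x : Unitization ℂ J) :
    (Unitization.starMap φ x).fst = x.fst := by
  induction x using Unitization.ind with
  | inl_add_inr r a =>
    rw [map_add, Unitization.starMap_inr]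
    change (Unitization.starMap φ (Unitization.inl r)).fst + _ = _
    rw [Unitization.starMap_inl]
    simp [Unitization.algebraMap_eq_inl]

lemma starMap_snd (φ : J →⋆ₙₐ[ℂ] Q) (x : Unitization ℂ J) :
    (Unitization.starMap φ x).snd = φ x.snd := by
  induction x using Unitization.ind with
  | inl_add_inr r a =>
    rw [map_add, Unitization.starMap_inr]
    change (Unitization.starMap φ (Unitization.inl r)).snd + _ = _
    rw [Unitization.starMap_inl]
    simp [Unitization.algebraMap_eq_inl]

/-- Each entry of `v` has non-scalar part in the kernel of `q`, hence in the image of `ι`; scalar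
parts lift to themselves. -/
lemma IsExtension.exists_map_eq (h : IsExtension ι q)
    {v : Matrix (Fin n) (Fin n) (Unitization ℂ Q)} (hv : v.map (Unitization.starMap q) = 1) :
    ∃ u : Matrix (Fin n) (Fin n) (Unitization ℂ J), u.map (Unitization.starMap ι) = v := by
  have : ∀ i j, ∃ x, Unitization.starMap ι x = v i j := by
    intro i j
    have h1 : Unitization.starMap q (v i j) = (1 : Matrix _ _ _) i j := congrFun (congrFun hv i) j
    have h2 : q (v i j).snd = 0 := by
      rw [← starMap_snd, h1, Matrix.one_apply]
      split_ifs <;> simp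
    obtain ⟨y, hy⟩ := (h.exact _).1 h2
    refine ⟨Unitization.inl (v i j).fst + (y : Unitization ℂ J), ?_⟩
    refine Unitization.ext ?_ ?_
    · rw [starMap_fst]
      simp
    · rw [starMap_snd]
      simpa using hy
  choose u hu using this
  exact ⟨Matrix.of u, by ext i j : 1; exact hu i j⟩

lemma mem_unitary_of_map {u : Matrix (Fin n) (Fin n) (Unitization ℂ J)}
    (h : Function.Injective ι)
    (hu : u.map (Unitization.starMap ι) ∈ unitary (Matrix (Fin n) (Fin n) (Unitization ℂ Q))) :
    u ∈ unitary (Matrix (Fin n) (Fin n) (Unitization ℂ J)) := by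
  have e1 : ∀ a b : Matrix (Fin n) (Fin n) (Unitization ℂ J), (a * b).map (Unitization.starMap ι) =
      a.map (Unitization.starMap ι) * b.map (Unitization.starMap ι) := fun a b =>
    Matrix.map_mul (f := (Unitization.starMap ι : Unitization ℂ J →+* Unitization ℂ Q))
  have e2 : (star u).map (Unitization.starMap ι) = star (u.map (Unitization.starMap ι)) := by
    ext i j : 1
    exact map_star (Unitization.starMap ι) (u j i)
  have e3 : (1 : Matrix (Fin n) (Fin n) (Unitization ℂ J)).map (Unitization.starMap ι) = 1 :=
    Matrix.map_one _ (map_zero _) (map_one _)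
  rw [Unitary.mem_iff] at hu ⊢
  constructor
  · apply matrix_map_injective h
    simp only [e1, e2, e3, hu.1]
  · apply matrix_map_injective h
    simp only [e1, e2, e3, hu.2]

lemma IsExpLift.mem_unitary (h : IsExtension ι q) {p a}
    {u : Matrix (Fin n) (Fin n) (Unitization ℂ J)} (hu : IsExpLift ι q p a u) :
    u ∈ unitary (Matrix (Fin n) (Fin n) (Unitization ℂ J)) :=
  mem_unitary_of_map h.injective (hu.exp_eq ▸ matrix_exp_smul_mem_unitary hu.isSelfAdjoint)

lemma IsExtension.exists_exp (h : IsExtension ι q) {a : Matrix (Fin n) (Fin n) (Unitization ℂ Q)}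
    (hp : IsStarProjection (a.map (Unitization.starMap q))) :
    ∃ u : Matrix (Fin n) (Fin n) (Unitization ℂ J),
      u.map (Unitization.starMap ι) = NormedSpace.exp (expFactor • a) := by
  apply h.exists_map_eq
  rw [matrix_map_star_exp]
  have : (expFactor • a).map (Unitization.starMap q) =
      expFactor • a.map (Unitization.starMap q) := by
    ext i j : 1
    exact map_smul (Unitization.starMap q) _ _
  rw [this, matrix_exp_smul_of_isStarProjection hp]

lemma IsExtension.exists_expLift (h : IsExtension ι q)
    {p : Matrix (Fin n) (Fin n) (Unitization ℂ B)} (hp : IsStarProjection p) :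
    ∃ a u, IsExpLift ι q p a u := by
  have hs : Function.Surjective (Unitization.starMap q) := Unitization.starMap_surjective h.surjective
  choose b hb using fun i j => hs (p i j)
  let b' : Matrix (Fin n) (Fin n) (Unitization ℂ Q) := Matrix.of b
  -- Averaging an arbitrary entrywise lift with its adjoint keeps a lift, as `p` is self-adjoint.
  let a : Matrix (Fin n) (Fin n) (Unitization ℂ Q) := (1 / 2 : ℂ) • (b' + star b')
  have ha : IsSelfAdjoint a := by
    change star a = a
    simp only [a, star_smul, star_add, star_star, add_comm]
    congr 1
    simp
  have hap : a.map (Unitization.starMap q) = p := by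
    ext i j : 1
    have h1 : star (p j i) = p i j := congrFun (congrFun hp.isSelfAdjoint.star_eq i) j
    change Unitization.starMap q ((1 / 2 : ℂ) • (b i j + star (b j i))) = p i j
    rw [map_smul, map_add, map_star, hb, hb, h1, ← two_smul ℂ, smul_smul]
    norm_num
  obtain ⟨u, hu⟩ := h.exists_exp (a := a) (by rwa [hap])
  exact ⟨a, u, ha, hap, hu⟩

/-- A path of self-adjoint lifts of projections gives a path of unitaries. -/
lemma IsExtension.joinedIn_of_path (h : IsExtension ι q)
    {c : unitInterval → Matrix (Fin n) (Fin n) (Unitization ℂ Q)} (hc : Continuous c)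
    (hs : ∀ t, IsSelfAdjoint (c t))
    (hp : ∀ t, IsStarProjection ((c t).map (Unitization.starMap q)))
    {u v : Matrix (Fin n) (Fin n) (Unitization ℂ J)}
    (hu : u.map (Unitization.starMap ι) = NormedSpace.exp (expFactor • c 0))
    (hv : v.map (Unitization.starMap ι) = NormedSpace.exp (expFactor • c 1)) :
    JoinedIn (unitaryMat (Unitization ℂ J) n) u v := by
  choose w hw using fun t => h.exists_exp (hp t)
  -- An injective *-homomorphism of C*-algebras is isometric, so continuity of a path of unitaries
  -- over `J⁺` may be checked over `Q⁺`, where it is a path of exponentials.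
  have hemb : Topology.IsEmbedding fun u : Matrix (Fin n) (Fin n) (Unitization ℂ J) =>
      u.map (Unitization.starMap ι) := by
    have h1 : Topology.IsEmbedding (Unitization.starMap ι) :=
      (NonUnitalStarAlgHom.isometry (Unitization.starMap ι)
        (Unitization.starMap_injective h.injective)).isEmbedding
    exact Topology.IsEmbedding.piMap fun _ => Topology.IsEmbedding.piMap fun _ => h1
  have hwc : Continuous w := by
    rw [hemb.continuous_iff]
    have : (fun u : Matrix (Fin n) (Fin n) (Unitization ℂ J) =>
        u.map (Unitization.starMap ι)) ∘ w = fun t => NormedSpace.exp (expFactor • c t) :=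
      funext hw
    rw [this]
    exact continuous_matrix_exp.comp (by fun_prop : Continuous fun t => expFactor • c t)
  refine ⟨⟨⟨w, hwc⟩, ?_, ?_⟩, fun t => ?_⟩
  · exact matrix_map_injective h.injective ((hw 0).trans hu.symm)
  · exact matrix_map_injective h.injective ((hw 1).trans hv.symm)
  · exact mem_unitary_of_map h.injective
      ((hw t).symm ▸ matrix_exp_smul_mem_unitary (hs t))

/-- Self-adjoint lifts of a fixed `p` form a convex set, so the segment between them gives a
homotopy of exponentials. -/
lemma IsExpLift.joinedIn (h : IsExtension ι q) {p a a'}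
    {u u' : Matrix (Fin n) (Fin n) (Unitization ℂ J)} (hp : IsStarProjection p)
    (hu : IsExpLift ι q p a u) (hu' : IsExpLift ι q p a' u') :
    JoinedIn (unitaryMat (Unitization ℂ J) n) u u' := by
  refine h.joinedIn_of_path (c := fun t => a + (t : ℝ) • (a' - a)) ?_ (fun t => ?_) (fun t => ?_)
    (by simpa using hu.exp_eq) (by simpa using hu'.exp_eq)
  · fun_prop
  · exact hu.isSelfAdjoint.add
      ((IsSelfAdjoint.all (t : ℝ)).smul (hu'.isSelfAdjoint.sub hu.isSelfAdjoint))
  · have : (a + (t : ℝ) • (a' - a)).map (Unitization.starMap q) = p := by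
      ext i j : 1
      have h1 : Unitization.starMap q (a i j) = p i j := congrFun (congrFun hu.map_eq i) j
      have h2 : Unitization.starMap q (a' i j) = p i j := congrFun (congrFun hu'.map_eq i) j
      change Unitization.starMap q (a i j + (t : ℝ) • (a' i j - a i j)) = p i j
      have h3 := map_smul (Unitization.starMap q) ((t : ℝ) : ℂ) (a' i j - a i j)
      simp only [Complex.coe_smul] at h3
      rw [map_add, h3, map_sub, h1, h2, sub_self, smul_zero, add_zero]
    rwa [this]

/-- The class in `K₁(J)` of the exponential of a self-adjoint lift. -/
def IsExtension.expClass (h : IsExtension ι q) (g : MatGen (Unitization ℂ B) (projMat _)) : K1 J :=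
  K1Unital.mk _ ((h.exists_expLift g.mat.2).choose_spec.choose_spec.mem_unitary h)

lemma IsExtension.expClass_eq (h : IsExtension ι q) {p a}
    {u : Matrix (Fin n) (Fin n) (Unitization ℂ J)} (hp : IsStarProjection p)
    (hu : IsExpLift ι q p a u) :
    h.expClass ⟨n, p, hp⟩ = K1Unital.mk u (hu.mem_unitary h) :=
  K1Unital.mk_eq_of_joinedIn
    (IsExpLift.joinedIn h hp (h.exists_expLift hp).choose_spec.choose_spec hu)

/-- The class is locally constant along a path of projections: nearby projections have lifts joined
through lifts of projections, and the class does not depend on which lift is used. -/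
lemma IsExtension.expClass_eq_of_joinedIn (h : IsExtension ι q)
    {p p' : Matrix (Fin n) (Fin n) (Unitization ℂ B)}
    (hpp : JoinedIn (projMat (Unitization ℂ B) n) p p') :
    h.expClass ⟨n, p, hpp.source_mem⟩ = h.expClass ⟨n, p', hpp.target_mem⟩ := by
  obtain ⟨γ, hγ⟩ := hpp
  let f : unitInterval → K1 J := fun t => h.expClass ⟨n, γ t, hγ t⟩
  have hf : IsLocallyConstant f := by
    rw [IsLocallyConstant.iff_eventually_eq]
    intro t₀
    filter_upwards [matrix_exists_path_of_lifts (Unitization.starMap q) γ.continuous t₀] with t ht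
    obtain ⟨a, u, hau⟩ := h.exists_expLift (hγ t)
    obtain ⟨b, v, hbv⟩ := h.exists_expLift (hγ t₀)
    obtain ⟨c, hc, hcs, hcp, hc0, hc1⟩ := ht b a hbv.isSelfAdjoint hau.isSelfAdjoint hbv.map_eq
      hau.map_eq (hγ t₀) (hγ t)
    obtain ⟨u', hu'⟩ := h.exists_exp (hcp 1)
    obtain ⟨v', hv'⟩ := h.exists_exp (hcp 0)
    have e1 : IsExpLift ι q (γ t) (c 1) u' := ⟨hcs 1, hc1.trans hau.map_eq, hu'⟩
    have e0 : IsExpLift ι q (γ t₀) (c 0) v' := ⟨hcs 0, hc0.trans hbv.map_eq, hv'⟩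
    change h.expClass ⟨n, γ t, hγ t⟩ = h.expClass ⟨n, γ t₀, hγ t₀⟩
    rw [h.expClass_eq (hγ t) e1, h.expClass_eq (hγ t₀) e0]
    exact (K1Unital.mk_eq_of_joinedIn (h.joinedIn_of_path hc hcs hcp hv' hu')).symm
  have := hf.apply_eq_of_isPreconnected isPreconnected_univ (Set.mem_univ 0) (Set.mem_univ 1)
  simpa [f] using this

/-- The block sum is a continuous unital ring homomorphism from the product, and such maps commute
with the exponential. -/
lemma exp_blockSum {A : Type*} [CStarAlgebra A] (a : Matrix (Fin m) (Fin m) A)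
    (b : Matrix (Fin n) (Fin n) A) :
    NormedSpace.exp (blockSum a b) = blockSum (NormedSpace.exp a) (NormedSpace.exp b) := by
  let _ : PartialOrder A := CStarAlgebra.spectralOrder A
  have _ : StarOrderedRing A := CStarAlgebra.spectralOrderedRing A
  let _ : NormedAlgebra ℚ (CStarMatrix (Fin m) (Fin m) A) := NormedAlgebra.restrictScalars ℚ ℂ _
  let _ : NormedAlgebra ℚ (CStarMatrix (Fin n) (Fin n) A) := NormedAlgebra.restrictScalars ℚ ℂ _
  let _ : NormedAlgebra ℚ (CStarMatrix (Fin (m + n)) (Fin (m + n)) A) :=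
    NormedAlgebra.restrictScalars ℚ ℂ _
  let φ : CStarMatrix (Fin m) (Fin m) A × CStarMatrix (Fin n) (Fin n) A →+*
      CStarMatrix (Fin (m + n)) (Fin (m + n)) A :=
    { toFun := fun x => blockSum x.1 x.2
      map_one' := blockSum_one
      map_mul' := fun x y => (blockSum_mul _ _ _ _).symm
      map_zero' := blockSum_zero
      map_add' := fun x y => blockSum_add _ _ _ _ }
  have hφ : Continuous φ := by
    change Continuous fun x : Matrix (Fin m) (Fin m) A × Matrix (Fin n) (Fin n) A =>
      blockSum x.1 x.2
    simp only [blockSum, Matrix.reindex_apply]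
    exact (Continuous.matrix_fromBlocks continuous_fst continuous_const continuous_const
      continuous_snd).matrix_submatrix _ _
  have := NormedSpace.map_exp φ hφ (a, b)
  refine this.symm.trans ?_
  change blockSum _ _ = _
  rw [Prod.fst_exp, Prod.snd_exp]
  rfl

lemma IsExpLift.blockSum {p a u} {p' a' u'} (hu : IsExpLift (n := m) ι q p a u)
    (hu' : IsExpLift (n := n) ι q p' a' u') :
    IsExpLift ι q (blockSum p p') (blockSum a a') (blockSum u u') where
  isSelfAdjoint := isSelfAdjoint_blockSum hu.isSelfAdjoint hu'.isSelfAdjoint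
  map_eq := by rw [map_blockSum, hu.map_eq, hu'.map_eq]
  exp_eq := by rw [map_blockSum, hu.exp_eq, hu'.exp_eq, blockSum_smul, exp_blockSum]

/-- The map `K₀(B⁺) → K₁(J)`, `[p] ↦ [exp(-2πi a)]`. -/
def IsExtension.expHomUnital (h : IsExtension ι q) : K0Unital (Unitization ℂ B) →+ K1 J :=
  QuotientAddGroup.lift _ (FreeAbelianGroup.lift h.expClass) (by
    rw [AddSubgroup.closure_le]
    rintro x ((⟨n, a, b, hab, rfl⟩ | ⟨m, n, a, b, c, hc, rfl⟩) | ⟨n, a, ha, rfl⟩)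
    · rw [SetLike.mem_coe, AddMonoidHom.mem_ker, map_sub, FreeAbelianGroup.lift_apply_of,
        FreeAbelianGroup.lift_apply_of, sub_eq_zero]
      exact h.expClass_eq_of_joinedIn hab
    · rw [SetLike.mem_coe, AddMonoidHom.mem_ker, map_sub, map_add,
        FreeAbelianGroup.lift_apply_of, FreeAbelianGroup.lift_apply_of,
        FreeAbelianGroup.lift_apply_of, sub_eq_zero]
      obtain ⟨a₁, u₁, h₁⟩ := h.exists_expLift a.2
      obtain ⟨a₂, u₂, h₂⟩ := h.exists_expLift b.2
      obtain ⟨c, hc'⟩ := c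
      obtain rfl : c = _ := hc
      rw [h.expClass_eq hc' (h₁.blockSum h₂), h.expClass_eq a.2 h₁, h.expClass_eq b.2 h₂,
        ← K1Unital.mk_blockSum]
    · rw [SetLike.mem_coe, AddMonoidHom.mem_ker, FreeAbelianGroup.lift_apply_of]
      obtain ⟨a, ha'⟩ := a
      obtain rfl : a = 0 := ha
      have : IsExpLift ι q (0 : Matrix (Fin n) (Fin n) (Unitization ℂ B)) 0 1 :=
        ⟨.zero _, by simp [Matrix.map_zero], by
          rw [smul_zero, NormedSpace.exp_zero, Matrix.map_one _ (map_zero _) (map_one _)]⟩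
      rw [h.expClass_eq ha' this]
      exact K1Unital.mk_one n)

lemma IsExtension.expHomUnital_mk (h : IsExtension ι q) {p a}
    {u : Matrix (Fin n) (Fin n) (Unitization ℂ J)} (hp : IsStarProjection p)
    (hu : IsExpLift ι q p a u) :
    h.expHomUnital (K0Unital.mk p hp) = K1Unital.mk u (hu.mem_unitary h) := by
  rw [← h.expClass_eq hp hu]
  exact FreeAbelianGroup.lift_apply_of h.expClass ⟨n, p, hp⟩

/-- A scalar projection has a scalar projection as its lift, and the exponential of that lift is
`1`. Hence subtracting `[s(p)]` does not change the value. -/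
lemma IsExtension.expHomUnital_scalarMat (h : IsExtension ι q)
    {p : Matrix (Fin n) (Fin n) (Unitization ℂ B)} (hp : IsStarProjection p) :
    h.expHomUnital (K0Unital.mk (scalarMat p) (isStarProjection_map _ hp)) = 0 := by
  let s : Matrix (Fin n) (Fin n) ℂ := p.map (scalarPart B)
  have hs : IsStarProjection s := isStarProjection_map _ hp
  have hs' := isStarProjection_map (StarAlgHom.ofId ℂ (Unitization ℂ Q)) hs
  have : IsExpLift ι q (scalarMat p) (s.map (StarAlgHom.ofId ℂ (Unitization ℂ Q))) 1 := by
    refine ⟨hs'.isSelfAdjoint, ?_, ?_⟩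
    · ext i j : 1
      change Unitization.starMap q (algebraMap ℂ _ (s i j)) = algebraMap ℂ _ (s i j)
      exact AlgHomClass.commutes (Unitization.starMap q) _
    · rw [matrix_exp_smul_of_isStarProjection hs', Matrix.map_one _ (map_zero _) (map_one _)]
  exact (h.expHomUnital_mk _ this).trans (K1Unital.mk_one n)

lemma K0Unital.exists_eq_sub {R : Type*} [Ring R] [StarRing R] [TopologicalSpace R]
    (x : K0Unital R) : ∃ (m n : ℕ) (p : Matrix (Fin m) (Fin m) R) (hp : IsStarProjection p)
      (q : Matrix (Fin n) (Fin n) R) (hq : IsStarProjection q),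
      x = K0Unital.mk p hp - K0Unital.mk q hq := by
  obtain ⟨y, rfl⟩ := QuotientAddGroup.mk_surjective x
  induction y using FreeAbelianGroup.induction_on with
  | zero =>
    exact ⟨0, 0, 0, .zero _, 0, .zero _, by rw [sub_self]; rfl⟩
  | of g =>
    exact ⟨g.size, 0, g.mat.1, g.mat.2, 0, .zero _, by rw [K0Unital.mk_zero, sub_zero]; rfl⟩
  | neg g =>
    exact ⟨0, g.size, 0, .zero _, g.mat.1, g.mat.2, by rw [K0Unital.mk_zero, zero_sub]; rfl⟩
  | add y z hy hz =>
    obtain ⟨m, n, p, hp, q, hq, e⟩ := hy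
    obtain ⟨m', n', p', hp', q', hq', e'⟩ := hz
    refine ⟨m + m', n + n', blockSum p p', isStarProjection_blockSum hp hp', blockSum q q',
      isStarProjection_blockSum hq hq', ?_⟩
    rw [QuotientAddGroup.mk_add, e, e', K0Unital.mk_blockSum hp hp', K0Unital.mk_blockSum hq hq']
    abel

/-- The standard picture of `K₀`: every class is of the form `[p] - [s(p)]`. -/
lemma K0.exists_eq_sub (x : K0 B) :
    ∃ (n : ℕ) (p : Matrix (Fin n) (Fin n) (Unitization ℂ B)) (hp : IsStarProjection p),
      (x : K0Unital (Unitization ℂ B)) =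
        K0Unital.mk p hp - K0Unital.mk (scalarMat p) (isStarProjection_map _ hp) := by
  obtain ⟨m, n, p, hp, q, hq, hx⟩ := K0Unital.exists_eq_sub (x : K0Unital (Unitization ℂ B))
  let σ : Unitization ℂ B →⋆ₐ[ℂ] Unitization ℂ B :=
    (StarAlgHom.ofId ℂ (Unitization ℂ B)).comp (scalarPart B)
  have hofc : Continuous (StarAlgHom.ofId ℂ (Unitization ℂ B)) :=
    continuous_algebraMap ℂ (Unitization ℂ B)
  have h0 : K0Unital.map (scalarPart B) (continuous_scalarPart B)
      (K0Unital.mk p hp - K0Unital.mk q hq) = 0 := by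
    rw [← hx]; exact x.2
  -- Membership in `K0 B` says that the scalar parts cancel in `K₀(ℂ)`; pushing this along `ℂ → B⁺`
  -- gives the relation in `K₀(B⁺)`.
  have h1 : K0Unital.mk (scalarMat p) (isStarProjection_map _ hp) -
      K0Unital.mk (scalarMat q) (isStarProjection_map _ hq) = 0 := by
    have := congrArg (K0Unital.map (StarAlgHom.ofId ℂ (Unitization ℂ B)) hofc) h0
    rw [map_zero, map_sub, map_sub] at this
    exact this
  -- Since `-[q] = [1 - q] - [1]`, the projection `p ⊕ (1 - q)` represents `[p] - [q] + [1]`, and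
  -- the scalar term removes the rest because `[s(p)] = [s(q)]`.
  refine ⟨m + n, blockSum p (1 - q), isStarProjection_blockSum hp hq.one_sub, ?_⟩
  have e1 : K0Unital.mk (scalarMat (blockSum p (1 - q)))
      (isStarProjection_map _ (isStarProjection_blockSum hp hq.one_sub)) =
      K0Unital.mk (scalarMat p) (isStarProjection_map _ hp) +
        (K0Unital.mk (n := n) 1 (.one _) - K0Unital.mk (scalarMat q) (isStarProjection_map _ hq)) := by
    have hσq := isStarProjection_map σ hq
    have e2 : K0Unital.mk (scalarMat q) (isStarProjection_map _ hq) +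
        K0Unital.mk (1 - q.map σ) hσq.one_sub = K0Unital.mk 1 (.one _) :=
      K0Unital.mk_add_mk_one_sub hσq
    have e3 : scalarMat (blockSum p (1 - q)) = blockSum (scalarMat p) (1 - q.map σ) := by
      rw [scalarMat, map_blockSum]
      congr 1
      change (1 - q).map σ = 1 - q.map σ
      rw [Matrix.map_sub _ (map_sub σ), Matrix.map_one _ (map_zero σ) (map_one σ)]
    rw [← e2, add_sub_cancel_left]
    refine Eq.trans ?_ (K0Unital.mk_blockSum (isStarProjection_map _ hp) hσq.one_sub)
    congr 1
  rw [K0Unital.mk_blockSum hp hq.one_sub, e1, hx, ← K0Unital.mk_add_mk_one_sub hq]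
  rw [sub_eq_zero] at h1
  rw [h1]
  abel

/-- The exponential map of an extension of C*-algebras. -/
def IsExtension.expHom (h : IsExtension ι q) : K0 B →+ K1 J :=
  h.expHomUnital.comp (K0 B).subtype

lemma IsExtension.isExponentialMap (h : IsExtension ι q) : IsExponentialMap ι q h.expHom := by
  intro x y
  constructor
  · rintro rfl
    obtain ⟨n, p, hp, hx⟩ := K0.exists_eq_sub x
    obtain ⟨a, u, hau⟩ := h.exists_expLift hp
    refine ⟨n, p, hp, a, u, hau.mem_unitary h, hau.isSelfAdjoint, hau.map_eq, hau.exp_eq, hx, ?_⟩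
    change h.expHomUnital (x : K0Unital (Unitization ℂ B)) = _
    rw [hx, map_sub, h.expHomUnital_scalarMat hp, sub_zero, h.expHomUnital_mk hp hau]
  · rintro ⟨n, p, hp, a, u, hu, ha, hap, hua, hx, rfl⟩
    change h.expHomUnital (x : K0Unital (Unitization ℂ B)) = _
    rw [hx, map_sub, h.expHomUnital_scalarMat hp, sub_zero, h.expHomUnital_mk hp ⟨ha, hap, hua⟩]

lemma IsExponentialMap.unique {E E' : K0 B →+ K1 J} (hE : IsExponentialMap ι q E)
    (hE' : IsExponentialMap ι q E') : E' = E := by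
  ext x
  exact (hE' x (E x)).2 ((hE x (E x)).1 rfl)

end ExponentialMap

/-! ### Compact operators, indicator functions and multiplication operators on `L²`. -/

section Approximable

variable {H K : Type*} [NormedAddCommGroup H] [InnerProductSpace ℂ H] [CompleteSpace H]
  [NormedAddCommGroup K] [InnerProductSpace ℂ K] [CompleteSpace K]

lemma isApproximable_iff_isCompactOperator {T : H →L[ℂ] K} :
    IsApproximable T ↔ IsCompactOperator T := by
  refine ⟨fun h => ?_, fun h => h.isApproximable⟩
  have hc : IsClosed {T : H →L[ℂ] K | IsCompactOperator T} := isClosed_setOfPred_isCompactOperator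
  refine closure_minimal (fun F hF => ?_) hc h
  have hF' : FiniteDimensional ℂ (LinearMap.range F.toLinearMap) := Module.Finite.iff_fg.2 hF
  have : ProperSpace (LinearMap.range F.toLinearMap) := FiniteDimensional.proper ℂ _
  exact (isCompactOperator_of_locallyCompactSpace_dom
    (F.codRestrict (LinearMap.range F.toLinearMap) fun x => ⟨x, rfl⟩)).clm_comp
    (LinearMap.range F.toLinearMap).subtypeL

/-- If `P` projects onto the finite-dimensional range of `F`, then `F = P F` and so `F* = F* P` has
finite rank; the adjoint is continuous. -/
lemma IsApproximable.adjoint {T : H →L[ℂ] K} (hT : IsApproximable T) :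
    IsApproximable (ContinuousLinearMap.adjoint T) := by
  refine map_mem_closure (f := fun T : H →L[ℂ] K => ContinuousLinearMap.adjoint T)
    (ContinuousLinearMap.adjoint (𝕜 := ℂ) (E := H) (F := K)).continuous hT fun F hF => ?_
  have hfin : FiniteDimensional ℂ (LinearMap.range F.toLinearMap) := Module.Finite.iff_fg.2 hF
  let S := LinearMap.range F.toLinearMap
  have e : F = S.starProjection ∘L F := by
    ext x
    exact (Submodule.starProjection_eq_self_iff.2 (LinearMap.mem_range_self F.toLinearMap x)).symm
  have hS : (S.starProjection : K →L[ℂ] K).toLinearMap.HasFiniteRange := by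
    rw [LinearMap.HasFiniteRange]
    have : LinearMap.range (S.starProjection : K →L[ℂ] K).toLinearMap = S :=
      Submodule.range_starProjection S
    rw [this]
    exact hF
  have e' : ContinuousLinearMap.adjoint F = ContinuousLinearMap.adjoint F ∘L S.starProjection := by
    conv_lhs => rw [e, ContinuousLinearMap.adjoint_comp,
      ← ContinuousLinearMap.star_eq_adjoint S.starProjection,
      (isSelfAdjoint_starProjection S).star_eq]
  change (ContinuousLinearMap.adjoint F).toLinearMap.HasFiniteRange
  rw [e']
  exact hS.comp_left _

end Approximable

section L2Operators

variable {X : Type*} [MetricSpace X] [MeasurableSpace X] [BorelSpace X] {ν : Measure X}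

lemma restrictOp_coeFn (W : Set X) (f : L2 ν) : restrictOp ν W f =ᵐ[ν.restrict W] f :=
  LpToLpRestrictCLM_coeFn ℂ W f

/-- `extendOp` is defined as an adjoint; pairing with every `v` shows that it really extends by
zero. -/
lemma extendOp_coeFn {W : Set X} (hW : MeasurableSet W) (f : L2 (ν.restrict W)) :
    extendOp ν W f =ᵐ[ν] W.indicator f := by
  have hf : MemLp (W.indicator f) 2 ν := (memLp_indicator_iff_restrict hW).2 (Lp.memLp f)
  suffices extendOp ν W f = hf.toLp _ by rw [this]; exact hf.coeFn_toLp
  refine ext_inner_right ℂ fun v => ?_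
  rw [extendOp, ContinuousLinearMap.adjoint_inner_left, L2.inner_def, L2.inner_def]
  have h1 : ∫ x, inner ℂ (f x) (restrictOp ν W v x) ∂(ν.restrict W) =
      ∫ x in W, inner ℂ (f x) (v x) ∂ν := by
    refine integral_congr_ae ?_
    filter_upwards [restrictOp_coeFn W v] with x h
    rw [h]
  rw [h1, ← integral_indicator hW]
  refine integral_congr_ae ?_
  filter_upwards [hf.coeFn_toLp] with x h
  rw [h]
  by_cases hx : x ∈ W <;> simp [hx]

lemma restrictOp_extendOp {W : Set X} (hW : MeasurableSet W) :
    restrictOp ν W ∘L extendOp ν W = 1 := by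
  ext1 f
  apply Lp.ext
  refine (restrictOp_coeFn W _).trans ?_
  filter_upwards [ae_restrict_mem hW, ae_restrict_of_ae (extendOp_coeFn hW f)] with x hx h
  simp [hx, h]

lemma adjoint_extendOp (W : Set X) :
    ContinuousLinearMap.adjoint (extendOp ν W) = restrictOp ν W :=
  ContinuousLinearMap.adjoint_adjoint _

/-- Multiplication by the indicator function of `E`. -/
def chi (ν : Measure X) (E : Set X) : BL2 ν := extendOp ν E ∘L restrictOp ν E

lemma chi_coeFn {E : Set X} (hE : MeasurableSet E) (f : L2 ν) : chi ν E f =ᵐ[ν] E.indicator f := by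
  refine (extendOp_coeFn hE _).trans ?_
  have := restrictOp_coeFn (ν := ν) E f
  rw [Filter.EventuallyEq, ae_restrict_iff' hE] at this
  filter_upwards [this] with x hx
  by_cases h : x ∈ E
  · simp [h, hx h]
  · simp [h]

lemma star_chi (E : Set X) : star (chi ν E) = chi ν E := by
  rw [ContinuousLinearMap.star_eq_adjoint, chi, ContinuousLinearMap.adjoint_comp, adjoint_extendOp]
  rfl

lemma chi_mul_chi {E F : Set X} (hE : MeasurableSet E) (hF : MeasurableSet F) :
    chi ν E * chi ν F = chi ν (E ∩ F) := by
  ext1 f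
  apply Lp.ext
  refine (chi_coeFn hE _).trans (.trans ?_ (chi_coeFn (hE.inter hF) f).symm)
  filter_upwards [chi_coeFn hF f] with x hx
  rw [← Set.indicator_indicator]
  by_cases h : x ∈ E <;> simp [h, hx]

lemma chi_mul_of_subset {E F : Set X} (hE : MeasurableSet E) (hF : MeasurableSet F) (h : E ⊆ F) :
    chi ν E * chi ν F = chi ν E := by
  rw [chi_mul_chi hE hF, Set.inter_eq_left.2 h]

lemma mul_chi_of_subset {E F : Set X} (hE : MeasurableSet E) (hF : MeasurableSet F) (h : E ⊆ F) :
    chi ν F * chi ν E = chi ν E := by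
  rw [chi_mul_chi hF hE, Set.inter_eq_right.2 h]

lemma chi_mul_self {E : Set X} (hE : MeasurableSet E) : chi ν E * chi ν E = chi ν E :=
  chi_mul_of_subset hE hE subset_rfl

lemma chi_of_measure_zero {E : Set X} (hE : MeasurableSet E) (h : ν E = 0) : chi ν E = 0 := by
  ext1 f
  apply Lp.ext
  refine (chi_coeFn hE _).trans (.trans ?_ (Lp.coeFn_zero ℂ 2 ν).symm)
  filter_upwards [measure_eq_zero_iff_ae_notMem.1 h] with x hx
  simp [hx]

lemma chi_empty : chi ν ∅ = 0 := chi_of_measure_zero .empty measure_empty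

lemma chi_univ : chi ν Set.univ = 1 := by
  ext1 f
  apply Lp.ext
  refine (chi_coeFn .univ _).trans ?_
  simp

lemma chi_add_of_disjoint {E F : Set X} (hE : MeasurableSet E) (hF : MeasurableSet F)
    (h : Disjoint E F) : chi ν E + chi ν F = chi ν (E ∪ F) := by
  ext1 f
  apply Lp.ext
  refine (Lp.coeFn_add _ _).trans (.trans ?_ (chi_coeFn (hE.union hF) f).symm)
  filter_upwards [chi_coeFn hE f, chi_coeFn hF f] with x hx hx'
  rw [Set.indicator_union_of_disjoint h]
  exact congrArg₂ (· + ·) hx hx'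

lemma chi_add_chi_sdiff {E F : Set X} (hE : MeasurableSet E) (hF : MeasurableSet F) (h : F ⊆ E) :
    chi ν F + chi ν (E \ F) = chi ν E := by
  rw [chi_add_of_disjoint hF (hE.diff hF) Set.disjoint_sdiff_right, Set.union_sdiff_cancel h]

lemma chi_compl {E : Set X} (hE : MeasurableSet E) : chi ν Eᶜ = 1 - chi ν E := by
  rw [eq_sub_iff_add_eq, add_comm, chi_add_of_disjoint hE hE.compl disjoint_compl_right,
    Set.union_compl_self, chi_univ]

lemma norm_chi_apply_le {E : Set X} (hE : MeasurableSet E) (f : L2 ν) : ‖chi ν E f‖ ≤ ‖f‖ := by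
  refine Lp.norm_le_norm_of_ae_le ?_
  filter_upwards [chi_coeFn hE f] with x hx
  rw [hx]
  exact norm_indicator_le_norm_self _ _

lemma chi_eq_chi_of_measure {E F : Set X} (hE : MeasurableSet E) (hF : MeasurableSet F) (h : F ⊆ E)
    (h0 : ν (E \ F) = 0) : chi ν E = chi ν F := by
  rw [← chi_add_chi_sdiff hE hF h, chi_of_measure_zero (hE.diff hF) h0, add_zero]

/-! Multiplication operators -/

lemma mulOp_coeFn (f : C₀(X, ℂ)) (w : L2 ν) : mulOp ν f w =ᵐ[ν] fun x => f x * w x := by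
  refine (ContinuousLinearMap.coeFn_holder (ContinuousLinearMap.mul ℂ ℂ) _ w).trans ?_
  filter_upwards [(memLp_top ν f).coeFn_toLp] with x hx
  rw [hx]
  rfl

lemma mulOp_mul_chi_of_eqOn {f : C₀(X, ℂ)} {E : Set X} (hE : MeasurableSet E)
    (h : ∀ x ∈ E, f x = 1) : mulOp ν f * chi ν E = chi ν E := by
  ext1 w
  apply Lp.ext
  refine (mulOp_coeFn f _).trans ?_
  filter_upwards [chi_coeFn hE w] with x hx
  change f x * (chi ν E w) x = (chi ν E w) x
  rw [hx]
  by_cases hxE : x ∈ E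
  · simp [hxE, h x hxE]
  · simp [hxE]

lemma chi_mul_mulOp_of_eqOn {f : C₀(X, ℂ)} {E : Set X} (hE : MeasurableSet E)
    (h : ∀ x ∈ E, f x = 1) : chi ν E * mulOp ν f = chi ν E := by
  ext1 w
  apply Lp.ext
  refine (chi_coeFn hE _).trans (.trans ?_ (chi_coeFn hE w).symm)
  filter_upwards [mulOp_coeFn f w] with x hx
  by_cases hxE : x ∈ E
  · simp [hxE, hx, h x hxE]
  · simp [hxE]

lemma mulOp_mul_chi_of_support {f : C₀(X, ℂ)} {E : Set X} (hE : MeasurableSet E)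
    (h : ∀ x, f x ≠ 0 → x ∈ E) : mulOp ν f * chi ν E = mulOp ν f := by
  ext1 w
  apply Lp.ext
  refine (mulOp_coeFn f _).trans (.trans ?_ (mulOp_coeFn f w).symm)
  filter_upwards [chi_coeFn hE w] with x hx
  by_cases hxE : x ∈ E
  · simp [hxE, hx]
  · have : f x = 0 := by_contra fun hf => hxE (h x hf)
    simp [this]

lemma chi_mul_mulOp_of_support {f : C₀(X, ℂ)} {E : Set X} (hE : MeasurableSet E)
    (h : ∀ x, f x ≠ 0 → x ∈ E) : chi ν E * mulOp ν f = mulOp ν f := by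
  ext1 w
  apply Lp.ext
  refine (chi_coeFn hE _).trans ?_
  filter_upwards [mulOp_coeFn f w] with x hx
  by_cases hxE : x ∈ E
  · simp [hxE]
  · have : f x = 0 := by_contra fun hf => hxE (h x hf)
    simp [hxE, hx, this]

variable [ProperSpace X]

/-- A continuous function that is `1` on the bounded set `E` and vanishes off its
`δ`-neighbourhood. -/
lemma exists_bump {E : Set X} (hE : Bornology.IsBounded E) {δ : ℝ} (hδ : 0 < δ) :
    ∃ f : C₀(X, ℂ), HasCompactSupport f ∧ (∀ x ∈ E, f x = 1) ∧
      ∀ x, f x ≠ 0 → x ∈ Metric.thickening δ E := by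
  let g : X → ℂ := fun x => ((thickenedIndicator hδ E x : ℝ) : ℂ)
  have hg : Continuous g := by
    have := (thickenedIndicator hδ E).continuous
    fun_prop
  have h0 : ∀ x, g x ≠ 0 → x ∈ Metric.thickening δ E := fun x hx => by
    by_contra h
    refine hx ?_
    simp only [g]
    rw [thickenedIndicator_zero hδ E h]
    simp
  have hc : HasCompactSupport g := by
    refine HasCompactSupport.of_support_subset_isCompact
      (hE.cthickening (δ := δ)).isCompact_closure fun x hx => ?_
    exact subset_closure (Metric.thickening_subset_cthickening _ _ (h0 x hx))
  refine ⟨⟨⟨g, hg⟩, hc.is_zero_at_infty⟩, hc, fun x hx => ?_, h0⟩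
  change g x = 1
  simp only [g]
  rw [thickenedIndicator_one hδ E hx]
  simp

lemma dense_range_ccToL2 [IsFiniteMeasureOnCompacts ν] : DenseRange (ccToL2 ν) := by
  intro w
  refine EMetric.mem_closure_iff.2 fun ε hε => ?_
  obtain ⟨g, hg, hle, hgc, hgm⟩ := (Lp.memLp w).exists_hasCompactSupport_eLpNorm_sub_le
    (by norm_num) (ε := ε / 2) (by simpa using hε.ne')
  rcases eq_or_ne ε ⊤ with rfl | htop
  · exact ⟨_, ⟨0, rfl⟩, edist_lt_top _ _⟩
  refine ⟨_, ⟨⟨⟨g, hgc⟩, hg⟩, rfl⟩, ?_⟩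
  rw [Lp.edist_def]
  refine lt_of_le_of_lt (le_trans (le_of_eq ?_) hle) (ENNReal.half_lt_self hε.ne' htop)
  refine eLpNorm_congr_ae ?_
  filter_upwards [ccToL2_coeFn ν ⟨⟨g, hgc⟩, hg⟩] with x hx
  simp only [Pi.sub_apply]
  rw [hx]
  rfl

lemma chi_ccToL2 [IsFiniteMeasureOnCompacts ν] {E : Set X} (hE : MeasurableSet E) (f : C_c(X, ℂ))
    (h : ∀ x, f x ≠ 0 → x ∈ E) : chi ν E (ccToL2 ν f) = ccToL2 ν f := by
  apply Lp.ext
  refine (chi_coeFn hE _).trans ?_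
  filter_upwards [ccToL2_coeFn ν f] with x hx
  by_cases hxE : x ∈ E
  · simp [hxE]
  · have : f x = 0 := by_contra fun hf => hxE (h x hf)
    simp [hxE, hx, this]

lemma tendsto_chi_ball [IsFiniteMeasureOnCompacts ν] (x₀ : X) (w : L2 ν) :
    Filter.Tendsto (fun n : ℕ => chi ν (Metric.ball x₀ n) w) Filter.atTop (nhds w) := by
  refine Metric.tendsto_atTop.2 fun ε hε => ?_
  obtain ⟨f, hf⟩ := (Metric.denseRange_iff.1 (dense_range_ccToL2 (ν := ν))) w (ε / 2) (by positivity)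
  obtain ⟨r, hr⟩ := f.hasCompactSupport.isBounded.subset_ball x₀
  obtain ⟨N, hN⟩ := exists_nat_ge r
  refine ⟨N, fun n hn => ?_⟩
  have e : chi ν (Metric.ball x₀ n) (ccToL2 ν f) = ccToL2 ν f :=
    chi_ccToL2 measurableSet_ball f fun x hx => Metric.ball_subset_ball
      (hN.trans (by exact_mod_cast hn)) (hr (subset_tsupport _ hx))
  have e2 : chi ν (Metric.ball x₀ n) w - w =
      chi ν (Metric.ball x₀ n) (w - ccToL2 ν f) - (w - ccToL2 ν f) := by
    rw [map_sub, e]; abel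
  rw [dist_eq_norm, e2]
  have := norm_chi_apply_le (ν := ν) (E := Metric.ball x₀ n) measurableSet_ball (w - ccToL2 ν f)
  rw [dist_eq_norm] at hf
  linarith [norm_sub_le (chi ν (Metric.ball x₀ n) (w - ccToL2 ν f)) (w - ccToL2 ν f)]

section

variable {V : Type*} [NormedAddCommGroup V] [NormedSpace ℂ V]

/-- Indicators of growing balls converge strongly to the identity. This reduces operator identities
to functions supported in bounded sets. -/
lemma eq_of_comp_chi_ball [IsFiniteMeasureOnCompacts ν] (x₀ : X) {S T : L2 ν →L[ℂ] V}
    (h : ∀ n : ℕ, S ∘L chi ν (Metric.ball x₀ n) = T ∘L chi ν (Metric.ball x₀ n)) : S = T := by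
  ext1 w
  have hS := (S.continuous.tendsto _).comp (tendsto_chi_ball x₀ w)
  have hT := (T.continuous.tendsto _).comp (tendsto_chi_ball x₀ w)
  refine tendsto_nhds_unique hS (hT.congr fun n => ?_)
  exact (congrArg (fun f : L2 ν →L[ℂ] V => f w) (h n)).symm

lemma eq_of_chi_ball_comp [IsFiniteMeasureOnCompacts ν] (x₀ : X) {S T : V →L[ℂ] L2 ν}
    (h : ∀ n : ℕ, chi ν (Metric.ball x₀ n) ∘L S = chi ν (Metric.ball x₀ n) ∘L T) : S = T := by
  ext1 w
  have hS := tendsto_chi_ball x₀ (S w)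
  have hT := tendsto_chi_ball x₀ (T w)
  refine tendsto_nhds_unique hS (hT.congr fun n => ?_)
  exact (congrArg (fun f : V →L[ℂ] L2 ν => f w) (h n)).symm

/-- An operator that vanishes on the compactly supported continuous functions supported near `E`
vanishes on `L²(E)`. -/
lemma comp_chi_eq_zero_of_ccToL2 [IsFiniteMeasureOnCompacts ν] {E : Set X} (hE : MeasurableSet E)
    {P : L2 ν →L[ℂ] V} {δ : ℝ} (hδ : 0 < δ)
    (h : ∀ f : C_c(X, ℂ), (∀ x, f x ≠ 0 → x ∈ Metric.thickening δ E) → P (ccToL2 ν f) = 0) :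
    P ∘L chi ν E = 0 := by
  rcases isEmpty_or_nonempty X with hX | ⟨⟨x₀⟩⟩
  · rw [Set.eq_empty_of_isEmpty E, chi_empty, ContinuousLinearMap.comp_zero]
  refine eq_of_comp_chi_ball x₀ fun n => ?_
  have hm : MeasurableSet (E ∩ Metric.ball x₀ n) := hE.inter measurableSet_ball
  rw [ContinuousLinearMap.zero_comp, ContinuousLinearMap.comp_assoc]
  change P ∘L (chi ν E * chi ν _) = 0
  rw [chi_mul_chi hE measurableSet_ball]
  -- The bump function equals `1` on the bounded piece and is supported within `δ` of it.
  -- Multiplying by it turns arbitrary test functions into ones to which `h` applies, and does not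
  -- affect functions living on the piece.
  obtain ⟨g, -, hg1, hg0⟩ := exists_bump (E := E ∩ Metric.ball x₀ n)
    (Metric.isBounded_ball.subset Set.inter_subset_right) hδ
  have key : P ∘L mulOp ν g = 0 := by
    ext1 w
    refine (dense_range_ccToL2 (ν := ν)).induction_on w
      (isClosed_eq (P ∘L mulOp ν g).continuous continuous_const) fun f => ?_
    let k : C_c(X, ℂ) := ⟨⟨fun x => g x * f x, g.continuous.mul f.continuous⟩,
      f.hasCompactSupport.mul_left⟩
    have e : mulOp ν g (ccToL2 ν f) = ccToL2 ν k := by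
      apply Lp.ext
      refine (mulOp_coeFn g _).trans (.trans ?_ (ccToL2_coeFn ν k).symm)
      filter_upwards [ccToL2_coeFn ν f] with x hx
      rw [hx]; rfl
    rw [ContinuousLinearMap.comp_apply, e]
    refine h k fun x hx => ?_
    have : g x ≠ 0 := left_ne_zero_of_mul hx
    exact Metric.thickening_subset_of_subset _ Set.inter_subset_left (hg0 x this)
  rw [← mulOp_mul_chi_of_eqOn hm hg1]
  change (P ∘L mulOp ν g) ∘L chi ν _ = 0
  rw [key, ContinuousLinearMap.zero_comp]

end

end L2Operators

/-! ### Local compactness and finite propagation via indicator functions. -/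

section RoeOperators

variable {X : Type*} [MetricSpace X] [MeasurableSpace X] [BorelSpace X] {ν : Measure X}

/-- `A` has propagation at most `R`, in terms of indicator functions. -/
def FinProp (ν : Measure X) (A : BL2 ν) (R : ℝ) : Prop :=
  ∀ E F : Set X, MeasurableSet E → MeasurableSet F → (∀ x ∈ E, ∀ y ∈ F, R ≤ dist x y) →
    chi ν E * A * chi ν F = 0

/-- Local compactness in terms of indicator functions. -/
def LocComp (ν : Measure X) (A : BL2 ν) : Prop :=
  ∀ E : Set X, MeasurableSet E → Bornology.IsBounded E →
    IsApproximable (A * chi ν E) ∧ IsApproximable (chi ν E * A)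

/-- Locally compact operators of finite propagation. -/
structure IsRoe (ν : Measure X) (A : BL2 ν) : Prop where
  locComp : LocComp ν A
  finProp : ∃ R : ℝ, FinProp ν A R

variable {A B : BL2 ν} {R S : ℝ}

lemma IsApproximable.mul_left {K : BL2 ν} (hK : IsApproximable K) (B : BL2 ν) :
    IsApproximable (B * K) := hK.comp_left B

lemma IsApproximable.mul_right {K : BL2 ν} (hK : IsApproximable K) (B : BL2 ν) :
    IsApproximable (K * B) := hK.comp_right B

lemma IsApproximable.smul {V W : Type*} [NormedAddCommGroup V] [NormedSpace ℂ V]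
    [NormedAddCommGroup W] [NormedSpace ℂ W] {K : V →L[ℂ] W} (hK : IsApproximable K) (c : ℂ) :
    IsApproximable (c • K) := by
  have := hK.comp_left (c • (1 : W →L[ℂ] W))
  rwa [ContinuousLinearMap.smul_comp, ContinuousLinearMap.one_def, ContinuousLinearMap.id_comp]
    at this

lemma IsApproximable.neg {V W : Type*} [NormedAddCommGroup V] [NormedSpace ℂ V]
    [NormedAddCommGroup W] [NormedSpace ℂ W] {K : V →L[ℂ] W} (hK : IsApproximable K) :
    IsApproximable (-K) := by
  simpa using hK.smul (-1)

lemma IsApproximable.sub {V W : Type*} [NormedAddCommGroup V] [NormedSpace ℂ V]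
    [NormedAddCommGroup W] [NormedSpace ℂ W] {K L : V →L[ℂ] W} (hK : IsApproximable K)
    (hL : IsApproximable L) : IsApproximable (K - L) := by
  rw [sub_eq_add_neg]
  exact hK.add hL.neg

lemma IsApproximable.star {K : BL2 ν} (hK : IsApproximable K) : IsApproximable (star K) :=
  hK.adjoint

lemma FinProp.mono (hA : FinProp ν A R) (h : R ≤ S) : FinProp ν A S :=
  fun E F hE hF hEF => hA E F hE hF fun x hx y hy => h.trans (hEF x hx y hy)

lemma finProp_zero : FinProp ν 0 R := fun E F _ _ _ => by simp

lemma FinProp.add (hA : FinProp ν A R) (hB : FinProp ν B R) : FinProp ν (A + B) R :=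
  fun E F hE hF h => by rw [mul_add, add_mul, hA E F hE hF h, hB E F hE hF h, add_zero]

lemma FinProp.smul (hA : FinProp ν A R) (c : ℂ) : FinProp ν (c • A) R :=
  fun E F hE hF h => by rw [mul_smul_comm, smul_mul_assoc, hA E F hE hF h, smul_zero]

lemma FinProp.star (hA : FinProp ν A R) : FinProp ν (star A) R := fun E F hE hF h => by
  have := congrArg Star.star (hA F E hF hE fun x hx y hy => by rw [dist_comm]; exact h y hy x hx)
  rwa [star_mul, star_mul, star_chi, star_chi, star_zero, ← mul_assoc] at this

/-- Strict positivity is needed: two sets at distance at least `0` may overlap. -/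
lemma finProp_chi {G : Set X} (hG : MeasurableSet G) (hR : 0 < R) : FinProp ν (chi ν G) R := by
  intro E F hE hF h
  rw [chi_mul_chi hE hG, chi_mul_chi (hE.inter hG) hF]
  have : E ∩ G ∩ F = ∅ := by
    ext x
    refine ⟨fun hx => ?_, fun hx => hx.elim⟩
    have := h x hx.1.1 x hx.2
    rw [dist_self] at this
    exact absurd hR (not_lt.2 this)
  rw [this, chi_empty]

lemma FinProp.chi_mul_of_subset (hA : FinProp ν A R) {E F : Set X} (hE : MeasurableSet E)
    (hF : MeasurableSet F) (h : Metric.thickening R E ⊆ F) :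
    chi ν E * A * chi ν F = chi ν E * A := by
  have : chi ν E * A * chi ν Fᶜ = 0 := hA E Fᶜ hE hF.compl fun x hx y hy => by
    by_contra hlt
    exact hy (h (Metric.mem_thickening_iff.2 ⟨x, hx, by rw [dist_comm]; linarith⟩))
  rw [chi_compl hF, mul_sub, mul_one, sub_eq_zero] at this
  exact this.symm

lemma FinProp.chi_mul (hA : FinProp ν A R) {E : Set X} (hE : MeasurableSet E) :
    chi ν E * A * chi ν (Metric.thickening R E) = chi ν E * A :=
  hA.chi_mul_of_subset hE Metric.isOpen_thickening.measurableSet subset_rfl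

lemma FinProp.mul_chi_of_subset (hA : FinProp ν A R) {E F : Set X} (hE : MeasurableSet E)
    (hF : MeasurableSet F) (h : Metric.thickening R E ⊆ F) :
    chi ν F * A * chi ν E = A * chi ν E := by
  have := congrArg Star.star (hA.star.chi_mul_of_subset hE hF h)
  simpa only [star_mul, star_chi, star_star, mul_assoc] using this

lemma FinProp.mul (hA : FinProp ν A R) (hB : FinProp ν B S) : FinProp ν (A * B) (R + S) := by
  intro E F hE hF h
  have e : chi ν (Metric.thickening R E) * B * chi ν F = 0 := by
    refine hB _ _ Metric.isOpen_thickening.measurableSet hF fun x hx y hy => ?_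
    obtain ⟨z, hz, hxz⟩ := Metric.mem_thickening_iff.1 hx
    have := h z hz y hy
    have := dist_triangle_left z y x
    linarith
  rw [← mul_assoc, ← hA.chi_mul hE]
  calc _ = chi ν E * A * (chi ν (Metric.thickening R E) * B * chi ν F) := by noncomm_ring
    _ = 0 := by rw [e, mul_zero]

lemma LocComp.add (hA : LocComp ν A) (hB : LocComp ν B) : LocComp ν (A + B) := fun E hE hb => by
  rw [add_mul, mul_add]
  exact ⟨(hA E hE hb).1.add (hB E hE hb).1, (hA E hE hb).2.add (hB E hE hb).2⟩

lemma LocComp.smul (hA : LocComp ν A) (c : ℂ) : LocComp ν (c • A) := fun E hE hb => by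
  rw [smul_mul_assoc, mul_smul_comm]
  exact ⟨(hA E hE hb).1.smul c, (hA E hE hb).2.smul c⟩

lemma LocComp.star (hA : LocComp ν A) : LocComp ν (star A) := fun E hE hb => by
  have h1 := (hA E hE hb).1.star
  have h2 := (hA E hE hb).2.star
  rw [star_mul, star_chi] at h1 h2
  exact ⟨h2, h1⟩

lemma isRoe_zero : IsRoe ν 0 :=
  ⟨fun E _ _ => by rw [zero_mul, mul_zero]; exact ⟨isApproximable_zero, isApproximable_zero⟩,
    0, finProp_zero⟩

lemma IsRoe.add (hA : IsRoe ν A) (hB : IsRoe ν B) : IsRoe ν (A + B) := by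
  obtain ⟨R, hR⟩ := hA.finProp
  obtain ⟨S, hS⟩ := hB.finProp
  exact ⟨hA.locComp.add hB.locComp, max R S, (hR.mono (le_max_left _ _)).add
    (hS.mono (le_max_right _ _))⟩

lemma IsRoe.smul (hA : IsRoe ν A) (c : ℂ) : IsRoe ν (c • A) := by
  obtain ⟨R, hR⟩ := hA.finProp
  exact ⟨hA.locComp.smul c, R, hR.smul c⟩

lemma IsRoe.sub (hA : IsRoe ν A) (hB : IsRoe ν B) : IsRoe ν (A - B) := by
  simpa [sub_eq_add_neg] using hA.add (hB.smul (-1))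

lemma IsRoe.star (hA : IsRoe ν A) : IsRoe ν (star A) := by
  obtain ⟨R, hR⟩ := hA.finProp
  exact ⟨hA.locComp.star, R, hR.star⟩

/-- Only `A` has to be locally compact. A bounded cut-off to the left of `B` moves past `B` at the
cost of thickening the set, which stays bounded. -/
lemma IsRoe.mul_left (hA : IsRoe ν A) (hB : FinProp ν B S) : IsRoe ν (B * A) := by
  obtain ⟨R, hR⟩ := hA.finProp
  refine ⟨fun E hE hb => ⟨?_, ?_⟩, S + R, hB.mul hR⟩
  · rw [mul_assoc]
    exact (hA.locComp E hE hb).1.mul_left B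
  · rw [← mul_assoc, ← hB.chi_mul hE, mul_assoc]
    exact (hA.locComp _ Metric.isOpen_thickening.measurableSet hb.thickening).2.mul_left _

lemma IsRoe.mul_right (hA : IsRoe ν A) (hB : FinProp ν B S) : IsRoe ν (A * B) := by
  have := (hA.star.mul_left hB.star).star
  rwa [star_mul, star_star, star_star] at this

lemma IsRoe.mul (hA : IsRoe ν A) (hB : IsRoe ν B) : IsRoe ν (A * B) := by
  obtain ⟨S, hS⟩ := hB.finProp
  exact hA.mul_right hS

variable [ProperSpace X]

lemma isLocCompact_iff : IsLocCompact ν A ↔ LocComp ν A := by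
  constructor
  · intro h E hE hb
    obtain ⟨f, hf, h1, -⟩ := exists_bump hb one_pos
    obtain ⟨ha, hb'⟩ := h f hf
    rw [← isApproximable_iff_isCompactOperator] at ha hb'
    constructor
    · rw [← mulOp_mul_chi_of_eqOn hE h1, ← mul_assoc]
      exact ha.mul_right _
    · rw [← chi_mul_mulOp_of_eqOn hE h1, mul_assoc]
      exact hb'.mul_left _
  · intro h f hf
    obtain ⟨ha, hb⟩ := h (tsupport f) (isClosed_tsupport f).measurableSet hf.isBounded
    have hs : ∀ x, f x ≠ 0 → x ∈ tsupport f := fun x hx => subset_tsupport _ hx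
    have hm := (isClosed_tsupport f).measurableSet
    constructor
    · rw [← isApproximable_iff_isCompactOperator, ← chi_mul_mulOp_of_support hm hs]
      exact ha.mul_right (mulOp ν f)
    · rw [← isApproximable_iff_isCompactOperator, ← mulOp_mul_chi_of_support hm hs]
      exact hb.mul_left (mulOp ν f)

lemma hasFinPropagation_iff [IsFiniteMeasureOnCompacts ν] :
    HasFinPropagation ν A ↔ ∃ R, FinProp ν A R := by
  constructor
  · rintro ⟨R, hR, h⟩
    -- Each of the two bump functions enlarges its set by `1`. Their closed supports lie in closed
    -- thickenings, hence the additional `ε` below.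
    refine ⟨R + 2, fun E F hE hF hd => ?_⟩
    rcases isEmpty_or_nonempty X with hX | ⟨⟨x₀⟩⟩
    · rw [Set.eq_empty_of_isEmpty E, chi_empty, zero_mul, zero_mul]
    refine eq_of_comp_chi_ball x₀ fun m => eq_of_chi_ball_comp x₀ fun n => ?_
    obtain ⟨f, -, hf1, hf0⟩ := exists_bump (E := Metric.ball x₀ n ∩ E)
      (Metric.isBounded_ball.subset Set.inter_subset_left) one_pos
    obtain ⟨g, -, hg1, hg0⟩ := exists_bump (E := F ∩ Metric.ball x₀ m)
      (Metric.isBounded_ball.subset Set.inter_subset_right) one_pos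
    have hts : ∀ {k : C₀(X, ℂ)} {G : Set X}, (∀ x, k x ≠ 0 → x ∈ Metric.thickening 1 G) →
        tsupport k ⊆ Metric.cthickening 1 G := fun {k G} hk =>
      closure_minimal (fun x hx => Metric.thickening_subset_cthickening _ _ (hk x hx))
        Metric.isClosed_cthickening
    have e : mulOp ν f * A * mulOp ν g = 0 := by
      refine h f g fun x hx y hy => le_of_forall_pos_le_add fun ε hε => ?_
      have hx' := Metric.cthickening_subset_thickening' (δ₂ := 1 + ε / 2) (by linarith) (by linarith)
        _ (hts hf0 hx)
      have hy' := Metric.cthickening_subset_thickening' (δ₂ := 1 + ε / 2) (by linarith) (by linarith)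
        _ (hts hg0 hy)
      obtain ⟨a, ha, hxa⟩ := Metric.mem_thickening_iff.1 hx'
      obtain ⟨b, hb, hyb⟩ := Metric.mem_thickening_iff.1 hy'
      have h1 := hd a ha.2 b hb.1
      have h2 := dist_triangle_left a b x
      have h3 := dist_triangle x y b
      linarith
    have hm1 : MeasurableSet (Metric.ball x₀ n ∩ E) := measurableSet_ball.inter hE
    have hm2 : MeasurableSet (F ∩ Metric.ball x₀ m) := hF.inter measurableSet_ball
    change chi ν _ * ((chi ν E * A * chi ν F) * chi ν _) = chi ν _ * (0 * chi ν _)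
    calc _ = (chi ν (Metric.ball x₀ n) * chi ν E) * A * (chi ν F * chi ν (Metric.ball x₀ m)) := by
          noncomm_ring
      _ = (chi ν (Metric.ball x₀ n ∩ E) * mulOp ν f) * A *
          (mulOp ν g * chi ν (F ∩ Metric.ball x₀ m)) := by
          rw [chi_mul_chi measurableSet_ball hE, chi_mul_chi hF measurableSet_ball,
            chi_mul_mulOp_of_eqOn hm1 hf1, mulOp_mul_chi_of_eqOn hm2 hg1]
      _ = chi ν (Metric.ball x₀ n ∩ E) * (mulOp ν f * A * mulOp ν g) *
          chi ν (F ∩ Metric.ball x₀ m) := by noncomm_ring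
      _ = _ := by rw [e]; simp
  · rintro ⟨R, hR⟩
    refine ⟨max R 0, le_max_right _ _, fun f g hfg => ?_⟩
    have hs : ∀ (f : C₀(X, ℂ)) x, f x ≠ 0 → x ∈ tsupport f := fun f x hx => subset_tsupport _ hx
    have hm := fun f : C₀(X, ℂ) => (isClosed_tsupport f).measurableSet
    change mulOp ν f * (A * mulOp ν g) = 0
    rw [← mulOp_mul_chi_of_support (hm f) (hs f), ← chi_mul_mulOp_of_support (hm g) (hs g)]
    calc _ = mulOp ν f * (chi ν (tsupport f) * A * chi ν (tsupport g)) * mulOp ν g := by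
          noncomm_ring
      _ = 0 := by
          rw [hR _ _ (hm f) (hm g) fun x hx y hy => (le_max_left _ _).trans (hfg x hx y hy)]
          simp

lemma isRoe_iff [IsFiniteMeasureOnCompacts ν] :
    IsRoe ν A ↔ IsLocCompact ν A ∧ HasFinPropagation ν A := by
  rw [isLocCompact_iff, hasFinPropagation_iff]
  exact ⟨fun h => ⟨h.1, h.2⟩, fun h => ⟨h.1, h.2⟩⟩

end RoeOperators

/-! ### Operators on `L²(W)` viewed on `L²(X)`. -/

section Extension

variable {X : Type*} [MetricSpace X] [MeasurableSpace X] [BorelSpace X] {ν : Measure X}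
variable {W : Set X}

lemma adjoint_restrictOp (W : Set X) :
    ContinuousLinearMap.adjoint (restrictOp ν W) = extendOp ν W := rfl

/-- Extension of operators on `L²(W)` by zero to `L²(X)`. -/
def extHom (ν : Measure X) (hW : MeasurableSet W) : BL2 (ν.restrict W) →⋆ₙₐ[ℂ] BL2 ν where
  toFun A := extendOp ν W ∘L A ∘L restrictOp ν W
  map_smul' c A := by ext1; simp
  map_zero' := by ext1; simp
  map_add' A B := by ext1; simp
  map_mul' A B := by
    ext1 f
    have := congrArg (fun T : BL2 (ν.restrict W) => T (B (restrictOp ν W f)))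
      (restrictOp_extendOp (ν := ν) hW)
    simp only [ContinuousLinearMap.comp_apply, one_apply_eq_self] at this
    simp [this]
  map_star' A := by
    rw [ContinuousLinearMap.star_eq_adjoint, ContinuousLinearMap.star_eq_adjoint,
      ContinuousLinearMap.adjoint_comp, ContinuousLinearMap.adjoint_comp, adjoint_extendOp,
      adjoint_restrictOp, ContinuousLinearMap.comp_assoc]

/-- The compression of an operator to `L²(W)`. -/
def compress (W : Set X) (B : BL2 ν) : BL2 (ν.restrict W) := restrictOp ν W ∘L B ∘L extendOp ν W

lemma extHom_apply (hW : MeasurableSet W) (A : BL2 (ν.restrict W)) (w : L2 ν) :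
    extHom ν hW A w = extendOp ν W (A (restrictOp ν W w)) := rfl

lemma compress_extHom (hW : MeasurableSet W) (A : BL2 (ν.restrict W)) :
    compress W (extHom ν hW A) = A := by
  have h : ∀ x, restrictOp ν W (extendOp ν W x) = x := fun x =>
    congrArg (fun T : BL2 (ν.restrict W) => T x) (restrictOp_extendOp hW)
  ext1 f
  change restrictOp ν W (extendOp ν W (A (restrictOp ν W (extendOp ν W f)))) = A f
  rw [h, h]

lemma extHom_compress (hW : MeasurableSet W) (B : BL2 ν) :
    extHom ν hW (compress W B) = chi ν W * B * chi ν W := rfl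

lemma extHom_injective (hW : MeasurableSet W) : Function.Injective (extHom ν hW) :=
  Function.LeftInverse.injective (compress_extHom hW)

lemma compress_star (B : BL2 ν) : compress W (star B) = star (compress W B) := by
  rw [compress, compress, ContinuousLinearMap.star_eq_adjoint, ContinuousLinearMap.star_eq_adjoint,
    ContinuousLinearMap.adjoint_comp, ContinuousLinearMap.adjoint_comp, adjoint_extendOp,
    adjoint_restrictOp, ContinuousLinearMap.comp_assoc]

lemma continuous_compress : Continuous (compress (ν := ν) W) :=
  ((ContinuousLinearMap.compL ℂ _ _ _ (restrictOp ν W)).continuous).comp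
    (((ContinuousLinearMap.compL ℂ (L2 (ν.restrict W)) (L2 ν) (L2 ν)).flip
      (extendOp ν W)).continuous)

lemma continuous_extHom (hW : MeasurableSet W) : Continuous (extHom ν hW) :=
  ((ContinuousLinearMap.compL ℂ _ _ _ (extendOp ν W)).continuous).comp
    (((ContinuousLinearMap.compL ℂ (L2 ν) (L2 (ν.restrict W)) (L2 (ν.restrict W))).flip
      (restrictOp ν W)).continuous)

lemma restrictOp_comp_chi {E : Set X} (hE : MeasurableSet E) :
    restrictOp ν W ∘L chi ν E = chi (ν.restrict W) E ∘L restrictOp ν W := by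
  ext1 f
  apply Lp.ext
  refine (restrictOp_coeFn W _).trans (.trans ?_ (chi_coeFn hE _).symm)
  filter_upwards [ae_restrict_of_ae (chi_coeFn hE f), restrictOp_coeFn W f] with x hx hx'
  refine hx.trans ?_
  by_cases h : x ∈ E <;> simp [h, hx']

lemma chi_comp_extendOp {E : Set X} (hE : MeasurableSet E) :
    chi ν E ∘L extendOp ν W = extendOp ν W ∘L chi (ν.restrict W) E := by
  have := congrArg ContinuousLinearMap.adjoint (restrictOp_comp_chi (ν := ν) (W := W) hE)
  rw [ContinuousLinearMap.adjoint_comp, ContinuousLinearMap.adjoint_comp,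
    ← ContinuousLinearMap.star_eq_adjoint (chi ν E),
    ← ContinuousLinearMap.star_eq_adjoint (chi (ν.restrict W) E), star_chi, star_chi] at this
  exact this

lemma extHom_mul_chi (hW : MeasurableSet W) {E : Set X} (hE : MeasurableSet E)
    (A : BL2 (ν.restrict W)) : extHom ν hW A * chi ν E = extHom ν hW (A * chi (ν.restrict W) E) := by
  change (extendOp ν W ∘L A ∘L restrictOp ν W) ∘L chi ν E = extendOp ν W ∘L _ ∘L _
  rw [ContinuousLinearMap.comp_assoc, ContinuousLinearMap.comp_assoc, restrictOp_comp_chi hE]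
  rfl

lemma chi_mul_extHom (hW : MeasurableSet W) {E : Set X} (hE : MeasurableSet E)
    (A : BL2 (ν.restrict W)) : chi ν E * extHom ν hW A = extHom ν hW (chi (ν.restrict W) E * A) := by
  change chi ν E ∘L (extendOp ν W ∘L A ∘L restrictOp ν W) = extendOp ν W ∘L _ ∘L _
  rw [← ContinuousLinearMap.comp_assoc, chi_comp_extendOp hE]
  rfl

lemma extHom_mul_chi_self (hW : MeasurableSet W) (A : BL2 (ν.restrict W)) :
    extHom ν hW A * chi ν W = extHom ν hW A := by
  rw [← compress_extHom hW A, extHom_compress, mul_assoc, mul_assoc, chi_mul_self hW, mul_assoc]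

lemma chi_mul_extHom_self (hW : MeasurableSet W) (A : BL2 (ν.restrict W)) :
    chi ν W * extHom ν hW A = extHom ν hW A := by
  rw [← compress_extHom hW A, extHom_compress, mul_assoc (chi ν W), ← mul_assoc (chi ν W), chi_mul_self hW]

lemma isApproximable_extHom (hW : MeasurableSet W) {A : BL2 (ν.restrict W)} :
    IsApproximable (extHom ν hW A) ↔ IsApproximable A := by
  refine ⟨fun h => ?_, fun h => (h.comp_right _).comp_left _⟩
  rw [← compress_extHom hW A]
  exact (h.comp_right _).comp_left _

/-- Indicators pass through the extension by zero, so both conditions can be tested on `L²(X)`. All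
later arguments take place there, which makes different half-spaces comparable. -/
lemma isRoe_extHom (hW : MeasurableSet W) {A : BL2 (ν.restrict W)} :
    IsRoe ν (extHom ν hW A) ↔ IsRoe (ν.restrict W) A := by
  have hL : LocComp ν (extHom ν hW A) ↔ LocComp (ν.restrict W) A := by
    refine forall_congr' fun E => forall_congr' fun hE => forall_congr' fun _ => ?_
    rw [extHom_mul_chi hW hE, chi_mul_extHom hW hE, isApproximable_extHom, isApproximable_extHom]
  have hP : ∀ R, FinProp ν (extHom ν hW A) R ↔ FinProp (ν.restrict W) A R := fun R => by
    refine forall_congr' fun E => forall_congr' fun F => forall_congr' fun hE => forall_congr'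
      fun hF => forall_congr' fun _ => ?_
    rw [chi_mul_extHom hW hE, extHom_mul_chi hW hF, map_eq_zero_iff _ (extHom_injective hW)]
  exact ⟨fun h => ⟨hL.1 h.1, h.2.imp fun R => (hP R).1⟩,
    fun h => ⟨hL.2 h.1, h.2.imp fun R => (hP R).2⟩⟩

lemma IsRoe.compress (hW : MeasurableSet W) {B : BL2 ν} (hB : IsRoe ν B) :
    IsRoe (ν.restrict W) (compress W B) := by
  rw [← isRoe_extHom hW, extHom_compress]
  exact (hB.mul_left (finProp_chi hW one_pos)).mul_right (finProp_chi hW one_pos)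

end Extension

/-! ### Translations and depth inside a half-space. -/

section Translations

variable {X : Type*} [MetricSpace X] [MeasurableSpace X] [BorelSpace X]
variable {Γ : Type*} [Group Γ] [MulAction Γ X] [IsIsometricSMul Γ X]
variable {μ : Measure X} [SMulInvariantMeasure Γ X μ]

lemma translateOp_coeFn (γ : Γ) (w : L2 μ) : translateOp μ γ w =ᵐ[μ] fun x => w (γ • x) :=
  Lp.coeFn_compMeasurePreserving _ (measurePreserving_smul γ μ)

/-- The order is reversed because `U_γ` is composition with `γ`. -/
lemma translateOp_mul (γ δ : Γ) :
    translateOp μ γ * translateOp μ δ = translateOp μ (δ * γ) := by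
  refine ContinuousLinearMap.ext fun w => ?_
  apply Lp.ext
  refine (translateOp_coeFn γ _).trans (.trans ?_ (translateOp_coeFn (δ * γ) w).symm)
  refine ((measurePreserving_smul γ μ).quasiMeasurePreserving.ae_eq_comp
    (translateOp_coeFn δ w)).trans ?_
  refine Filter.Eventually.of_forall fun x => ?_
  simp [mul_smul]

lemma translateOp_one : translateOp μ (1 : Γ) = 1 := by
  refine ContinuousLinearMap.ext fun w => ?_
  apply Lp.ext
  refine (translateOp_coeFn 1 _).trans (Filter.Eventually.of_forall fun x => ?_)
  simp

lemma translateOp_inv_mul (γ : Γ) : translateOp μ γ⁻¹ * translateOp μ γ = 1 := by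
  rw [translateOp_mul, mul_inv_cancel, translateOp_one]

lemma translateOp_mul_inv (γ : Γ) : translateOp μ γ * translateOp μ γ⁻¹ = 1 := by
  rw [translateOp_mul, inv_mul_cancel, translateOp_one]

lemma star_translateOp (γ : Γ) : star (translateOp μ γ) = translateOp μ γ⁻¹ := by
  have h : star (translateOp μ γ) * translateOp μ γ = 1 :=
    (translateOp μ γ).norm_map_iff_adjoint_comp_self.1
      (Lp.compMeasurePreservingₗᵢ ℂ (fun x : X => γ • x) (measurePreserving_smul γ μ)).norm_map
  calc _ = star (translateOp μ γ) * (translateOp μ γ * translateOp μ γ⁻¹) := by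
        rw [translateOp_mul_inv, mul_one]
    _ = _ := by rw [← mul_assoc, h, one_mul]

lemma norm_translateOp_apply (γ : Γ) (w : L2 μ) : ‖translateOp μ γ w‖ = ‖w‖ :=
  (Lp.compMeasurePreservingₗᵢ ℂ (fun x : X => γ • x) (measurePreserving_smul γ μ)).norm_map w

lemma measurableSet_preimage_smul (γ : Γ) {E : Set X} (hE : MeasurableSet E) :
    MeasurableSet ((γ • ·) ⁻¹' E : Set X) :=
  hE.preimage (continuous_const_smul γ).measurable

lemma translateOp_mul_chi (γ : Γ) {E : Set X} (hE : MeasurableSet E) :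
    translateOp μ γ * chi μ E = chi μ ((γ • ·) ⁻¹' E) * translateOp μ γ := by
  refine ContinuousLinearMap.ext fun w => ?_
  apply Lp.ext
  refine (translateOp_coeFn γ _).trans (.trans ?_
    (chi_coeFn (measurableSet_preimage_smul γ hE) _).symm)
  refine ((measurePreserving_smul γ μ).quasiMeasurePreserving.ae_eq_comp
    (chi_coeFn hE w)).trans ?_
  filter_upwards [translateOp_coeFn γ w] with x hx
  by_cases h : γ • x ∈ E
  · simp [h, hx]
  · simp [h]

end Translations

section Deep

variable {X : Type*} [MetricSpace X]

/-- The points at distance at least `R` from the complement of `W`. -/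
def deep (W : Set X) (R : ℝ) : Set X := {x | ENNReal.ofReal R ≤ Metric.infEDist x Wᶜ}

lemma isClosed_deep (W : Set X) (R : ℝ) : IsClosed (deep W R) :=
  isClosed_le continuous_const Metric.continuous_infEDist

/-- For `R ≤ 0` the set `deep W R` is the whole space, which is why positive radii are carried
along. -/
lemma deep_subset {W : Set X} {R : ℝ} (hR : 0 < R) : deep W R ⊆ W := fun x hx => by
  by_contra h
  have h0 : Metric.infEDist x Wᶜ = 0 := Metric.infEDist_zero_of_mem h
  have hx' : ENNReal.ofReal R ≤ Metric.infEDist x Wᶜ := hx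
  rw [h0] at hx'
  exact absurd (ENNReal.ofReal_pos.2 hR) (not_lt.2 hx')

lemma deep_anti {W : Set X} {R S : ℝ} (h : R ≤ S) : deep W S ⊆ deep W R :=
  fun _ hx => (ENNReal.ofReal_le_ofReal h).trans hx

lemma thickening_deep_subset {W : Set X} {R r : ℝ} (hR : 0 ≤ R) (hr : 0 ≤ r) :
    Metric.thickening r (deep W (R + r)) ⊆ deep W R := fun x hx => by
  obtain ⟨y, hy, hxy⟩ := Metric.mem_thickening_iff.1 hx
  by_contra h
  have h' : Metric.infEDist x Wᶜ < ENNReal.ofReal R := not_le.1 h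
  have h1 : Metric.infEDist y Wᶜ ≤ edist y x + Metric.infEDist x Wᶜ := by
    rw [add_comm]; exact Metric.infEDist_le_infEDist_add_edist
  have h2 : edist y x < ENNReal.ofReal r := by
    rw [edist_dist, dist_comm]
    exact (ENNReal.ofReal_lt_ofReal_iff (dist_nonneg.trans_lt hxy)).2 hxy
  have h3 := h1.trans_lt (ENNReal.add_lt_add h2 h')
  rw [← ENNReal.ofReal_add hr hR, add_comm] at h3
  exact absurd (show ENNReal.ofReal (R + r) ≤ _ from hy) (not_le.2 h3)

lemma isDeepIn_iff (hX : HasAlmostGeodesics X) {W : Set X} {R : ℝ} (hR : 0 < R) {f : X → ℂ} :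
    IsDeepIn W R f ↔ ∀ x, f x ≠ 0 → x ∈ deep W R := by
  refine forall_congr' fun x => forall_congr' fun _ => ?_
  constructor
  · rintro ⟨h1, h2⟩
    rwa [infEDist_frontier_eq hX h1] at h2
  · intro h
    have hW := deep_subset hR h
    exact ⟨hW, by rw [infEDist_frontier_eq hX hW]; exact h⟩

variable {Γ : Type*} [Group Γ] [MulAction Γ X] [IsIsometricSMul Γ X]

lemma thickening_preimage_smul (γ : Γ) (r : ℝ) (E : Set X) :
    Metric.thickening r ((γ • ·) ⁻¹' E : Set X) = (γ • ·) ⁻¹' (Metric.thickening r E) := by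
  ext x
  simp only [Metric.mem_thickening_iff, Set.mem_preimage]
  constructor
  · rintro ⟨z, hz, h⟩
    exact ⟨γ • z, hz, by rwa [dist_smul]⟩
  · rintro ⟨z, hz, h⟩
    exact ⟨γ⁻¹ • z, by simpa using hz, by rwa [← dist_smul γ, smul_inv_smul]⟩

/-- The functions `w` supported here are those for which both `w` and its translate `U_γ w` are
supported in `deep W R`. -/
def deepPair (W : Set X) (R : ℝ) (γ : Γ) : Set X := deep W R ∩ (γ⁻¹ • ·) ⁻¹' deep W R

lemma deepPair_anti {W : Set X} {R S : ℝ} (h : R ≤ S) (γ : Γ) : deepPair W S γ ⊆ deepPair W R γ :=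
  Set.inter_subset_inter (deep_anti h) (Set.preimage_mono (deep_anti h))

lemma thickening_deepPair_subset {W : Set X} {R r : ℝ} (hR : 0 ≤ R) (hr : 0 ≤ r) (γ : Γ) :
    Metric.thickening r (deepPair W (R + r) γ) ⊆ deepPair W R γ := by
  refine Set.subset_inter ?_ ?_
  · exact (Metric.thickening_subset_of_subset r Set.inter_subset_left).trans
      (thickening_deep_subset hR hr)
  · refine (Metric.thickening_subset_of_subset r Set.inter_subset_right).trans ?_
    rw [thickening_preimage_smul]
    exact Set.preimage_mono (thickening_deep_subset hR hr)

lemma preimage_deepPair (W : Set X) (R : ℝ) (γ : Γ) :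
    (γ • ·) ⁻¹' deepPair W R γ = deepPair W R γ⁻¹ := by
  ext x
  simp [deepPair, and_comm]

lemma isClosed_deepPair (W : Set X) (R : ℝ) (γ : Γ) : IsClosed (deepPair W R γ) :=
  (isClosed_deep W R).inter ((isClosed_deep W R).preimage (continuous_const_smul _))

end Deep

/-! ### The generating sets of the three algebras, expressed on `L²(X)`. -/

section Sets

variable {X : Type*} [MetricSpace X] [MeasurableSpace X] [BorelSpace X]
variable (Γ : Type*) [Group Γ] [MulAction Γ X] [IsIsometricSMul Γ X]
variable (μ : Measure X) [SMulInvariantMeasure Γ X μ] (W : Set X)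

/-- The operator `T` on `L²(X)` commutes with translations deep inside `W`. -/
def QuasiCommutes (T : BL2 μ) : Prop :=
  ∃ R : ℝ, 0 < R ∧ ∀ γ : Γ, translateOp μ γ * T * chi μ (deepPair W R γ) =
    T * translateOp μ γ * chi μ (deepPair W R γ)

variable {Γ μ W} {T S : BL2 μ} {r : ℝ}

lemma translate_comm_mono {R R' : ℝ} (h : R ≤ R') {γ : Γ}
    (hT : translateOp μ γ * T * chi μ (deepPair W R γ) =
      T * translateOp μ γ * chi μ (deepPair W R γ)) :
    translateOp μ γ * T * chi μ (deepPair W R' γ) =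
      T * translateOp μ γ * chi μ (deepPair W R' γ) := by
  rw [← mul_chi_of_subset (isClosed_deepPair W R' γ).measurableSet
    (isClosed_deepPair W R γ).measurableSet (deepPair_anti h γ), ← mul_assoc, hT, mul_assoc]

lemma quasiCommutes_zero : QuasiCommutes Γ μ W 0 := ⟨1, one_pos, fun γ => by simp⟩

lemma QuasiCommutes.add (hT : QuasiCommutes Γ μ W T) (hS : QuasiCommutes Γ μ W S) :
    QuasiCommutes Γ μ W (T + S) := by
  obtain ⟨R, hR, h⟩ := hT
  obtain ⟨R', hR', h'⟩ := hS
  refine ⟨max R R', lt_max_of_lt_left hR, fun γ => ?_⟩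
  rw [mul_add, add_mul, translate_comm_mono (le_max_left R R') (h γ),
    translate_comm_mono (le_max_right R R') (h' γ), add_mul, add_mul]

lemma QuasiCommutes.smul (hT : QuasiCommutes Γ μ W T) (c : ℂ) : QuasiCommutes Γ μ W (c • T) := by
  obtain ⟨R, hR, h⟩ := hT
  refine ⟨R, hR, fun γ => ?_⟩
  rw [mul_smul_comm, smul_mul_assoc, h γ, smul_mul_assoc, smul_mul_assoc]

/-- `S` moves supports by at most `r`, so starting `r` deeper leaves its output deep enough for `T`
to commute with the translation. -/
lemma QuasiCommutes.mul (hT : QuasiCommutes Γ μ W T) (hS : QuasiCommutes Γ μ W S)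
    (hr : 0 ≤ r) (hSr : FinProp μ S r) : QuasiCommutes Γ μ W (T * S) := by
  obtain ⟨R, hR, h⟩ := hT
  obtain ⟨R', hR', h'⟩ := hS
  refine ⟨max R R' + r, by positivity, fun γ => ?_⟩
  have h1 := translate_comm_mono (le_max_left R R') (h γ)
  have h2 := translate_comm_mono ((le_max_right R R').trans (le_add_of_nonneg_right hr)) (h' γ)
  have h3 := hSr.mul_chi_of_subset (isClosed_deepPair W (max R R' + r) γ).measurableSet
    (isClosed_deepPair W (max R R') γ).measurableSet
    (thickening_deepPair_subset (hR.le.trans (le_max_left _ _)) hr γ)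
  set E := chi μ (deepPair W (max R R' + r) γ)
  set F := chi μ (deepPair W (max R R') γ)
  set U := translateOp μ γ
  calc U * (T * S) * E = U * T * (S * E) := by noncomm_ring
    _ = (U * T * F) * S * E := by rw [← h3]; noncomm_ring
    _ = T * U * (F * S * E) := by rw [h1]; noncomm_ring
    _ = T * (U * S * E) := by rw [h3]; noncomm_ring
    _ = T * S * U * E := by rw [h2]; noncomm_ring

/-- Taking adjoints moves the cut-off to the left of the operator; finite propagation moves it back,
with a loss of depth `r`. The relation for `γ` comes from the one for `γ⁻¹`. -/
lemma QuasiCommutes.star (hT : QuasiCommutes Γ μ W T) (hr : 0 ≤ r) (hTr : FinProp μ T r) :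
    QuasiCommutes Γ μ W (star T) := by
  obtain ⟨R, hR, h⟩ := hT
  refine ⟨R + r, by positivity, fun γ => ?_⟩
  have hm : ∀ S (δ : Γ), MeasurableSet (deepPair W S δ) :=
    fun S δ => (isClosed_deepPair W S δ).measurableSet
  have h1 := h γ⁻¹
  have h2 := hTr.chi_mul_of_subset (hm (R + r) γ) (hm R γ) (thickening_deepPair_subset hR.le hr γ)
  have h3 := hTr.chi_mul_of_subset (hm (R + r) γ⁻¹) (hm R γ⁻¹)
    (thickening_deepPair_subset hR.le hr γ⁻¹)
  have e : ∀ S, translateOp μ γ⁻¹ * chi μ (deepPair W S γ⁻¹) =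
      chi μ (deepPair W S γ) * translateOp μ γ⁻¹ := fun S => by
    rw [translateOp_mul_chi _ (hm S γ⁻¹), preimage_deepPair, inv_inv]
  have key : chi μ (deepPair W (R + r) γ) * T * translateOp μ γ⁻¹ =
      chi μ (deepPair W (R + r) γ) * translateOp μ γ⁻¹ * T := by
    rw [← h2, mul_assoc, ← e R, ← e (R + r)]
    calc _ = chi μ (deepPair W (R + r) γ) * (T * translateOp μ γ⁻¹ * chi μ (deepPair W R γ⁻¹)) := by
          noncomm_ring
      _ = (chi μ (deepPair W (R + r) γ) * translateOp μ γ⁻¹) * T * chi μ (deepPair W R γ⁻¹) := by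
          rw [← h1]; noncomm_ring
      _ = translateOp μ γ⁻¹ * (chi μ (deepPair W (R + r) γ⁻¹) * T * chi μ (deepPair W R γ⁻¹)) := by
          rw [← e (R + r)]; noncomm_ring
      _ = _ := by rw [h3]; noncomm_ring
  have := congrArg Star.star key
  simp only [star_mul, star_chi, star_translateOp, inv_inv] at this
  rw [mul_assoc, mul_assoc, this]

variable [ProperSpace X] [IsFiniteMeasureOnCompacts μ]

lemma mem_quasiEquivariantSet_iff (hX : HasAlmostGeodesics X) (hW : MeasurableSet W)
    {A : BL2 (μ.restrict W)} :
    A ∈ quasiEquivariantSet Γ μ W ↔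
      IsRoe μ (extHom μ hW A) ∧ QuasiCommutes Γ μ W (extHom μ hW A) := by
  have hm : ∀ S (δ : Γ), MeasurableSet (deepPair W S δ) :=
    fun S δ => (isClosed_deepPair W S δ).measurableSet
  have hr : ∀ f : C_c(X, ℂ), ccToL2 (μ.restrict W) f = restrictOp μ W (ccToL2 μ f) :=
    fun f => (restrictOp_ccToL2 μ W f).symm
  have hpair : ∀ {R : ℝ} (γ : Γ) (f : C_c(X, ℂ)), 0 < R →
      ((IsDeepIn W R f ∧ IsDeepIn W R fun x => f (γ • x)) ↔
        ∀ x, f x ≠ 0 → x ∈ deepPair W R γ) := by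
    intro R γ f hR
    rw [isDeepIn_iff hX hR, isDeepIn_iff hX hR]
    constructor
    · rintro ⟨h1, h2⟩ x hx
      exact ⟨h1 x hx, h2 (γ⁻¹ • x) (by simpa using hx)⟩
    · intro h
      refine ⟨fun x hx => (h x hx).1, fun x hx => ?_⟩
      simpa using (h (γ • x) hx).2
  constructor
  · rintro ⟨h1, h2, R₀, hR₀, h3⟩
    have hroe : IsRoe μ (extHom μ hW A) := (isRoe_extHom hW).2 (isRoe_iff.2 ⟨h1, h2⟩)
    refine ⟨hroe, ?_⟩
    obtain ⟨r₀, hr₀⟩ := hroe.finProp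
    obtain ⟨r, hr0, hr'⟩ : ∃ r, 0 ≤ r ∧ FinProp μ (extHom μ hW A) r :=
      ⟨max r₀ 0, le_max_right _ _, hr₀.mono (le_max_left _ _)⟩
    -- One unit makes the radius positive, so that deep points lie in `W`; `r` pays for the
    -- propagation of `A`; the last unit is the neighbourhood used in `comp_chi_eq_zero_of_ccToL2`.
    refine ⟨R₀ + 1 + r + 1, by positivity, fun γ => ?_⟩
    rw [← sub_eq_zero, ← sub_mul]
    refine comp_chi_eq_zero_of_ccToL2 (hm _ _) one_pos fun f hf => ?_
    have hf1 : ∀ x, f x ≠ 0 → x ∈ deepPair W (R₀ + 1 + r) γ := fun x hx =>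
      thickening_deepPair_subset (by positivity) zero_le_one γ (hf x hx)
    have hf2 : ∀ x, f x ≠ 0 → x ∈ deepPair W (R₀ + 1) γ := fun x hx =>
      deepPair_anti (by linarith) γ (hf1 x hx)
    have hfW : ∀ x, f x ≠ 0 → x ∈ W := fun x hx => deep_subset (by positivity) (hf2 x hx).1
    obtain ⟨hd1, hd2⟩ := (hpair γ f (by positivity)).2 hf2
    have hmono : ∀ {g : X → ℂ}, IsDeepIn W (R₀ + 1) g → IsDeepIn W R₀ g := fun hg x hx =>
      ⟨(hg x hx).1, (ENNReal.ofReal_le_ofReal (by linarith)).trans (hg x hx).2⟩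
    have key := congrArg (extendOp μ W) (h3 γ f (hmono hd1) (hmono hd2))
    rw [hr f] at key
    have hext : extendOp μ W (restrictOp μ W (ccToL2 μ f)) = ccToL2 μ f := by
      rw [← hr, extendOp_ccToL2 μ f hfW]
    simp only [compTranslateOp, ContinuousLinearMap.comp_apply, hext] at key
    have key' : chi μ W (translateOp μ γ (extHom μ hW A (ccToL2 μ f))) =
        extHom μ hW A (translateOp μ γ (ccToL2 μ f)) := key
    -- The compressed translation loses nothing here: the image under `A` is still supported where
    -- the translate stays inside `W`.
    have e : chi μ W * translateOp μ γ * extHom μ hW A * chi μ (deepPair W (R₀ + 1 + r) γ) =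
        translateOp μ γ * extHom μ hW A * chi μ (deepPair W (R₀ + 1 + r) γ) := by
      have h4 := hr'.mul_chi_of_subset (hm (R₀ + 1 + r) γ) (hm (R₀ + 1) γ)
        (thickening_deepPair_subset (by positivity) hr0 γ)
      have h5 := translateOp_mul_chi (μ := μ) γ (hm (R₀ + 1) γ)
      rw [preimage_deepPair] at h5
      have h6 := mul_chi_of_subset (ν := μ) (hm (R₀ + 1) γ⁻¹) hW
        (Set.inter_subset_left.trans (deep_subset (by positivity)))
      rw [mul_assoc, ← h4, mul_assoc (translateOp μ γ), ← h4]
      calc _ = chi μ W * (translateOp μ γ * chi μ (deepPair W (R₀ + 1) γ)) * extHom μ hW A *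
            chi μ (deepPair W (R₀ + 1 + r) γ) := by noncomm_ring
        _ = (chi μ W * chi μ (deepPair W (R₀ + 1) γ⁻¹)) * translateOp μ γ * extHom μ hW A *
            chi μ (deepPair W (R₀ + 1 + r) γ) := by rw [h5]; noncomm_ring
        _ = (chi μ (deepPair W (R₀ + 1) γ⁻¹) * translateOp μ γ) * extHom μ hW A *
            chi μ (deepPair W (R₀ + 1 + r) γ) := by rw [h6]
        _ = _ := by rw [← h5]; noncomm_ring
    have e' := congrArg (fun T : BL2 μ => T (ccToL2 μ f)) e
    simp only [mul_apply_eq_comp] at e'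
    rw [chi_ccToL2 (hm _ _) f hf1] at e'
    change translateOp μ γ (extHom μ hW A (ccToL2 μ f)) -
      extHom μ hW A (translateOp μ γ (ccToL2 μ f)) = 0
    rw [← key', e', sub_self]
  · rintro ⟨h1, R, hR, h2⟩
    obtain ⟨h3, h4⟩ := isRoe_iff.1 ((isRoe_extHom hW).1 h1)
    refine ⟨h3, h4, R, hR.le, fun γ f hf hf' => ?_⟩
    have hfd := (hpair γ f hR).1 ⟨hf, hf'⟩
    have hfW : ∀ x, f x ≠ 0 → x ∈ W := fun x hx => (hf x hx).1
    have hext : extendOp μ W (ccToL2 (μ.restrict W) f) = ccToL2 μ f := extendOp_ccToL2 μ f hfW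
    have key := congrArg (fun T : BL2 μ => restrictOp μ W (T (ccToL2 μ f))) (h2 γ)
    simp only [mul_apply_eq_comp] at key
    rw [chi_ccToL2 (hm _ _) f hfd, extHom_apply, extHom_apply] at key
    have hre : ∀ x, restrictOp μ W (extendOp μ W x) = x := fun x =>
      congrArg (fun T : BL2 (μ.restrict W) => T x) (restrictOp_extendOp hW)
    rw [hre] at key
    simp only [compTranslateOp, ContinuousLinearMap.comp_apply, hext]
    rw [hr]
    exact key

lemma mem_localizedSet_iff (hX : HasAlmostGeodesics X) (hW : MeasurableSet W)
    {A : BL2 (μ.restrict W)} :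
    A ∈ localizedSet μ W ↔
      IsRoe μ (extHom μ hW A) ∧ ∃ R : ℝ, 0 < R ∧ extHom μ hW A * chi μ (deep W R) = 0 := by
  constructor
  · rintro ⟨h1, h2, R₀, hR₀, h3⟩
    refine ⟨(isRoe_extHom hW).2 (isRoe_iff.2 ⟨h1, h2⟩), R₀ + 1 + 1, by positivity, ?_⟩
    refine comp_chi_eq_zero_of_ccToL2 (isClosed_deep _ _).measurableSet one_pos fun f hf => ?_
    have hf1 : ∀ x, f x ≠ 0 → x ∈ deep W (R₀ + 1) := fun x hx =>
      thickening_deep_subset (by positivity) zero_le_one (hf x hx)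
    have hd := (isDeepIn_iff hX (by positivity)).2 hf1
    rw [extHom_apply, restrictOp_ccToL2, h3 f fun x hx =>
      ⟨(hd x hx).1, (ENNReal.ofReal_le_ofReal (by linarith)).trans (hd x hx).2⟩, map_zero]
  · rintro ⟨h1, R, hR, h2⟩
    obtain ⟨h3, h4⟩ := isRoe_iff.1 ((isRoe_extHom hW).1 h1)
    refine ⟨h3, h4, R, hR.le, fun f hf => ?_⟩
    have key := congrArg (fun T : BL2 μ => restrictOp μ W (T (ccToL2 μ f))) h2
    have hre : ∀ x, restrictOp μ W (extendOp μ W x) = x := fun x =>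
      congrArg (fun T : BL2 (μ.restrict W) => T x) (restrictOp_extendOp hW)
    simp only [mul_apply_eq_comp] at key
    rw [chi_ccToL2 (isClosed_deep _ _).measurableSet f ((isDeepIn_iff hX hR).1 hf), extHom_apply,
      hre, restrictOp_ccToL2] at key
    rw [key]
    exact map_zero (restrictOp μ W)

lemma mem_equivariantRoeSet_iff {A : BL2 μ} :
    A ∈ equivariantRoeSet Γ μ ↔ IsRoe μ A ∧ ∀ γ : Γ, translateOp μ γ * A = A * translateOp μ γ := by
  rw [isRoe_iff]
  exact ⟨fun h => ⟨⟨h.1, h.2.1⟩, h.2.2⟩, fun h => ⟨h.1.1, h.1.2, h.2⟩⟩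

-- The generating set is already a *-algebra, so elements of the completed algebra are norm limits
-- of generators. The same holds for the two algebras on `L²(W)`.
variable (Γ μ) in
lemma coe_equivariantRoe : (equivariantRoe Γ μ : Set (BL2 μ)) = closure (equivariantRoeSet Γ μ) := by
  let S : NonUnitalStarSubalgebra ℂ (BL2 μ) :=
    { carrier := equivariantRoeSet Γ μ
      zero_mem' := mem_equivariantRoeSet_iff.2 ⟨isRoe_zero, fun γ => by simp⟩
      add_mem' := fun {A B} hA hB => by
        rw [mem_equivariantRoeSet_iff] at *
        exact ⟨hA.1.add hB.1, fun γ => by rw [mul_add, hA.2, hB.2, add_mul]⟩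
      mul_mem' := fun {A B} hA hB => by
        rw [mem_equivariantRoeSet_iff] at *
        exact ⟨hA.1.mul hB.1, fun γ => by rw [← mul_assoc, hA.2, mul_assoc, hB.2, mul_assoc]⟩
      smul_mem' := fun c A hA => by
        rw [mem_equivariantRoeSet_iff] at *
        exact ⟨hA.1.smul c, fun γ => by rw [mul_smul_comm, hA.2, smul_mul_assoc]⟩
      star_mem' := fun {A} hA => by
        rw [mem_equivariantRoeSet_iff] at *
        refine ⟨hA.1.star, fun γ => ?_⟩
        have := congrArg star (hA.2 γ⁻¹)
        rw [star_mul, star_mul, star_translateOp, inv_inv] at this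
        exact this.symm }
  have h : NonUnitalStarAlgebra.adjoin ℂ (equivariantRoeSet Γ μ) = S :=
    NonUnitalStarAlgebra.adjoin_eq S
  rw [equivariantRoe, h]
  rfl

variable (Γ) in
lemma coe_quasiEquivariantRoe (hX : HasAlmostGeodesics X) (hW : MeasurableSet W) :
    (quasiEquivariantRoe Γ μ W : Set (BL2 (μ.restrict W))) =
      closure (quasiEquivariantSet Γ μ W) := by
  have hpos : ∀ {A : BL2 μ}, IsRoe μ A → ∃ r, 0 ≤ r ∧ FinProp μ A r := fun hA => by
    obtain ⟨r, hr⟩ := hA.finProp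
    exact ⟨max r 0, le_max_right _ _, hr.mono (le_max_left _ _)⟩
  let S : NonUnitalStarSubalgebra ℂ (BL2 (μ.restrict W)) :=
    { carrier := quasiEquivariantSet Γ μ W
      zero_mem' := (mem_quasiEquivariantSet_iff hX hW).2
        (by rw [map_zero]; exact ⟨isRoe_zero, quasiCommutes_zero⟩)
      add_mem' := fun {A B} hA hB => by
        rw [mem_quasiEquivariantSet_iff hX hW] at *
        rw [map_add]
        exact ⟨hA.1.add hB.1, hA.2.add hB.2⟩
      mul_mem' := fun {A B} hA hB => by
        rw [mem_quasiEquivariantSet_iff hX hW] at *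
        rw [map_mul]
        obtain ⟨r, hr, h⟩ := hpos hB.1
        exact ⟨hA.1.mul hB.1, hA.2.mul hB.2 hr h⟩
      smul_mem' := fun c A hA => by
        rw [mem_quasiEquivariantSet_iff hX hW] at *
        rw [map_smul]
        exact ⟨hA.1.smul c, hA.2.smul c⟩
      star_mem' := fun {A} hA => by
        rw [mem_quasiEquivariantSet_iff hX hW] at *
        rw [map_star]
        obtain ⟨r, hr, h⟩ := hpos hA.1
        exact ⟨hA.1.star, hA.2.star hr h⟩ }
  have h : NonUnitalStarAlgebra.adjoin ℂ (quasiEquivariantSet Γ μ W) = S :=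
    NonUnitalStarAlgebra.adjoin_eq S
  rw [quasiEquivariantRoe, h]
  rfl

lemma coe_localizedRoe (hX : HasAlmostGeodesics X) (hW : MeasurableSet W) :
    (localizedRoe μ W : Set (BL2 (μ.restrict W))) = closure (localizedSet μ W) := by
  have hd : ∀ R, MeasurableSet (deep W R) := fun R => (isClosed_deep W R).measurableSet
  have hmono : ∀ {A : BL2 μ} {R S : ℝ}, R ≤ S → A * chi μ (deep W R) = 0 →
      A * chi μ (deep W S) = 0 := fun {A R S} h hA => by
    rw [← mul_chi_of_subset (hd S) (hd R) (deep_anti h), ← mul_assoc, hA, zero_mul]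
  let S : NonUnitalStarSubalgebra ℂ (BL2 (μ.restrict W)) :=
    { carrier := localizedSet μ W
      zero_mem' := (mem_localizedSet_iff hX hW).2
        (by rw [map_zero]; exact ⟨isRoe_zero, 1, one_pos, zero_mul _⟩)
      add_mem' := fun {A B} hA hB => by
        rw [mem_localizedSet_iff hX hW] at *
        rw [map_add]
        obtain ⟨hA, R, hR, h⟩ := hA
        obtain ⟨hB, R', hR', h'⟩ := hB
        exact ⟨hA.add hB, max R R', lt_max_of_lt_left hR, by
          rw [add_mul, hmono (le_max_left _ _) h, hmono (le_max_right _ _) h', add_zero]⟩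
      mul_mem' := fun {A B} hA hB => by
        rw [mem_localizedSet_iff hX hW] at *
        rw [map_mul]
        obtain ⟨hB, R, hR, h⟩ := hB
        exact ⟨hA.1.mul hB, R, hR, by rw [mul_assoc, h, mul_zero]⟩
      smul_mem' := fun c A hA => by
        rw [mem_localizedSet_iff hX hW] at *
        rw [map_smul]
        obtain ⟨hA, R, hR, h⟩ := hA
        exact ⟨hA.smul c, R, hR, by rw [smul_mul_assoc, h, smul_zero]⟩
      star_mem' := fun {A} hA => by
        rw [mem_localizedSet_iff hX hW] at *
        rw [map_star]
        obtain ⟨hA, R, hR, h⟩ := hA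
        obtain ⟨r, hr⟩ := hA.finProp
        have hr' : FinProp μ (extHom μ hW A) (max r 0) := hr.mono (le_max_left _ _)
        -- The adjoint maps functions at depth `R + r` to functions at depth `R`, which the relation
        -- `chi * star A = 0` annihilates.
        refine ⟨hA.star, R + max r 0, by positivity, ?_⟩
        have e := congrArg star h
        rw [star_mul, star_chi, star_zero] at e
        rw [← hr'.star.mul_chi_of_subset (hd _) (hd R)
          (thickening_deep_subset hR.le (le_max_right _ _)), e, zero_mul] }
  have h : NonUnitalStarAlgebra.adjoin ℂ (localizedSet μ W) = S :=
    NonUnitalStarAlgebra.adjoin_eq S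
  rw [localizedRoe, h]
  rfl

end Sets

/-! ### Deep translations and strong limits of conjugates. -/

section DeepSequences

variable {X : Type*} [MetricSpace X]
variable {Γ : Type*} [Group Γ] [MulAction Γ X] [IsIsometricSMul Γ X]

/-- A sequence of translations moving larger and larger balls deeper and deeper into `W`. -/
def IsDeepSeq (W : Set X) (x₀ : X) (g : ℕ → Γ) : Prop :=
  ∀ n : ℕ, ∀ y ∈ Metric.ball x₀ n, g n • y ∈ deep W n

lemma exists_isDeepSeq [MeasurableSpace X] {μ : Measure X} {W : Set X} (hW : IsHalfSpace μ W)
    (hΓ : ∃ D : ℝ, 0 ≤ D ∧ ∀ x y : X, ∃ γ : Γ, dist (γ • x) y ≤ D) (x₀ : X) :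
    ∃ g : ℕ → Γ, IsDeepSeq W x₀ g := by
  obtain ⟨D, hD0, hD⟩ := hΓ
  have h : ∀ n : ℕ, ∃ γ : Γ, ∀ y ∈ Metric.ball x₀ n, γ • y ∈ deep W n := fun n => by
    -- A translate of `x₀` is within `D` of `x`, and the ball about it has radius `n`, so the whole
    -- ball is within `n + D + 1` of a point at depth `n + (n + D + 1)`.
    obtain ⟨x, hx⟩ := hW.unbounded (n + (n + D + 1))
    obtain ⟨γ, hγ⟩ := hD x₀ x
    refine ⟨γ, fun y hy => ?_⟩
    refine thickening_deep_subset (W := W) (R := n) (r := n + D + 1) (by positivity) (by positivity)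
      (Metric.mem_thickening_iff.2 ⟨x, hx, ?_⟩)
    have h1 : dist (γ • y) (γ • x₀) < n := by rw [dist_smul]; exact hy
    linarith [dist_triangle (γ • y) (γ • x₀) x]
  exact ⟨fun n => (h n).choose, fun n => (h n).choose_spec⟩

lemma IsDeepSeq.eventually {W : Set X} {x₀ : X} {g : ℕ → Γ} (hg : IsDeepSeq W x₀ g) {E : Set X}
    (hE : Bornology.IsBounded E) (R : ℝ) :
    ∀ᶠ n in Filter.atTop, ∀ y ∈ E, g n • y ∈ deep W R := by
  obtain ⟨r, hr⟩ := hE.subset_ball x₀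
  filter_upwards [Filter.eventually_ge_atTop ⌈r⌉₊, Filter.eventually_ge_atTop ⌈R⌉₊] with n h1 h2 y hy
  exact deep_anti (Nat.ceil_le.1 h2) (hg n y (Metric.ball_subset_ball (Nat.ceil_le.1 h1) (hr hy)))

end DeepSequences

section StrongLimits

variable {X : Type*} [MetricSpace X] [MeasurableSpace X] [BorelSpace X]
variable {Γ : Type*} [Group Γ] [MulAction Γ X] [IsIsometricSMul Γ X]
variable {μ : Measure X} [SMulInvariantMeasure Γ X μ]

/-- Conjugation of an operator by a translation. -/
def conjTranslate (a : Γ) (T : BL2 μ) : BL2 μ := translateOp μ a * T * translateOp μ a⁻¹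

lemma conjTranslate_mul (a : Γ) (T S : BL2 μ) :
    conjTranslate a (T * S) = conjTranslate a T * conjTranslate a S := by
  have := translateOp_inv_mul (μ := μ) a
  calc _ = translateOp μ a * T * 1 * S * translateOp μ a⁻¹ := by rw [conjTranslate]; noncomm_ring
    _ = _ := by rw [← this, conjTranslate, conjTranslate]; noncomm_ring

lemma conjTranslate_add (a : Γ) (T S : BL2 μ) :
    conjTranslate a (T + S) = conjTranslate a T + conjTranslate a S := by
  simp only [conjTranslate, mul_add, add_mul]

lemma conjTranslate_sub (a : Γ) (T S : BL2 μ) :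
    conjTranslate a (T - S) = conjTranslate a T - conjTranslate a S := by
  simp only [conjTranslate, mul_sub, sub_mul]

lemma conjTranslate_smul (a : Γ) (c : ℂ) (T : BL2 μ) :
    conjTranslate a (c • T) = c • conjTranslate a T := by
  simp only [conjTranslate, mul_smul_comm, smul_mul_assoc]

lemma conjTranslate_star (a : Γ) (T : BL2 μ) :
    conjTranslate a (star T) = star (conjTranslate a T) := by
  simp only [conjTranslate, star_mul, star_translateOp, inv_inv, mul_assoc]

lemma conjTranslate_chi (a : Γ) {E : Set X} (hE : MeasurableSet E) :
    conjTranslate a (chi μ E) = chi μ ((a • ·) ⁻¹' E) := by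
  rw [conjTranslate, translateOp_mul_chi a hE, mul_assoc, translateOp_mul_inv, mul_one]

lemma conjTranslate_one (T : BL2 μ) : conjTranslate (1 : Γ) T = T := by
  rw [conjTranslate, inv_one, translateOp_one, one_mul, mul_one]

lemma translateOp_mul_conjTranslate (γ a : Γ) (T : BL2 μ) :
    translateOp μ γ * conjTranslate a T = conjTranslate (a * γ) T * translateOp μ γ := by
  have h1 := translateOp_mul (μ := μ) γ a
  have h2 := translateOp_mul (μ := μ) a⁻¹ γ⁻¹
  rw [conjTranslate, conjTranslate, ← h1, mul_inv_rev, ← h2, mul_assoc _ _ (translateOp μ γ),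
    mul_assoc _ _ (translateOp μ γ), translateOp_inv_mul, mul_one, mul_assoc, mul_assoc, mul_assoc]

lemma norm_conjTranslate_apply_le (a : Γ) (T : BL2 μ) (w : L2 μ) :
    ‖conjTranslate a T w‖ ≤ ‖T‖ * ‖w‖ := by
  change ‖translateOp μ a (T (translateOp μ a⁻¹ w))‖ ≤ _
  rw [norm_translateOp_apply]
  exact (T.le_opNorm _).trans_eq (by rw [norm_translateOp_apply])

lemma FinProp.conjTranslate {T : BL2 μ} {r : ℝ} (hT : FinProp μ T r) (a : Γ) :
    FinProp μ (conjTranslate a T) r := by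
  intro E F hE hF h
  have hE' := conjTranslate_chi (μ := μ) a (measurableSet_preimage_smul a⁻¹ hE)
  have hF' := conjTranslate_chi (μ := μ) a (measurableSet_preimage_smul a⁻¹ hF)
  have e : ∀ G : Set X, (a • ·) ⁻¹' ((a⁻¹ • ·) ⁻¹' G : Set X) = G := fun G => by ext x; simp
  rw [e] at hE' hF'
  rw [← hE', ← hF', ← conjTranslate_mul, ← conjTranslate_mul,
    hT _ _ (measurableSet_preimage_smul a⁻¹ hE) (measurableSet_preimage_smul a⁻¹ hF)
      fun x hx y hy => (h _ hx _ hy).trans_eq (dist_smul _ _ _)]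
  simp [_root_.conjTranslate]

lemma IsApproximable.conjTranslate {T : BL2 μ} (hT : IsApproximable T) (a : Γ) :
    IsApproximable (conjTranslate a T) :=
  (hT.mul_left _).mul_right _

/-- The conjugates of `T` by the translations `g n` converge strongly to `B`. -/
def StrongLim (g : ℕ → Γ) (T B : BL2 μ) : Prop :=
  ∀ w, Filter.Tendsto (fun n => conjTranslate (g n) T w) Filter.atTop (nhds (B w))

variable {g : ℕ → Γ} {T S B C : BL2 μ}

lemma StrongLim.unique (h : StrongLim g T B) (h' : StrongLim g T C) : B = C :=
  ContinuousLinearMap.ext fun w => tendsto_nhds_unique (h w) (h' w)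

lemma strongLim_zero : StrongLim g (0 : BL2 μ) 0 := fun w => by
  simp [conjTranslate]

lemma StrongLim.add (h : StrongLim g T B) (h' : StrongLim g S C) :
    StrongLim g (T + S) (B + C) := fun w => by
  simp only [conjTranslate_add]
  exact (h w).add (h' w)

lemma StrongLim.sub (h : StrongLim g T B) (h' : StrongLim g S C) :
    StrongLim g (T - S) (B - C) := fun w => by
  simp only [conjTranslate_sub]
  exact (h w).sub (h' w)

lemma StrongLim.smul (h : StrongLim g T B) (c : ℂ) : StrongLim g (c • T) (c • B) := fun w => by
  simp only [conjTranslate_smul]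
  exact (h w).const_smul c

/-- Strong convergence is compatible with products because the conjugates of `T` are uniformly
bounded by `‖T‖`. -/
lemma StrongLim.mul (h : StrongLim g T B) (h' : StrongLim g S C) :
    StrongLim g (T * S) (B * C) := fun w => by
  have h1 := h (C w)
  have h2 : Filter.Tendsto (fun n => conjTranslate (g n) T (conjTranslate (g n) S w - C w))
      Filter.atTop (nhds 0) := by
    have h3 := ((h' w).sub_const (C w)).norm.const_mul ‖T‖
    rw [sub_self, norm_zero, mul_zero] at h3
    exact squeeze_zero_norm (fun n => norm_conjTranslate_apply_le _ _ _) h3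
  have h4 := h2.add h1
  rw [zero_add] at h4
  refine h4.congr fun n => ?_
  rw [map_sub, sub_add_cancel, conjTranslate_mul]
  rfl

/-- The adjoint is not strongly continuous, so a limit for `star T` is assumed as well; weak limits
then identify it. -/
lemma StrongLim.star_eq (h : StrongLim g T B) (h' : StrongLim g (star T) C) : C = star B := by
  refine ContinuousLinearMap.ext fun v => ext_inner_left ℂ fun w => ?_
  have h1 := (tendsto_const_nhds (x := w)).inner (𝕜 := ℂ) (h' v)
  have h2 := (h w).inner (𝕜 := ℂ) (tendsto_const_nhds (x := v))
  rw [ContinuousLinearMap.star_eq_adjoint, ContinuousLinearMap.adjoint_inner_right]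
  refine tendsto_nhds_unique h1 (h2.congr fun n => ?_)
  rw [conjTranslate_star, ContinuousLinearMap.star_eq_adjoint,
    ContinuousLinearMap.adjoint_inner_right]

lemma StrongLim.norm_le (h : StrongLim g T B) : ‖B‖ ≤ ‖T‖ :=
  ContinuousLinearMap.opNorm_le_bound _ (norm_nonneg _) fun w =>
    le_of_tendsto (h w).norm (Filter.Eventually.of_forall fun _ => norm_conjTranslate_apply_le _ _ _)

lemma StrongLim.of_tendsto {t b : ℕ → BL2 μ} (h : ∀ k, StrongLim g (t k) (b k))
    (ht : Filter.Tendsto t Filter.atTop (nhds T)) (hb : Filter.Tendsto b Filter.atTop (nhds B)) :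
    StrongLim g T B := by
  intro w
  refine Metric.tendsto_atTop.2 fun ε hε => ?_
  obtain ⟨δ, hδ, hδε⟩ : ∃ δ > 0, δ * ‖w‖ ≤ ε / 3 := ⟨ε / 3 / (‖w‖ + 1), by positivity, by
    rw [div_mul_eq_mul_div, div_le_iff₀ (by positivity)]
    nlinarith [norm_nonneg w]⟩
  obtain ⟨k, hk1, hk2⟩ := ((Metric.tendsto_nhds.1 ht δ hδ).and (Metric.tendsto_nhds.1 hb δ hδ)).exists
  obtain ⟨N, hN⟩ := Metric.tendsto_atTop.1 (h k w) (ε / 3) (by positivity)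
  refine ⟨N, fun n hn => ?_⟩
  have h1 : ‖conjTranslate (g n) (T - t k) w‖ ≤ ε / 3 :=
    (norm_conjTranslate_apply_le _ _ _).trans (le_trans (mul_le_mul_of_nonneg_right (by
      rw [← dist_eq_norm, dist_comm]; exact hk1.le) (norm_nonneg w)) hδε)
  have h2 : ‖(b k - B) w‖ ≤ ε / 3 :=
    ((b k - B).le_opNorm w).trans (le_trans (mul_le_mul_of_nonneg_right (by
      rw [← dist_eq_norm]; exact hk2.le) (norm_nonneg w)) hδε)
  have h3 := hN n hn
  rw [dist_eq_norm] at h3 ⊢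
  have e : conjTranslate (g n) T w - B w = conjTranslate (g n) (T - t k) w +
      (conjTranslate (g n) (t k) w - b k w) + (b k - B) w := by
    rw [conjTranslate_sub]
    change _ = (conjTranslate (g n) T w - conjTranslate (g n) (t k) w) + _ + (b k w - B w)
    abel
  rw [e]
  linarith [norm_add₃_le (a := conjTranslate (g n) (T - t k) w)
    (b := conjTranslate (g n) (t k) w - b k w) (c := (b k - B) w)]

variable [ProperSpace X] [IsFiniteMeasureOnCompacts μ] {W : Set X}

lemma conjTranslate_mul_chi_eq {R : ℝ}
    (hT : ∀ γ : Γ, translateOp μ γ * T * chi μ (deepPair W R γ) =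
      T * translateOp μ γ * chi μ (deepPair W R γ)) {E : Set X} (hE : MeasurableSet E) {a b : Γ}
    (ha : ∀ y ∈ E, a • y ∈ deep W R) (hb : ∀ y ∈ E, b • y ∈ deep W R) :
    conjTranslate a T * chi μ E = conjTranslate b T * chi μ E := by
  have hE' : MeasurableSet ((b⁻¹ • ·) ⁻¹' E : Set X) := measurableSet_preimage_smul _ hE
  -- The set is the translate `b E`, and `b * a⁻¹` is the translation comparing the two conjugates:
  -- functions on `b E` and their translates on `a E` are both deep, so `T` commutes with it there.
  have hsub : ((b⁻¹ • ·) ⁻¹' E : Set X) ⊆ deepPair W R (b * a⁻¹) := fun x hx => by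
    refine ⟨by simpa using hb _ hx, ?_⟩
    have := ha _ hx
    simpa [mul_smul] using this
  have h1 := hT (b * a⁻¹)
  have h2 : translateOp μ (b * a⁻¹) * T * chi μ ((b⁻¹ • ·) ⁻¹' E) =
      T * translateOp μ (b * a⁻¹) * chi μ ((b⁻¹ • ·) ⁻¹' E) := by
    rw [← mul_chi_of_subset hE' (isClosed_deepPair W R _).measurableSet hsub, ← mul_assoc, h1,
      mul_assoc]
  have e1 : translateOp μ a⁻¹ = translateOp μ (b * a⁻¹) * translateOp μ b⁻¹ := by
    rw [translateOp_mul, inv_mul_cancel_left]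
  have e2 : translateOp μ a * translateOp μ (b * a⁻¹) = translateOp μ b := by
    rw [translateOp_mul, inv_mul_cancel_right]
  have e3 := translateOp_mul_chi (μ := μ) b⁻¹ hE
  calc _ = translateOp μ a * T * translateOp μ (b * a⁻¹) * (translateOp μ b⁻¹ * chi μ E) := by
        rw [conjTranslate, e1]; noncomm_ring
    _ = translateOp μ a * (T * translateOp μ (b * a⁻¹) * chi μ ((b⁻¹ • ·) ⁻¹' E)) *
        translateOp μ b⁻¹ := by rw [e3]; noncomm_ring
    _ = (translateOp μ a * translateOp μ (b * a⁻¹)) * T *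
        (chi μ ((b⁻¹ • ·) ⁻¹' E) * translateOp μ b⁻¹) := by rw [← h2]; noncomm_ring
    _ = _ := by rw [← e3, e2, conjTranslate]; noncomm_ring

/-- The periodization of a quasi-equivariant locally compact operator of finite propagation. -/
lemma exists_strongLim {x₀ : X} (hg : IsDeepSeq W x₀ g) (hroe : IsRoe μ T) {R : ℝ}
    (hT : ∀ γ : Γ, translateOp μ γ * T * chi μ (deepPair W R γ) =
      T * translateOp μ γ * chi μ (deepPair W R γ)) :
    ∃ B ∈ equivariantRoeSet Γ μ, StrongLim g T B ∧
      B * chi μ (deep W R) = T * chi μ (deep W R) := by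
  -- On functions with bounded support the sequence of conjugates is eventually constant. The
  -- uniform bound `‖T‖` makes it Cauchy on all of `L²`.
  have hex : ∀ w : L2 μ, ∃ v, Filter.Tendsto (fun n => conjTranslate (g n) T w) Filter.atTop
      (nhds v) := by
    intro w
    refine cauchySeq_tendsto_of_complete (Metric.cauchySeq_iff'.2 fun ε hε => ?_)
    obtain ⟨δ, hδ, hδε⟩ : ∃ δ > 0, ‖T‖ * δ ≤ ε / 3 := ⟨ε / 3 / (‖T‖ + 1), by positivity, by
      rw [mul_div_assoc', div_le_iff₀ (by positivity)]
      nlinarith [norm_nonneg T]⟩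
    obtain ⟨m, hm⟩ := (Metric.tendsto_nhds.1 (tendsto_chi_ball x₀ w) δ hδ).exists
    obtain ⟨N, hN⟩ := Filter.eventually_atTop.1
      (hg.eventually (E := Metric.ball x₀ m) Metric.isBounded_ball R)
    refine ⟨N, fun n hn => ?_⟩
    have h1 := conjTranslate_mul_chi_eq hT measurableSet_ball (hN n hn) (hN N le_rfl)
    have h2 := congrArg (fun T : BL2 μ => T w) h1
    simp only [mul_apply_eq_comp] at h2
    set w' := chi μ (Metric.ball x₀ m) w
    have h3 : ∀ k, ‖conjTranslate (g k) T (w - w')‖ ≤ ε / 3 := fun k =>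
      (norm_conjTranslate_apply_le _ _ _).trans (le_trans (mul_le_mul_of_nonneg_left (by
        rw [← dist_eq_norm, dist_comm]; exact hm.le) (norm_nonneg _)) hδε)
    rw [dist_eq_norm]
    have e : conjTranslate (g n) T w - conjTranslate (g N) T w =
        conjTranslate (g n) T (w - w') - conjTranslate (g N) T (w - w') := by
      rw [map_sub, map_sub, h2]; abel
    rw [e]
    linarith [norm_sub_le (conjTranslate (g n) T (w - w')) (conjTranslate (g N) T (w - w')),
      h3 n, h3 N]
  choose f hf using hex
  let B : BL2 μ := continuousLinearMapOfTendsto (fun n => conjTranslate (g n) T)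
    (f := f) (tendsto_pi_nhds.2 hf)
  have hB : StrongLim g T B := hf
  -- On a bounded set the limit is computed by any single translation pushing that set deep into
  -- `W`. The properties of `B` follow from this freedom of choice.
  have hloc : ∀ {E : Set X}, MeasurableSet E → Bornology.IsBounded E → ∀ a : Γ,
      (∀ y ∈ E, a • y ∈ deep W R) → B * chi μ E = conjTranslate a T * chi μ E := by
    intro E hE hb a ha
    refine ContinuousLinearMap.ext fun w => ?_
    refine tendsto_nhds_unique (hB (chi μ E w)) (tendsto_const_nhds.congr' ?_)
    filter_upwards [hg.eventually hb R] with n hn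
    exact congrArg (fun T : BL2 μ => T w) (conjTranslate_mul_chi_eq hT hE ha hn)
  obtain ⟨r, hr⟩ := hroe.finProp
  have hfp : FinProp μ B r := by
    intro E F hE hF hd
    refine eq_of_comp_chi_ball x₀ fun m => ?_
    have hb : Bornology.IsBounded (F ∩ Metric.ball x₀ m) :=
      Metric.isBounded_ball.subset Set.inter_subset_right
    obtain ⟨n, hn⟩ := (hg.eventually hb R).exists
    change chi μ E * B * chi μ F * chi μ _ = 0 * _
    rw [mul_assoc, chi_mul_chi hF measurableSet_ball, mul_assoc,
      hloc (hF.inter measurableSet_ball) hb (g n) hn, ← mul_assoc,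
      hr.conjTranslate (g n) E _ hE (hF.inter measurableSet_ball) fun x hx y hy => hd x hx y hy.1,
      zero_mul]
  have hcomp : ∀ {E : Set X}, MeasurableSet E → Bornology.IsBounded E →
      IsApproximable (B * chi μ E) := by
    intro E hE hb
    obtain ⟨n, hn⟩ := (hg.eventually hb R).exists
    rw [hloc hE hb (g n) hn]
    have e := conjTranslate_chi (μ := μ) (g n) (measurableSet_preimage_smul (g n)⁻¹ hE)
    have e' : (g n • ·) ⁻¹' (((g n)⁻¹ • ·) ⁻¹' E : Set X) = E := by ext x; simp
    rw [e'] at e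
    rw [← e, ← conjTranslate_mul]
    refine (hroe.locComp _ (measurableSet_preimage_smul (g n)⁻¹ hE) ?_).1.conjTranslate _
    have : ((g n)⁻¹ • ·) ⁻¹' E = (fun x : X => g n • x) '' E := by
      ext x
      simp only [Set.mem_preimage, Set.mem_image]
      exact ⟨fun h => ⟨_, h, by simp⟩, fun ⟨y, hy, h⟩ => by rw [← h]; simpa using hy⟩
    rw [this]
    exact (isometry_smul X (g n)).lipschitz.isBounded_image hb
  refine ⟨B, mem_equivariantRoeSet_iff.2 ⟨⟨fun E hE hb => ⟨hcomp hE hb, ?_⟩, r, hfp⟩,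
    fun γ => ?_⟩, hB, ?_⟩
  · rw [← hfp.chi_mul hE, mul_assoc]
    exact (hcomp Metric.isOpen_thickening.measurableSet hb.thickening).mul_left _
  -- Equivariance: if `g n` pushes the ball deep into `W`, then `g n * γ` does so for its preimage
  -- under `γ`, and the two resulting descriptions of `B` are intertwined by `U_γ`.
  · refine eq_of_comp_chi_ball x₀ fun m => ?_
    change translateOp μ γ * B * chi μ _ = B * translateOp μ γ * chi μ _
    have hb : Bornology.IsBounded (Metric.ball x₀ (m : ℝ)) := Metric.isBounded_ball
    obtain ⟨n, hn⟩ := (hg.eventually hb R).exists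
    have hm : MeasurableSet ((γ • ·) ⁻¹' Metric.ball x₀ (m : ℝ)) :=
      measurableSet_preimage_smul γ measurableSet_ball
    rw [mul_assoc, hloc measurableSet_ball hb (g n) hn, mul_assoc B,
      translateOp_mul_chi γ measurableSet_ball, ← mul_assoc, ← mul_assoc,
      translateOp_mul_conjTranslate, mul_assoc, translateOp_mul_chi γ measurableSet_ball,
      ← mul_assoc, hloc hm ((isometry_smul X γ).antilipschitz.isBounded_preimage hb) (g n * γ)
        fun y hy => by rw [mul_smul]; exact hn _ hy]
  -- Deep inside `W` the trivial translation may be used, so `B` agrees with `T` there.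
  · refine eq_of_comp_chi_ball x₀ fun m => ?_
    have hd := (isClosed_deep W R).measurableSet
    change B * chi μ _ * chi μ _ = T * chi μ _ * chi μ _
    rw [mul_assoc, mul_assoc, chi_mul_chi hd measurableSet_ball,
      hloc (hd.inter measurableSet_ball) (Metric.isBounded_ball.subset Set.inter_subset_right) 1
        fun y hy => by simpa using hy.1, conjTranslate_one]

/-- An equivariant operator is determined by its restriction to functions supported deep inside
`W`. -/
lemma eq_of_mul_chi_deep {x₀ : X} (hg : IsDeepSeq W x₀ g)
    (hB : ∀ γ : Γ, translateOp μ γ * B = B * translateOp μ γ)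
    (hC : ∀ γ : Γ, translateOp μ γ * C = C * translateOp μ γ) {R : ℝ}
    (h : B * chi μ (deep W R) = C * chi μ (deep W R)) : B = C := by
  refine eq_of_comp_chi_ball x₀ fun m => ?_
  -- By equivariance, the action on a ball is conjugate to the action on a deep translate of that
  -- ball.
  obtain ⟨n, hn⟩ := (hg.eventually (E := Metric.ball x₀ m) Metric.isBounded_ball R).exists
  have hd := (isClosed_deep W R).measurableSet
  have e := translateOp_mul_chi (μ := μ) (g n) hd
  have hsub : Metric.ball x₀ m ⊆ (g n • ·) ⁻¹' deep W R := hn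
  have key : ∀ {B : BL2 μ}, (∀ γ : Γ, translateOp μ γ * B = B * translateOp μ γ) →
      B * chi μ (Metric.ball x₀ m) = translateOp μ (g n) * (B * chi μ (deep W R)) *
        translateOp μ (g n)⁻¹ * chi μ (Metric.ball x₀ m) := fun {B} hB => by
    calc _ = B * (chi μ ((g n • ·) ⁻¹' deep W R) * chi μ (Metric.ball x₀ m)) := by
          rw [mul_chi_of_subset measurableSet_ball (measurableSet_preimage_smul _ hd) hsub]
      _ = B * (translateOp μ (g n) * chi μ (deep W R)) * translateOp μ (g n)⁻¹ *
          chi μ (Metric.ball x₀ m) := by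
          rw [e, mul_assoc, mul_assoc, mul_assoc, ← mul_assoc (translateOp μ (g n)),
            translateOp_mul_inv, one_mul]
      _ = _ := by rw [← mul_assoc B, ← hB (g n)]; noncomm_ring
  change B * chi μ _ = C * chi μ _
  rw [key hB, key hC, h]

end StrongLimits

/-! ### The periodization map and its extension. -/

section Periodization

lemma continuous_starHom {A B : Type*} [NonUnitalCStarAlgebra A] [NonUnitalCStarAlgebra B]
    (φ : A →⋆ₙₐ[ℂ] B) : Continuous φ :=
  AddMonoidHomClass.continuous_of_bound φ 1 fun x => by
    rw [one_mul]; exact NonUnitalStarAlgHom.norm_apply_le φ x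

variable {X : Type*} [MetricSpace X] [MeasurableSpace X] [BorelSpace X]
variable {Γ : Type*} [Group Γ] [MulAction Γ X] [IsIsometricSMul Γ X]
variable {μ : Measure X} [SMulInvariantMeasure Γ X μ] [ProperSpace X] [IsFiniteMeasureOnCompacts μ]
variable {W : Set X} {g : ℕ → Γ} {x₀ : X}

lemma translateOp_mul_equivariantRoe {B : BL2 μ} (hB : B ∈ equivariantRoe Γ μ) (γ : Γ) :
    translateOp μ γ * B = B * translateOp μ γ := by
  have hB' : B ∈ closure (equivariantRoeSet Γ μ) := by rw [← coe_equivariantRoe]; exact hB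
  have hc : IsClosed {B : BL2 μ | translateOp μ γ * B = B * translateOp μ γ} :=
    isClosed_eq (continuous_const_mul _) (continuous_mul_const _)
  exact closure_minimal (fun A hA => (mem_equivariantRoeSet_iff.1 hA).2 γ) hc hB'

/-- Strong limits do not increase norms, so the limits of approximating generators form a Cauchy
sequence. -/
lemma exists_strongLim_of_mem (hX : HasAlmostGeodesics X) (hW : MeasurableSet W)
    (hg : IsDeepSeq W x₀ g) {A : BL2 (μ.restrict W)} (hA : A ∈ quasiEquivariantRoe Γ μ W) :
    ∃ B ∈ equivariantRoe Γ μ, StrongLim g (extHom μ hW A) B := by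
  have hA' : A ∈ closure (quasiEquivariantSet Γ μ W) := by
    rw [← coe_quasiEquivariantRoe Γ hX hW]; exact hA
  obtain ⟨a, ha, hlim⟩ := mem_closure_iff_seq_limit.1 hA'
  have hex : ∀ k, ∃ B ∈ equivariantRoeSet Γ μ, StrongLim g (extHom μ hW (a k)) B := fun k => by
    obtain ⟨h1, R, -, h2⟩ := (mem_quasiEquivariantSet_iff hX hW).1 (ha k)
    obtain ⟨B, h3, h4, -⟩ := exists_strongLim hg h1 h2
    exact ⟨B, h3, h4⟩
  choose b hb hbl using hex
  have hext := ((continuous_extHom (ν := μ) hW).tendsto A).comp hlim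
  have hcau : CauchySeq b := by
    refine Metric.cauchySeq_iff'.2 fun ε hε => ?_
    obtain ⟨N, hN⟩ := Metric.cauchySeq_iff'.1 hext.cauchySeq ε hε
    refine ⟨N, fun n hn => lt_of_le_of_lt ?_ (hN n hn)⟩
    rw [dist_eq_norm, dist_eq_norm]
    exact ((hbl n).sub (hbl N)).norm_le
  obtain ⟨B, hB⟩ := cauchySeq_tendsto_of_complete hcau
  refine ⟨B, ?_, StrongLim.of_tendsto hbl hext hB⟩
  have : B ∈ closure (equivariantRoeSet Γ μ) :=
    mem_closure_of_tendsto hB (Filter.Eventually.of_forall hb)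
  rwa [← coe_equivariantRoe] at this

/-- The periodization map, as a strong limit of translates. -/
def periodization (hX : HasAlmostGeodesics X) (hW : MeasurableSet W) (hg : IsDeepSeq W x₀ g) :
    quasiEquivariantRoe Γ μ W →⋆ₙₐ[ℂ] equivariantRoe Γ μ where
  toFun A := ⟨(exists_strongLim_of_mem hX hW hg A.2).choose,
    (exists_strongLim_of_mem hX hW hg A.2).choose_spec.1⟩
  map_smul' c A := Subtype.ext <| StrongLim.unique
    (exists_strongLim_of_mem hX hW hg (c • A).2).choose_spec.2 (by
      have := (exists_strongLim_of_mem hX hW hg A.2).choose_spec.2.smul c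
      rwa [← map_smul] at this)
  map_zero' := Subtype.ext <| StrongLim.unique
    (exists_strongLim_of_mem hX hW hg (0 : quasiEquivariantRoe Γ μ W).2).choose_spec.2 (by
      have e : extHom μ hW ((0 : quasiEquivariantRoe Γ μ W) : BL2 (μ.restrict W)) = 0 :=
        map_zero _
      rw [e]
      exact strongLim_zero)
  map_add' A B := Subtype.ext <| StrongLim.unique
    (exists_strongLim_of_mem hX hW hg (A + B).2).choose_spec.2 (by
      have := (exists_strongLim_of_mem hX hW hg A.2).choose_spec.2.add
        (exists_strongLim_of_mem hX hW hg B.2).choose_spec.2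
      rwa [← map_add] at this)
  map_mul' A B := Subtype.ext <| StrongLim.unique
    (exists_strongLim_of_mem hX hW hg (A * B).2).choose_spec.2 (by
      have := (exists_strongLim_of_mem hX hW hg A.2).choose_spec.2.mul
        (exists_strongLim_of_mem hX hW hg B.2).choose_spec.2
      rwa [← map_mul] at this)
  map_star' A := Subtype.ext <| StrongLim.star_eq
    (exists_strongLim_of_mem hX hW hg A.2).choose_spec.2 (by
      have := (exists_strongLim_of_mem hX hW hg (star A).2).choose_spec.2
      rw [← map_star]
      exact this)

lemma strongLim_periodization (hX : HasAlmostGeodesics X) (hW : MeasurableSet W)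
    (hg : IsDeepSeq W x₀ g) (A : quasiEquivariantRoe Γ μ W) :
    StrongLim g (extHom μ hW A) (periodization hX hW hg A : BL2 μ) :=
  (exists_strongLim_of_mem hX hW hg A.2).choose_spec.2

lemma periodization_mem_equivariantRoeSet (hX : HasAlmostGeodesics X) (hW : MeasurableSet W)
    (hg : IsDeepSeq W x₀ g) {A : quasiEquivariantRoe Γ μ W}
    (hA : (A : BL2 (μ.restrict W)) ∈ quasiEquivariantSet Γ μ W) :
    (periodization hX hW hg A : BL2 μ) ∈ equivariantRoeSet Γ μ ∧ ∃ R : ℝ, 0 < R ∧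
      (periodization hX hW hg A : BL2 μ) * chi μ (deep W R) =
        extHom μ hW A * chi μ (deep W R) := by
  obtain ⟨h1, R, hR, h2⟩ := (mem_quasiEquivariantSet_iff hX hW).1 hA
  obtain ⟨B, h3, h4, h5⟩ := exists_strongLim hg h1 h2
  rw [(strongLim_periodization hX hW hg A).unique h4]
  exact ⟨h3, R, hR, h5⟩

lemma isPeriodization_periodization (hX : HasAlmostGeodesics X) (hW : MeasurableSet W)
    (hg : IsDeepSeq W x₀ g) : IsPeriodization Γ μ W (periodization hX hW hg) := by
  intro A hA
  obtain ⟨-, R, hR, h⟩ := periodization_mem_equivariantRoeSet hX hW hg hA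
  refine ⟨R, hR.le, fun f hf => ?_⟩
  have hd := (isDeepIn_iff hX hR).1 hf
  have key := congrArg (fun T : BL2 μ => T (ccToL2 μ f)) h
  simp only [mul_apply_eq_comp] at key
  rw [chi_ccToL2 (isClosed_deep _ _).measurableSet f hd, extHom_apply, restrictOp_ccToL2] at key
  rw [extendOp_ccToL2 μ f fun x hx => deep_subset hR (hd x hx), key]

lemma dense_quasiEquivariantSet (hX : HasAlmostGeodesics X) (hW : MeasurableSet W) :
    Dense {A : quasiEquivariantRoe Γ μ W |
      (A : BL2 (μ.restrict W)) ∈ quasiEquivariantSet Γ μ W} := by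
  rw [Subtype.dense_iff]
  intro A hA
  have hA' : A ∈ closure (quasiEquivariantSet Γ μ W) := by
    rw [← coe_quasiEquivariantRoe Γ hX hW]; exact hA
  refine closure_mono (fun B hB => ?_) hA'
  have : B ∈ (quasiEquivariantRoe Γ μ W : Set (BL2 (μ.restrict W))) := by
    rw [coe_quasiEquivariantRoe Γ hX hW]; exact subset_closure hB
  exact ⟨⟨B, this⟩, hB, rfl⟩

lemma IsPeriodization.exists_mul_chi_deep (hX : HasAlmostGeodesics X) (hW : MeasurableSet W)
    {ϖ : quasiEquivariantRoe Γ μ W →⋆ₙₐ[ℂ] equivariantRoe Γ μ} (h : IsPeriodization Γ μ W ϖ)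
    {A : quasiEquivariantRoe Γ μ W}
    (hA : (A : BL2 (μ.restrict W)) ∈ quasiEquivariantSet Γ μ W) :
    ∃ R : ℝ, 0 < R ∧ (ϖ A : BL2 μ) * chi μ (deep W R) = extHom μ hW A * chi μ (deep W R) := by
  obtain ⟨R, hR, h⟩ := h A hA
  refine ⟨R + 1 + 1, by positivity, ?_⟩
  rw [← sub_eq_zero, ← sub_mul]
  refine comp_chi_eq_zero_of_ccToL2 (isClosed_deep _ _).measurableSet one_pos fun f hf => ?_
  have hf1 : ∀ x, f x ≠ 0 → x ∈ deep W (R + 1) := fun x hx =>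
    thickening_deep_subset (by positivity) zero_le_one (hf x hx)
  have hd := (isDeepIn_iff hX (by positivity)).2 hf1
  have key := h f fun x hx =>
    ⟨(hd x hx).1, (ENNReal.ofReal_le_ofReal (by linarith)).trans (hd x hx).2⟩
  rw [extendOp_ccToL2 μ f fun x hx => (hd x hx).1, ← restrictOp_ccToL2] at key
  exact sub_eq_zero.2 key

/-- On generators both maps agree with `A` at large depth, and an equivariant operator is determined
there; density and automatic continuity of *-homomorphisms finish. In particular `periodization`
does not depend on the deep sequence. -/
lemma IsPeriodization.unique (hX : HasAlmostGeodesics X) (hW : MeasurableSet W)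
    (hg : IsDeepSeq W x₀ g) {ϖ ϖ' : quasiEquivariantRoe Γ μ W →⋆ₙₐ[ℂ] equivariantRoe Γ μ}
    (h : IsPeriodization Γ μ W ϖ) (h' : IsPeriodization Γ μ W ϖ') : ϖ' = ϖ := by
  refine DFunLike.coe_injective (Continuous.ext_on (dense_quasiEquivariantSet hX hW)
    (continuous_starHom ϖ') (continuous_starHom ϖ) fun A hA => ?_)
  obtain ⟨R, -, e⟩ := h.exists_mul_chi_deep hX hW hA
  obtain ⟨R', -, e'⟩ := h'.exists_mul_chi_deep hX hW hA
  have hm : ∀ S, MeasurableSet (deep W S) := fun S => (isClosed_deep W S).measurableSet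
  refine Subtype.ext (eq_of_mul_chi_deep hg (translateOp_mul_equivariantRoe (ϖ' A).2)
    (translateOp_mul_equivariantRoe (ϖ A).2) (R := max R R') ?_)
  have h1 := mul_chi_of_subset (ν := μ) (hm (max R R')) (hm R) (deep_anti (le_max_left _ _))
  have h2 := mul_chi_of_subset (ν := μ) (hm (max R R')) (hm R') (deep_anti (le_max_right _ _))
  calc _ = (ϖ' A : BL2 μ) * chi μ (deep W R') * chi μ (deep W (max R R')) := by
        rw [mul_assoc, h2]
    _ = (ϖ A : BL2 μ) * chi μ (deep W R) * chi μ (deep W (max R R')) := by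
        rw [e', e, mul_assoc, h2, mul_assoc, h1]
    _ = _ := by rw [mul_assoc, h1]

/-- From depth `1 + r` the operator cannot leave `W`, so compressing it to `W` has no effect. The
`1` keeps the remaining depth positive. -/
lemma chi_mul_mul_chi_deep (hW : MeasurableSet W) {B : BL2 μ} {r : ℝ} (hr : 0 ≤ r)
    (hB : FinProp μ B r) :
    chi μ W * B * chi μ W * chi μ (deep W (1 + r)) = B * chi μ (deep W (1 + r)) := by
  have hd := (isClosed_deep W (1 + r)).measurableSet
  rw [mul_assoc, mul_chi_of_subset hd hW (deep_subset (by positivity)),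
    hB.mul_chi_of_subset hd hW ((thickening_deep_subset zero_le_one hr).trans
      (deep_subset one_pos))]

lemma compress_mem_quasiEquivariantSet (hX : HasAlmostGeodesics X) (hW : MeasurableSet W)
    {B : BL2 μ} (hB : B ∈ equivariantRoeSet Γ μ) :
    compress W B ∈ quasiEquivariantSet Γ μ W := by
  obtain ⟨h1, h2⟩ := mem_equivariantRoeSet_iff.1 hB
  refine (mem_quasiEquivariantSet_iff hX hW).2 ⟨(isRoe_extHom hW).2 (h1.compress hW), ?_⟩
  obtain ⟨r₀, hr₀⟩ := h1.finProp
  obtain ⟨r, hr, hBr⟩ : ∃ r, 0 ≤ r ∧ FinProp μ B r :=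
    ⟨max r₀ 0, le_max_right _ _, hr₀.mono (le_max_left _ _)⟩
  have hm : ∀ S (δ : Γ), MeasurableSet (deepPair W S δ) :=
    fun S δ => (isClosed_deepPair W S δ).measurableSet
  have hd := (isClosed_deep W (1 + r)).measurableSet
  have key := chi_mul_mul_chi_deep hW hr hBr
  have hin : ∀ (δ : Γ), chi μ W * B * chi μ W * chi μ (deepPair W (1 + r) δ) =
      B * chi μ (deepPair W (1 + r) δ) := fun δ => by
    rw [← mul_chi_of_subset (ν := μ) (hm (1 + r) δ) hd Set.inter_subset_left, ← mul_assoc, key,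
      mul_assoc]
  refine ⟨1 + r, by positivity, fun γ => ?_⟩
  rw [extHom_compress, mul_assoc, hin, mul_assoc _ (translateOp μ γ), translateOp_mul_chi γ (hm _ _),
    preimage_deepPair, ← mul_assoc, ← mul_assoc, hin, h2, mul_assoc, mul_assoc,
    translateOp_mul_chi γ (hm _ _), preimage_deepPair]

lemma compress_mem_quasiEquivariantRoe (hX : HasAlmostGeodesics X) (hW : MeasurableSet W)
    {B : BL2 μ} (hB : B ∈ equivariantRoe Γ μ) : compress W B ∈ quasiEquivariantRoe Γ μ W := by
  have hB' : B ∈ closure (equivariantRoeSet Γ μ) := by rw [← coe_equivariantRoe]; exact hB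
  have : compress W B ∈ closure (quasiEquivariantSet Γ μ W) :=
    map_mem_closure continuous_compress hB' fun A hA => compress_mem_quasiEquivariantSet hX hW hA
  rwa [← coe_quasiEquivariantRoe Γ hX hW] at this

/-- Compression to `W` as a section of the periodization map. -/
def compressRoe (hX : HasAlmostGeodesics X) (hW : MeasurableSet W) (B : equivariantRoe Γ μ) :
    quasiEquivariantRoe Γ μ W :=
  ⟨compress W (B : BL2 μ), compress_mem_quasiEquivariantRoe hX hW B.2⟩

lemma continuous_compressRoe (hX : HasAlmostGeodesics X) (hW : MeasurableSet W) :
    Continuous (compressRoe (Γ := Γ) (μ := μ) hX hW) :=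
  (continuous_compress.comp continuous_subtype_val).subtype_mk _

lemma dense_equivariantRoeSet :
    Dense {A : equivariantRoe Γ μ | (A : BL2 μ) ∈ equivariantRoeSet Γ μ} := by
  rw [Subtype.dense_iff]
  intro A hA
  have hA' : A ∈ closure (equivariantRoeSet Γ μ) := by rw [← coe_equivariantRoe]; exact hA
  refine closure_mono (fun B hB => ?_) hA'
  have : B ∈ (equivariantRoe Γ μ : Set (BL2 μ)) := by
    rw [coe_equivariantRoe]; exact subset_closure hB
  exact ⟨⟨B, this⟩, hB, rfl⟩

/-- At large depth the compression agrees with `B` itself, which is equivariant. This gives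
surjectivity and an explicit *-preserving linear section, the source of the canonical lift `s + E C
E`. -/
lemma periodization_compressRoe (hX : HasAlmostGeodesics X) (hW : MeasurableSet W)
    (hg : IsDeepSeq W x₀ g) (B : equivariantRoe Γ μ) :
    periodization hX hW hg (compressRoe hX hW B) = B := by
  have hc : Continuous fun B : equivariantRoe Γ μ =>
      periodization hX hW hg (compressRoe hX hW B) :=
    (continuous_starHom _).comp (continuous_compressRoe hX hW)
  refine congrFun (Continuous.ext_on dense_equivariantRoeSet hc continuous_id fun B hB => ?_) B
  have hB' := mem_equivariantRoeSet_iff.1 hB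
  obtain ⟨r₀, hr₀⟩ := hB'.1.finProp
  obtain ⟨r, hr, hBr⟩ : ∃ r, 0 ≤ r ∧ FinProp μ (B : BL2 μ) r :=
    ⟨max r₀ 0, le_max_right _ _, hr₀.mono (le_max_left _ _)⟩
  obtain ⟨h1, R, hR, h2⟩ := periodization_mem_equivariantRoeSet hX hW hg
    (A := compressRoe hX hW B) (compress_mem_quasiEquivariantSet hX hW hB)
  have hm : ∀ S, MeasurableSet (deep W S) := fun S => (isClosed_deep W S).measurableSet
  refine Subtype.ext (eq_of_mul_chi_deep hg (mem_equivariantRoeSet_iff.1 h1).2 hB'.2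
    (R := max R (1 + r)) ?_)
  have e1 := mul_chi_of_subset (ν := μ) (hm (max R (1 + r))) (hm R) (deep_anti (le_max_left _ _))
  have e2 := mul_chi_of_subset (ν := μ) (hm (max R (1 + r))) (hm (1 + r))
    (deep_anti (le_max_right _ _))
  have h3 : extHom μ hW (compressRoe hX hW B : BL2 (μ.restrict W)) =
    chi μ W * (B : BL2 μ) * chi μ W := rfl
  rw [h3] at h2
  rw [← e1, ← mul_assoc, h2, mul_assoc, e1, ← e2, ← mul_assoc,
    chi_mul_mul_chi_deep hW hr hBr, mul_assoc]
  rfl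

lemma coe_localizedIncl (j : localizedRoe μ W) :
    ((localizedIncl Γ μ W j : quasiEquivariantRoe Γ μ W) : BL2 (μ.restrict W)) = j :=
  NonUnitalStarSubalgebra.val_inclusion (localizedRoe_le Γ μ W) j

lemma localizedIncl_injective : Function.Injective (localizedIncl Γ μ W) :=
  NonUnitalStarSubalgebra.inclusion_injective (localizedRoe_le Γ μ W)

lemma dense_localizedSet (hX : HasAlmostGeodesics X) (hW : MeasurableSet W) :
    Dense {j : localizedRoe μ W | (j : BL2 (μ.restrict W)) ∈ localizedSet μ W} := by
  rw [Subtype.dense_iff]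
  intro A hA
  have hA' : A ∈ closure (localizedSet μ W) := by rw [← coe_localizedRoe hX hW]; exact hA
  refine closure_mono (fun B hB => ?_) hA'
  have : B ∈ (localizedRoe μ W : Set (BL2 (μ.restrict W))) := by
    rw [coe_localizedRoe hX hW]; exact subset_closure hB
  exact ⟨⟨B, this⟩, hB, rfl⟩

lemma strongLim_zero_of_localized (hX : HasAlmostGeodesics X) (hW : MeasurableSet W)
    (hg : IsDeepSeq W x₀ g) {A : BL2 (μ.restrict W)} (hA : A ∈ localizedSet μ W) :
    StrongLim g (extHom μ hW A) 0 := by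
  have hm : ∀ S, MeasurableSet (deep W S) := fun S => (isClosed_deep W S).measurableSet
  obtain ⟨h1, R, hR, h2⟩ := (mem_localizedSet_iff hX hW).1 hA
  have hz : ∀ γ : Γ, extHom μ hW A * chi μ (deepPair W R γ) = 0 := fun γ => by
    rw [← mul_chi_of_subset (ν := μ) (isClosed_deepPair W R γ).measurableSet (hm R)
        Set.inter_subset_left, ← mul_assoc, h2, zero_mul]
  obtain ⟨B, h3, h4, h5⟩ := exists_strongLim (R := R) hg h1 fun γ => by
    rw [mul_assoc, mul_assoc, translateOp_mul_chi γ (isClosed_deepPair W R γ).measurableSet,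
      preimage_deepPair, ← mul_assoc (extHom μ hW _), hz, hz, mul_zero, zero_mul]
  have e : B = 0 := by
    refine eq_of_mul_chi_deep hg (mem_equivariantRoeSet_iff.1 h3).2 (fun γ => ?_) (R := R) ?_
    · rw [mul_zero, zero_mul]
    · rw [h5, h2, zero_mul]
  rwa [e] at h4

lemma periodization_localizedIncl (hX : HasAlmostGeodesics X) (hW : MeasurableSet W)
    (hg : IsDeepSeq W x₀ g) (j : localizedRoe μ W) :
    periodization hX hW hg (localizedIncl Γ μ W j) = 0 := by
  have hc : Continuous fun j => periodization hX hW hg (localizedIncl Γ μ W j) :=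
    (continuous_starHom _).comp (continuous_starHom _)
  refine congrFun (Continuous.ext_on (dense_localizedSet hX hW) hc
    (continuous_const (y := 0)) fun j hj => ?_) j
  have h := strongLim_periodization hX hW hg (localizedIncl Γ μ W j)
  rw [coe_localizedIncl] at h
  exact Subtype.ext (h.unique (strongLim_zero_of_localized hX hW hg hj))

/-- At large depth both terms act as the periodization of `y`, so the difference is supported near
the boundary. -/
lemma sub_compress_mem_localizedSet (hX : HasAlmostGeodesics X) (hW : MeasurableSet W)
    (hg : IsDeepSeq W x₀ g) {y : quasiEquivariantRoe Γ μ W}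
    (hy : (y : BL2 (μ.restrict W)) ∈ quasiEquivariantSet Γ μ W) :
    (y : BL2 (μ.restrict W)) - compress W (periodization hX hW hg y : BL2 μ) ∈
      localizedSet μ W := by
  have hm : ∀ S, MeasurableSet (deep W S) := fun S => (isClosed_deep W S).measurableSet
  obtain ⟨h1, R, hR, h2⟩ := periodization_mem_equivariantRoeSet hX hW hg hy
  have h3 := (mem_equivariantRoeSet_iff.1 h1).1
  obtain ⟨r₀, hr₀⟩ := h3.finProp
  have hBr := hr₀.mono (le_max_left r₀ 0)
  refine (mem_localizedSet_iff hX hW).2 ?_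
  rw [map_sub]
  refine ⟨((mem_quasiEquivariantSet_iff hX hW).1 hy).1.sub
    ((isRoe_extHom hW).2 (h3.compress hW)), max R (1 + max r₀ 0), lt_max_of_lt_left hR, ?_⟩
  have e1 := mul_chi_of_subset (ν := μ) (hm (max R (1 + max r₀ 0))) (hm R)
    (deep_anti (le_max_left _ _))
  have e2 := mul_chi_of_subset (ν := μ) (hm (max R (1 + max r₀ 0))) (hm (1 + max r₀ 0))
    (deep_anti (le_max_right _ _))
  have e3 : extHom μ hW (y : BL2 (μ.restrict W)) * chi μ (deep W (max R (1 + max r₀ 0))) =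
      (periodization hX hW hg y : BL2 μ) * chi μ (deep W (max R (1 + max r₀ 0))) := by
    rw [← e1, ← mul_assoc, ← h2, mul_assoc]
  rw [sub_mul, e3, extHom_compress, sub_eq_zero, ← e2, ← mul_assoc, ← mul_assoc,
    chi_mul_mul_chi_deep hW (le_max_right _ _) hBr]

/-- The continuous map `y ↦ y - compress (ϖ y)` sends a dense set into the localized operators and
fixes the kernel. This avoids having to approximate kernel elements by generators in the kernel. -/
lemma mem_localizedRoe_of_periodization_eq_zero (hX : HasAlmostGeodesics X) (hW : MeasurableSet W)
    (hg : IsDeepSeq W x₀ g) {x : quasiEquivariantRoe Γ μ W} (hx : periodization hX hW hg x = 0) :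
    (x : BL2 (μ.restrict W)) ∈ localizedRoe μ W := by
  have hc : Continuous fun y : quasiEquivariantRoe Γ μ W =>
      (y : BL2 (μ.restrict W)) - compress W (periodization hX hW hg y : BL2 μ) :=
    continuous_subtype_val.sub (continuous_compress.comp
      (continuous_subtype_val.comp (continuous_starHom _)))
  have hmem := map_mem_closure hc ((dense_quasiEquivariantSet hX hW) x)
    (t := localizedSet μ W) fun y hy => sub_compress_mem_localizedSet hX hW hg hy
  have e0 : ((0 : equivariantRoe Γ μ) : BL2 μ) = 0 := rfl
  have hz : compress W (0 : BL2 μ) = 0 := by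
    rw [compress, ContinuousLinearMap.zero_comp, ContinuousLinearMap.comp_zero]
  rw [hx, e0, hz, sub_zero, ← coe_localizedRoe hX hW] at hmem
  exact hmem

/-- The extension `C^*_W(∂W) → Q^*(W, Γ) → C^*(X, Γ)` is exact. -/
lemma isExtension_periodization (hX : HasAlmostGeodesics X) (hW : MeasurableSet W)
    (hg : IsDeepSeq W x₀ g) :
    IsExtension (localizedIncl Γ μ W) (periodization hX hW hg) where
  injective := localizedIncl_injective
  surjective B := ⟨_, periodization_compressRoe hX hW hg B⟩
  exact x := by
    constructor
    · intro hx
      exact ⟨⟨x, mem_localizedRoe_of_periodization_eq_zero hX hW hg hx⟩, Subtype.ext (coe_localizedIncl _)⟩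
    · rintro ⟨j, rfl⟩
      exact periodization_localizedIncl hX hW hg j

end Periodization

section Corner

variable {V W : Type*} [NormedAddCommGroup V] [NormedSpace ℂ V] [NormedAddCommGroup W]
  [NormedSpace ℂ W] {v : V →L[ℂ] W} {w : W →L[ℂ] V}

lemma isFredholm_corner (hwv : w ∘L v = 1) {T : V →L[ℂ] V} (hT : T.IsFredholm) :
    (1 - v ∘L w + v ∘L T ∘L w).IsFredholm := by
  have h : ∀ x, w (v x) = x := fun x => congrArg (fun f : V →L[ℂ] V => f x) hwv
  obtain ⟨S, h1, h2⟩ := hT.exists_isQuasiInverse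
  refine isFredholm_of_left_right (A := 1 - v ∘L w + v ∘L S ∘L w)
    (B := 1 - v ∘L w + v ∘L S ∘L w) ?_ ?_
  · have := LinearMap.FiniteRangeSetoid.equiv_comp_left (u' := v.toLinearMap)
      (LinearMap.FiniteRangeSetoid.equiv_comp_right (u := w.toLinearMap) h1)
    rw [LinearMap.FiniteRangeSetoid.equiv_iff_hasFiniteRange] at this ⊢
    convert this using 1
    ext x
    simp [h]
    abel
  · have := LinearMap.FiniteRangeSetoid.equiv_comp_left (u' := v.toLinearMap)
      (LinearMap.FiniteRangeSetoid.equiv_comp_right (u := w.toLinearMap) h2)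
    rw [LinearMap.FiniteRangeSetoid.equiv_iff_hasFiniteRange] at this ⊢
    convert this using 1
    ext x
    simp [h]
    abel

end Corner

/-! ### Operator matrices and Toeplitz operators. -/

section MatrixOperators

variable {H : Type*} [NormedAddCommGroup H] [InnerProductSpace ℂ H] [CompleteSpace H] {m n : ℕ}

/-- The operator on `H^n` given by a matrix of operators on `H`. -/
def matOp (M : Matrix (Fin n) (Fin n) (H →L[ℂ] H)) : (Fin n → H) →L[ℂ] (Fin n → H) :=
  ContinuousLinearMap.pi fun i => ∑ j, M i j ∘L ContinuousLinearMap.proj j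

lemma matOp_apply (M : Matrix (Fin n) (Fin n) (H →L[ℂ] H)) (f : Fin n → H) (i : Fin n) :
    matOp M f i = ∑ j, M i j (f j) := by
  simp [matOp]

lemma matOp_one : matOp (1 : Matrix (Fin n) (Fin n) (H →L[ℂ] H)) = 1 := by
  refine ContinuousLinearMap.ext fun f => funext fun i => ?_
  rw [matOp_apply, Finset.sum_eq_single i]
  · simp
  · intro j _ hj
    simp [Matrix.one_apply_ne hj.symm]
  · simp

lemma matOp_mul (M N : Matrix (Fin n) (Fin n) (H →L[ℂ] H)) :
    matOp (M * N) = matOp M * matOp N := by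
  refine ContinuousLinearMap.ext fun f => funext fun i => ?_
  rw [mul_apply_eq_comp, matOp_apply, matOp_apply]
  simp only [matOp_apply, Matrix.mul_apply, map_sum, sum_apply,
    mul_apply_eq_comp]
  exact Finset.sum_comm

lemma matOp_add (M N : Matrix (Fin n) (Fin n) (H →L[ℂ] H)) :
    matOp (M + N) = matOp M + matOp N := by
  refine ContinuousLinearMap.ext fun f => funext fun i => ?_
  rw [matOp_apply]
  change _ = matOp M f i + matOp N f i
  rw [matOp_apply, matOp_apply, ← Finset.sum_add_distrib]
  rfl

set_option synthInstance.maxHeartbeats 200000 in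
lemma continuous_matOp :
    Continuous (matOp : Matrix (Fin n) (Fin n) (H →L[ℂ] H) → _) := by
  have h : ∀ M : Matrix (Fin n) (Fin n) (H →L[ℂ] H), matOp M =
      ∑ i, ∑ j, ContinuousLinearMap.single ℂ (fun _ : Fin n => H) i ∘L
        M i j ∘L ContinuousLinearMap.proj j := fun M => by
    refine ContinuousLinearMap.ext fun f => funext fun i => ?_
    rw [matOp_apply]
    simp [Finset.sum_apply, Pi.single_apply]
  rw [funext h]
  refine continuous_finsetSum _ fun i _ => continuous_finsetSum _ fun j _ => ?_
  have h1 : Continuous fun M : Matrix (Fin n) (Fin n) (H →L[ℂ] H) => M i j :=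
    continuous_id.matrix_elem i j
  exact ((ContinuousLinearMap.compL ℂ _ _ _ _).continuous).comp
    (((ContinuousLinearMap.compL ℂ (Fin n → H) H H).flip _).continuous.comp h1)

/-- A matrix of operators which are norm limits of operators of finite rank. -/
def MatApprox (M : Matrix (Fin n) (Fin n) (H →L[ℂ] H)) : Prop := ∀ i j, IsApproximable (M i j)

variable {M N : Matrix (Fin n) (Fin n) (H →L[ℂ] H)}

lemma matApprox_zero : MatApprox (0 : Matrix (Fin n) (Fin n) (H →L[ℂ] H)) :=
  fun _ _ => isApproximable_zero

lemma MatApprox.add (hM : MatApprox M) (hN : MatApprox N) : MatApprox (M + N) :=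
  fun i j => (hM i j).add (hN i j)

lemma MatApprox.sub (hM : MatApprox M) (hN : MatApprox N) : MatApprox (M - N) :=
  fun i j => (hM i j).sub (hN i j)

lemma MatApprox.neg (hM : MatApprox M) : MatApprox (-M) := fun i j => (hM i j).neg

lemma MatApprox.smul (hM : MatApprox M) (c : ℂ) : MatApprox (c • M) := fun i j => (hM i j).smul c

lemma MatApprox.mul_left (hM : MatApprox M) (N : Matrix (Fin n) (Fin n) (H →L[ℂ] H)) :
    MatApprox (N * M) := fun i j => by
  rw [Matrix.mul_apply]
  exact isApproximable_sum _ fun k _ => (hM k j).comp_left (N i k)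

lemma MatApprox.mul_right (hM : MatApprox M) (N : Matrix (Fin n) (Fin n) (H →L[ℂ] H)) :
    MatApprox (M * N) := fun i j => by
  rw [Matrix.mul_apply]
  exact isApproximable_sum _ fun k _ => (hM i k).comp_right (N k j)

lemma MatApprox.sum {ι : Type*} {s : Finset ι} {f : ι → Matrix (Fin n) (Fin n) (H →L[ℂ] H)}
    (h : ∀ i ∈ s, MatApprox (f i)) : MatApprox (∑ i ∈ s, f i) :=
  Finset.sum_induction _ _ (fun _ _ => MatApprox.add) matApprox_zero h

lemma isClosed_matApprox : IsClosed {M : Matrix (Fin n) (Fin n) (H →L[ℂ] H) | MatApprox M} := by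
  have : {M : Matrix (Fin n) (Fin n) (H →L[ℂ] H) | MatApprox M} =
      ⋂ i, ⋂ j, (fun M : Matrix (Fin n) (Fin n) (H →L[ℂ] H) => M i j) ⁻¹'
        closure {F : H →L[ℂ] H | F.toLinearMap.HasFiniteRange} := by
    ext M
    simp [MatApprox, IsApproximable]
  rw [this]
  exact isClosed_iInter fun i => isClosed_iInter fun j =>
    isClosed_closure.preimage (continuous_id.matrix_elem i j)

lemma MatApprox.isApproximable_matOp (hM : MatApprox M) : IsApproximable (matOp M) := by
  have h : matOp M = ∑ i, ∑ j, ContinuousLinearMap.single ℂ (fun _ : Fin n => H) i ∘L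
        M i j ∘L ContinuousLinearMap.proj j := by
    refine ContinuousLinearMap.ext fun f => funext fun i => ?_
    rw [matOp_apply]
    simp [Finset.sum_apply, Pi.single_apply]
  rw [h]
  exact isApproximable_sum _ fun i _ => isApproximable_sum _ fun j _ =>
    ((hM i j).comp_right _).comp_left _

lemma isFredholm_matOp {S T : Matrix (Fin n) (Fin n) (H →L[ℂ] H)} (h1 : MatApprox (S * T - 1))
    (h2 : MatApprox (T * S - 1)) : (matOp T).IsFredholm := by
  have e : ∀ A B : Matrix (Fin n) (Fin n) (H →L[ℂ] H), matOp (A * B - 1) =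
      matOp A * matOp B - 1 := fun A B => by
    rw [eq_sub_iff_add_eq, ← matOp_mul, ← matOp_one, ← matOp_add, sub_add_cancel]
  have h1' := h1.isApproximable_matOp
  have h2' := h2.isApproximable_matOp
  rw [e] at h1' h2'
  exact isFredholm_of_mul_sub_one h1' h2'

lemma fredholm_matOp_of_sub (hM : (matOp M).IsFredholm) (h : MatApprox (N - M)) :
    (matOp N).IsFredholm ∧ fredholmIndex (matOp N) = fredholmIndex (matOp M) := by
  have := fredholm_add_approximable hM h.isApproximable_matOp
  rwa [← matOp_add, add_sub_cancel] at this

lemma isUnit_matOp (h : IsUnit M) : IsUnit (matOp M) := by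
  obtain ⟨u, rfl⟩ := h
  exact ⟨⟨matOp u, matOp (↑u⁻¹ : Matrix (Fin n) (Fin n) (H →L[ℂ] H)),
    by rw [← matOp_mul, Units.mul_inv, matOp_one], by rw [← matOp_mul, Units.inv_mul, matOp_one]⟩,
    rfl⟩

/-! ### Block sums -/

lemma matOp_blockSum_one (M : Matrix (Fin m) (Fin m) (H →L[ℂ] H)) (n : ℕ) :
    ∃ (v : (Fin m → H) →L[ℂ] (Fin (m + n) → H)) (w : (Fin (m + n) → H) →L[ℂ] (Fin m → H)),
      w ∘L v = 1 ∧ matOp (blockSum M (1 : Matrix (Fin n) (Fin n) (H →L[ℂ] H))) =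
        1 - v ∘L w + v ∘L matOp M ∘L w := by
  refine ⟨ContinuousLinearMap.pi fun k => Sum.elim (fun i => ContinuousLinearMap.proj i)
    (fun _ => 0) (finSumFinEquiv.symm k), ContinuousLinearMap.pi fun i =>
      ContinuousLinearMap.proj (finSumFinEquiv (Sum.inl i)), ?_, ?_⟩
  · refine ContinuousLinearMap.ext fun f => funext fun i => ?_
    simp only [ContinuousLinearMap.comp_apply, ContinuousLinearMap.pi_apply,
      ContinuousLinearMap.proj_apply, Equiv.symm_apply_apply, Sum.elim_inl]
    rfl
  · refine ContinuousLinearMap.ext fun f => funext fun k => ?_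
    obtain ⟨k, rfl⟩ := finSumFinEquiv.surjective k
    rw [matOp_apply, ← finSumFinEquiv.sum_comp, Fintype.sum_sum_type]
    change _ = f _ - _ + _
    rcases k with i | i
    · simp [blockSum, matOp_apply]
    · simp only [blockSum, Matrix.reindex_apply, Matrix.submatrix_apply, Equiv.symm_apply_apply,
        Matrix.fromBlocks_apply₂₁, Matrix.fromBlocks_apply₂₂, Matrix.zero_apply,
        zero_apply, Finset.sum_const_zero, zero_add]
      rw [Finset.sum_eq_single i]
      · simp
      · intro j _ hj
        simp [Matrix.one_apply_ne hj.symm]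
      · simp

lemma matOp_one_blockSum (m : ℕ) (M : Matrix (Fin n) (Fin n) (H →L[ℂ] H)) :
    ∃ (v : (Fin n → H) →L[ℂ] (Fin (m + n) → H)) (w : (Fin (m + n) → H) →L[ℂ] (Fin n → H)),
      w ∘L v = 1 ∧ matOp (blockSum (1 : Matrix (Fin m) (Fin m) (H →L[ℂ] H)) M) =
        1 - v ∘L w + v ∘L matOp M ∘L w := by
  refine ⟨ContinuousLinearMap.pi fun k => Sum.elim (fun _ => 0)
    (fun i => ContinuousLinearMap.proj i) (finSumFinEquiv.symm k), ContinuousLinearMap.pi fun i =>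
      ContinuousLinearMap.proj (finSumFinEquiv (Sum.inr i)), ?_, ?_⟩
  · refine ContinuousLinearMap.ext fun f => funext fun i => ?_
    simp only [ContinuousLinearMap.comp_apply, ContinuousLinearMap.pi_apply,
      ContinuousLinearMap.proj_apply, Equiv.symm_apply_apply, Sum.elim_inr]
    rfl
  · refine ContinuousLinearMap.ext fun f => funext fun k => ?_
    obtain ⟨k, rfl⟩ := finSumFinEquiv.surjective k
    rw [matOp_apply, ← finSumFinEquiv.sum_comp, Fintype.sum_sum_type]
    change _ = f _ - _ + _
    rcases k with i | i
    · simp only [blockSum, Matrix.reindex_apply, Matrix.submatrix_apply, Equiv.symm_apply_apply,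
        Matrix.fromBlocks_apply₁₁, Matrix.fromBlocks_apply₁₂, Matrix.zero_apply,
        zero_apply, Finset.sum_const_zero, add_zero]
      rw [Finset.sum_eq_single i]
      · simp
      · intro j _ hj
        simp [Matrix.one_apply_ne hj.symm]
      · simp
    · simp [blockSum, matOp_apply]

lemma fredholm_blockSum_one {M : Matrix (Fin m) (Fin m) (H →L[ℂ] H)} :
    fredholmIndex (matOp (blockSum M (1 : Matrix (Fin n) (Fin n) (H →L[ℂ] H)))) =
      fredholmIndex (matOp M) := by
  obtain ⟨v, w, h, e⟩ := matOp_blockSum_one M n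
  rw [e, fredholmIndex_corner h]

lemma fredholm_one_blockSum {M : Matrix (Fin n) (Fin n) (H →L[ℂ] H)} :
    fredholmIndex (matOp (blockSum (1 : Matrix (Fin m) (Fin m) (H →L[ℂ] H)) M)) =
      fredholmIndex (matOp M) := by
  obtain ⟨v, w, h, e⟩ := matOp_one_blockSum m M
  rw [e, fredholmIndex_corner h]

/-! ### Toeplitz operators -/

/-- The compression of `U` to the range of the projection `P`, extended by the identity. -/
def toeplitz (P : H →L[ℂ] H) (U : Matrix (Fin n) (Fin n) (H →L[ℂ] H)) :
    Matrix (Fin n) (Fin n) (H →L[ℂ] H) :=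
  1 - Matrix.diagonal (fun _ => P) + Matrix.diagonal (fun _ => P) * U * Matrix.diagonal (fun _ => P)

variable {P P' : H →L[ℂ] H} {U V U' : Matrix (Fin n) (Fin n) (H →L[ℂ] H)}

lemma diagonal_mul_self (hP : P * P = P) :
    Matrix.diagonal (fun _ : Fin n => P) * Matrix.diagonal (fun _ => P) =
      Matrix.diagonal fun _ => P := by
  rw [Matrix.diagonal_mul_diagonal, hP]

lemma toeplitz_one (hP : P * P = P) :
    toeplitz P (1 : Matrix (Fin n) (Fin n) (H →L[ℂ] H)) = 1 := by
  rw [toeplitz, mul_one, diagonal_mul_self hP, sub_add_cancel]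

/-- The failure of multiplicativity is `P U (1 - P) V P`, which contains the commutator of `P` with
`U` as a factor. Applied to a unitary and its inverse, this makes each a parametrix for the other.
-/
lemma toeplitz_mul_sub_one (hP : P * P = P) (hUV : U * V = 1)
    (hU : MatApprox (Matrix.diagonal (fun _ => P) * U - U * Matrix.diagonal fun _ => P)) :
    MatApprox (toeplitz P U * toeplitz P V - 1) := by
  have hD := diagonal_mul_self (n := n) hP
  rw [toeplitz, toeplitz]
  set D : Matrix (Fin n) (Fin n) (H →L[ℂ] H) := Matrix.diagonal fun _ => P
  have e : (1 - D + D * U * D) * (1 - D + D * V * D) - 1 =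
      -((D * U - U * D) * ((1 - D) * V * D)) := by
    have e1 : (1 - D) * (1 - D) = 1 - D := by
      rw [mul_sub, mul_one, sub_mul, one_mul, hD, sub_self, sub_zero]
    have e2 : (1 - D) * (D * V * D) = 0 := by
      rw [← mul_assoc, ← mul_assoc, sub_mul, one_mul, hD, sub_self, zero_mul, zero_mul]
    have e3 : D * U * D * (1 - D) = 0 := by
      rw [mul_sub, mul_one, mul_assoc _ D D, hD, sub_self]
    have e4 : D * U * D * (D * V * D) = D * U * D * V * D := by
      calc _ = D * U * (D * D) * V * D := by noncomm_ring
        _ = _ := by rw [hD]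
    have e5 : (D * U - U * D) * ((1 - D) * V * D) = D * U * V * D - D * U * D * V * D -
        U * (D * (1 - D)) * V * D := by noncomm_ring
    rw [e5, mul_sub D, mul_one, hD, sub_self, mul_zero, zero_mul, zero_mul, sub_zero, add_mul,
      mul_add, mul_add, e1, e2, e3, e4, mul_assoc D U V, hUV, mul_one, hD]
    abel
  rw [e]
  exact (hU.mul_right _).neg

lemma matApprox_commutator_inv (hUV : U * V = 1) (hVU : V * U = 1)
    (hU : MatApprox (Matrix.diagonal (fun _ => P) * U - U * Matrix.diagonal fun _ => P)) :
    MatApprox (Matrix.diagonal (fun _ => P) * V - V * Matrix.diagonal fun _ => P) := by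
  set D : Matrix (Fin n) (Fin n) (H →L[ℂ] H) := Matrix.diagonal fun _ => P
  have e : D * V - V * D = -(V * (D * U - U * D) * V) := by
    calc _ = (V * U) * D * V - V * D * (U * V) := by rw [hUV, hVU, one_mul, mul_one]
      _ = _ := by noncomm_ring
  rw [e]
  exact ((hU.mul_left _).mul_right _).neg

lemma isFredholm_toeplitz (hP : P * P = P) (hUV : U * V = 1) (hVU : V * U = 1)
    (hU : MatApprox (Matrix.diagonal (fun _ => P) * U - U * Matrix.diagonal fun _ => P)) :
    (matOp (toeplitz P U)).IsFredholm :=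
  isFredholm_matOp (toeplitz_mul_sub_one hP hVU (matApprox_commutator_inv hUV hVU hU))
    (toeplitz_mul_sub_one hP hUV hU)

lemma fredholmIndex_toeplitz_congr (hU : (matOp (toeplitz P U)).IsFredholm)
    (h : MatApprox (Matrix.diagonal (fun _ => P) * U * Matrix.diagonal (fun _ => P) -
      Matrix.diagonal (fun _ => P) * U' * Matrix.diagonal (fun _ => P))) :
    fredholmIndex (matOp (toeplitz P U')) = fredholmIndex (matOp (toeplitz P U)) := by
  refine (fredholm_matOp_of_sub hU ?_).2
  have : toeplitz P U' - toeplitz P U = -(Matrix.diagonal (fun _ => P) * U *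
    Matrix.diagonal (fun _ => P) - Matrix.diagonal (fun _ => P) * U' *
      Matrix.diagonal (fun _ => P)) := by
    rw [toeplitz, toeplitz]; abel
  rw [this]
  exact h.neg

/-- The indices of the compressions to two complementary projections add up to zero. -/
lemma fredholmIndex_toeplitz_add_eq_zero (hP : P * P = P) (hP' : P' * P' = P') (hPP' : P * P' = 0)
    (hP'P : P' * P = 0) (hUV : U * V = 1) (hVU : V * U = 1)
    (hS : Matrix.diagonal (fun _ => P + P') * U = U * Matrix.diagonal fun _ => P + P')
    (hU : MatApprox (Matrix.diagonal (fun _ => P) * U - U * Matrix.diagonal fun _ => P)) :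
    fredholmIndex (matOp (toeplitz P U)) + fredholmIndex (matOp (toeplitz P' U)) = 0 := by
  have hadd : Matrix.diagonal (fun _ : Fin n => P + P') =
      Matrix.diagonal (fun _ => P) + Matrix.diagonal (fun _ => P') :=
    (Matrix.diagonal_add _ _).symm
  have hD := diagonal_mul_self (n := n) hP
  have hD' := diagonal_mul_self (n := n) hP'
  have hDD' : Matrix.diagonal (fun _ : Fin n => P) * Matrix.diagonal (fun _ => P') = 0 := by
    rw [Matrix.diagonal_mul_diagonal, hPP']; exact Matrix.diagonal_zero
  have hD'D : Matrix.diagonal (fun _ : Fin n => P') * Matrix.diagonal (fun _ => P) = 0 := by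
    rw [Matrix.diagonal_mul_diagonal, hP'P]; exact Matrix.diagonal_zero
  have hFP := isFredholm_toeplitz hP hUV hVU hU
  have hU' : MatApprox (Matrix.diagonal (fun _ => P') * U - U * Matrix.diagonal fun _ => P') := by
    have e : Matrix.diagonal (fun _ => P') * U - U * Matrix.diagonal (fun _ => P') =
        -(Matrix.diagonal (fun _ => P) * U - U * Matrix.diagonal fun _ => P) := by
      rw [hadd, add_mul, mul_add] at hS
      rw [neg_sub, sub_eq_sub_iff_add_eq_add, add_comm, hS, add_comm]
    rw [e]
    exact hU.neg
  have hFP' := isFredholm_toeplitz hP' hUV hVU hU'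
  rw [← fredholmIndex_mul hFP hFP', ← matOp_mul]
  rw [hadd] at hS
  rw [toeplitz, toeplitz]
  set D : Matrix (Fin n) (Fin n) (H →L[ℂ] H) := Matrix.diagonal fun _ => P
  set D' : Matrix (Fin n) (Fin n) (H →L[ℂ] H) := Matrix.diagonal fun _ => P'
  set S := D + D' with hSdef
  have hSS : S * S = S := by rw [hSdef, add_mul, mul_add, mul_add, hD, hD', hDD', hD'D]; abel
  have hV : S * V = V * S := by
    calc S * V = V * U * S * V := by rw [hVU, one_mul]
      _ = V * (U * S) * V := by noncomm_ring
      _ = V * S * (U * V) := by rw [← hS]; noncomm_ring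
      _ = V * S := by rw [hUV, mul_one]
  -- `S` is an idempotent commuting with `U`, so the Toeplitz operator of `S` is honestly invertible
  -- and has index zero.
  have hunit : IsUnit (1 - S + S * U) := by
    have hmul : ∀ {A B : Matrix (Fin n) (Fin n) (H →L[ℂ] H)}, A * B = 1 → S * A = A * S →
        (1 - S + S * A) * (1 - S + S * B) = 1 := fun {A B} hAB hA => by
      have e1 : (1 - S) * (1 - S) = 1 - S := by
        rw [mul_sub, mul_one, sub_mul, one_mul, hSS, sub_self, sub_zero]
      have e2 : (1 - S) * (S * B) = 0 := by
        rw [← mul_assoc, sub_mul, one_mul, hSS, sub_self, zero_mul]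
      have e3 : S * A * (1 - S) = 0 := by
        rw [hA, mul_assoc, mul_sub, mul_one, hSS, sub_self, mul_zero]
      have e4 : S * A * (S * B) = S := by
        rw [hA, mul_assoc, ← mul_assoc S S B, hSS, ← mul_assoc, ← hA, mul_assoc, hAB, mul_one]
      rw [add_mul, mul_add, mul_add, e1, e2, e3, e4]
      abel
    exact ⟨⟨_, _, hmul hUV hS, hmul hVU hV⟩, rfl⟩
  have hUf := isFredholm_of_isUnit (isUnit_matOp hunit)
  rw [← fredholmIndex_of_isUnit (isUnit_matOp hunit)]
  refine (fredholm_matOp_of_sub hUf ?_).2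
  -- The product of the two Toeplitz operators differs from that of `S` by the off-diagonal corners
  -- `D U D'` and `D' U D`, which are commutators cut down by a projection.
  have e : (1 - D + D * U * D) * (1 - D' + D' * U * D') - (1 - S + S * U) =
      -((D * U - U * D) * D') - (D' * U - U * D') * D := by
    have f1 : (1 - D) * (1 - D') = 1 - S := by
      rw [mul_sub, mul_one, sub_mul, one_mul, hDD', hSdef]; abel
    have f2 : (1 - D) * (D' * U * D') = D' * U * D' := by
      rw [← mul_assoc, ← mul_assoc, sub_mul, one_mul, hDD', sub_zero]
    have f3 : D * U * D * (1 - D') = D * U * D := by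
      rw [mul_sub, mul_one, mul_assoc _ D D', hDD', mul_zero, sub_zero]
    have f4 : D * U * D * (D' * U * D') = 0 := by
      calc _ = D * U * (D * D') * U * D' := by noncomm_ring
        _ = 0 := by rw [hDD']; simp
    have f5 : S * U = D * U * D + D * U * D' + D' * U * D + D' * U * D' := by
      calc S * U = S * S * U := by rw [hSS]
        _ = S * U * S := by conv_lhs => rw [mul_assoc, hS, ← mul_assoc]
        _ = _ := by rw [hSdef]; noncomm_ring
    rw [add_mul, mul_add, mul_add, f1, f2, f3, f4, f5, sub_mul, sub_mul, mul_assoc U D D', hDD',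
      mul_assoc U D' D, hD'D]
    noncomm_ring
  rw [e]
  exact (hU.mul_right _).neg.sub (hU'.mul_right _)

/-- Factoring into two commuting blocks, each padded by an identity, reduces additivity under block
sums to multiplicativity of the index. -/
lemma toeplitz_blockSum (P : H →L[ℂ] H) (U : Matrix (Fin m) (Fin m) (H →L[ℂ] H))
    (V : Matrix (Fin n) (Fin n) (H →L[ℂ] H)) :
    toeplitz P (blockSum U V) = blockSum (toeplitz P U) 1 * blockSum 1 (toeplitz P V) := by
  have hd : Matrix.diagonal (fun _ : Fin (m + n) => P) =
      blockSum (Matrix.diagonal fun _ : Fin m => P) (Matrix.diagonal fun _ : Fin n => P) := by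
    ext i j : 1
    obtain ⟨i, rfl⟩ := finSumFinEquiv.surjective i
    obtain ⟨j, rfl⟩ := finSumFinEquiv.surjective j
    rcases i with i | i <;> rcases j with j | j <;>
      simp only [blockSum, Matrix.diagonal_apply, Matrix.reindex_apply, Matrix.submatrix_apply,
        Equiv.symm_apply_apply, Matrix.fromBlocks_apply₁₁, Matrix.fromBlocks_apply₁₂,
        Matrix.fromBlocks_apply₂₁, Matrix.fromBlocks_apply₂₂, Matrix.zero_apply,
        EmbeddingLike.apply_eq_iff_eq, Sum.inl.injEq, Sum.inr.injEq, reduceCtorEq, if_false]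
  have hs : ∀ (A B : Matrix (Fin m) (Fin m) (H →L[ℂ] H)) (C D : Matrix (Fin n) (Fin n) (H →L[ℂ] H)),
      blockSum A C - blockSum B D = blockSum (A - B) (C - D) := fun A B C D => by
    rw [sub_eq_iff_eq_add, ← blockSum_add, sub_add_cancel, sub_add_cancel]
  rw [blockSum_mul, mul_one, one_mul, toeplitz, hd, blockSum_mul, blockSum_mul, ← blockSum_one, hs,
    ← blockSum_add]
  rfl

lemma fredholmIndex_toeplitz_blockSum {U : Matrix (Fin m) (Fin m) (H →L[ℂ] H)}
    {V : Matrix (Fin n) (Fin n) (H →L[ℂ] H)} (hU : (matOp (toeplitz P U)).IsFredholm)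
    (hV : (matOp (toeplitz P V)).IsFredholm) :
    fredholmIndex (matOp (toeplitz P (blockSum U V))) =
      fredholmIndex (matOp (toeplitz P U)) + fredholmIndex (matOp (toeplitz P V)) := by
  have h1 : (matOp (blockSum (toeplitz P U)
      (1 : Matrix (Fin n) (Fin n) (H →L[ℂ] H)))).IsFredholm := by
    obtain ⟨v, w, h, e⟩ := matOp_blockSum_one (toeplitz P U) n
    rw [e]
    exact isFredholm_corner h hU
  have h2 : (matOp (blockSum (1 : Matrix (Fin m) (Fin m) (H →L[ℂ] H))
      (toeplitz P V))).IsFredholm := by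
    obtain ⟨v, w, h, e⟩ := matOp_one_blockSum m (toeplitz P V)
    rw [e]
    exact isFredholm_corner h hV
  rw [toeplitz_blockSum, matOp_mul, fredholmIndex_mul h1 h2, fredholm_blockSum_one,
    fredholm_one_blockSum]

end MatrixOperators

/-! ### Geometry of admissible sets and compact commutators. -/

section AdmissibleGeometry

variable {X : Type*} [MetricSpace X] [MeasurableSpace X] {μ : Measure X} {W Z : Set X}

lemma isClosed_regCompl (hW : IsClosed W) : IsClosed (regCompl W Z) :=
  hW.inter isClosed_closure

lemma IsAdmissible.isClosed (h : IsAdmissible μ W Z) : IsClosed Z := by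
  rw [← h.regular]
  exact isClosed_regCompl h.isHalfSpace.isClosed

lemma sdiff_subset_regCompl : W \ Z ⊆ regCompl W Z :=
  fun _ hx => ⟨hx.1, subset_closure hx⟩

lemma regCompl_subset : regCompl W Z ⊆ W := Set.inter_subset_left

lemma IsAdmissible.compl (h : IsAdmissible μ W Z) : IsAdmissible μ W (regCompl W Z) where
  isHalfSpace := h.isHalfSpace
  subset := regCompl_subset
  regular := by rw [h.regular]
  excisive R hR := by
    rw [h.regular, Set.inter_comm (regCompl W Z), Set.inter_comm (Metric.cthickening R _)]
    exact h.excisive R hR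
  transverse R hR := by
    rw [h.regular, Set.inter_comm (regCompl W Z)]
    exact h.transverse R hR
  measure_zero := by
    rw [h.regular, Set.inter_comm]
    exact h.measure_zero

/-- If `Z` is admissible in `W` and `W'` then it is separated from `W' \ Z` near the complement of
`W`. -/
lemma IsAdmissible.isBounded {W' : Set X} (h : IsAdmissible μ W Z) (h' : IsAdmissible μ W' Z)
    (hN : Z ∩ regCompl W' Z = Z ∩ regCompl W Z) (R : ℝ) :
    Bornology.IsBounded (Metric.cthickening R Wᶜ ∩ Metric.cthickening R Z ∩
      Metric.cthickening R (W' \ Z)) := by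
  -- Excisiveness in `W'` puts a point close to both `Z` and `W' \ Z` near the common interface `N`;
  -- transversality in `W` bounds such points close to `Wᶜ`.
  obtain ⟨S, hS, hsub⟩ := h'.excisive (max R 0) (le_max_right _ _)
  refine (h.transverse (max (max R 0) S) (le_trans (le_max_right _ _) (le_max_left _ _))).subset ?_
  rintro x ⟨⟨h1, h2⟩, h3⟩
  refine ⟨Metric.cthickening_mono (le_trans (le_max_left _ _) (le_max_left _ _)) _ h1, ?_⟩
  rw [← hN]
  refine Metric.cthickening_mono (le_max_right _ _) _ (hsub ⟨?_, ?_⟩)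
  · exact Metric.cthickening_mono (le_max_left _ _) _ h2
  · exact Metric.cthickening_subset_of_subset _ sdiff_subset_regCompl
      (Metric.cthickening_mono (le_max_left _ _) _ h3)

end AdmissibleGeometry

section Commutators

variable {X : Type*} [MetricSpace X] [MeasurableSpace X] [BorelSpace X]
variable {μ : Measure X} {W Z : Set X}

lemma IsRoe.isApproximable_chi_mul_chi {T : BL2 μ} (hT : IsRoe μ T) {r : ℝ} (hr : FinProp μ T r)
    {A B : Set X} (hA : MeasurableSet A) (hB : MeasurableSet B)
    (hb : Bornology.IsBounded (Metric.thickening r A ∩ B)) :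
    IsApproximable (chi μ A * T * chi μ B) := by
  have hth : MeasurableSet (Metric.thickening r A) := Metric.isOpen_thickening.measurableSet
  rw [← hr.chi_mul hA, mul_assoc _ (chi μ _), chi_mul_chi hth hB, mul_assoc]
  exact (hT.locComp _ (hth.inter hB) hb).1.mul_left _

lemma mem_cthickening_of_notMem_deep {R : ℝ} {x : X} (hx : x ∉ deep W R) :
    x ∈ Metric.cthickening R Wᶜ :=
  Metric.mem_cthickening_iff.2 (not_le.1 (show ¬ ENNReal.ofReal R ≤ _ from hx)).le

variable [ProperSpace X] [IsFiniteMeasureOnCompacts μ]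

/-- Operators localized near the boundary of `W` commute with the projection onto `L²(Z)` up to
compact operators. -/
lemma IsAdmissible.isApproximable_commutator_of_mem (hX : HasAlmostGeodesics X)
    (h : IsAdmissible μ W Z) (hW : MeasurableSet W) {A : BL2 (μ.restrict W)}
    (hA : A ∈ localizedSet μ W) :
    IsApproximable (chi μ Z * extHom μ hW A - extHom μ hW A * chi μ Z) := by
  obtain ⟨h1, R, hR, h2⟩ := (mem_localizedSet_iff hX hW).1 hA
  obtain ⟨r, hr⟩ := h1.finProp
  have hZ := h.isClosed.measurableSet
  have hd : MeasurableSet (deep W R) := (isClosed_deep W R).measurableSet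
  have e1 := chi_mul_extHom_self hW A
  have e2 := extHom_mul_chi_self hW A
  have e3 := chi_add_chi_sdiff (ν := μ) hW hZ h.subset
  have hcut : ∀ {E : Set X}, MeasurableSet E →
      -- Localized operators ignore deep functions, so every source set may be cut down to a
      -- neighbourhood of `Wᶜ`.
      extHom μ hW A * chi μ E = extHom μ hW A * chi μ (E \ deep W R) := fun {E} hE => by
    have := chi_add_chi_sdiff (ν := μ) hE (hE.inter hd) Set.inter_subset_left
    rw [Set.sdiff_self_inter] at this
    rw [← this, mul_add, Set.inter_comm, ← chi_mul_chi hd hE, ← mul_assoc, h2, zero_mul, zero_add]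
  set T := extHom μ hW A
  -- Only crossings between `Z` and `W \ Z` contribute to the commutator. Close to `Wᶜ` they happen
  -- in a bounded set, where `T` is compact.
  have e : chi μ Z * T - T * chi μ Z = chi μ Z * T * chi μ (W \ Z) - chi μ (W \ Z) * T * chi μ Z := by
    have f1 : chi μ Z * T = chi μ Z * T * chi μ Z + chi μ Z * T * chi μ (W \ Z) := by
      rw [← mul_add, e3, mul_assoc, e2]
    have f2 : T * chi μ Z = chi μ Z * T * chi μ Z + chi μ (W \ Z) * T * chi μ Z := by
      rw [← add_mul, ← add_mul, e3, e1]
    exact (congrArg₂ (· - ·) f1 f2).trans (by abel)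
  have hbd : ∀ {x : X} {A B : Set X}, x ∈ Metric.thickening r A → x ∈ B → x ∉ deep W R →
      x ∈ Metric.cthickening (max r R) A ∧ x ∈ Metric.cthickening (max r R) B ∧
        x ∈ Metric.cthickening (max r R) Wᶜ := fun {x A B} hA hB hd =>
    ⟨Metric.cthickening_mono (le_max_left _ _) _ (Metric.thickening_subset_cthickening _ _ hA),
      Metric.self_subset_cthickening _ hB,
      Metric.cthickening_mono (le_max_right _ _) _ (mem_cthickening_of_notMem_deep hd)⟩
  rw [e]
  refine IsApproximable.sub ?_ ?_
  · rw [mul_assoc, hcut (hW.diff hZ), ← mul_assoc]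
    refine h1.isApproximable_chi_mul_chi hr hZ ((hW.diff hZ).diff hd)
      ((h.isBounded h rfl (max r R)).subset ?_)
    rintro x ⟨hx1, hx2, hx3⟩
    obtain ⟨g1, g2, g3⟩ := hbd hx1 hx2 hx3
    exact ⟨⟨g3, g1⟩, g2⟩
  · rw [mul_assoc, hcut hZ, ← mul_assoc]
    refine h1.isApproximable_chi_mul_chi hr (hW.diff hZ) (hZ.diff hd)
      ((h.isBounded h rfl (max r R)).subset ?_)
    rintro x ⟨hx1, hx2, hx3⟩
    obtain ⟨g1, g2, g3⟩ := hbd hx1 hx2 hx3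
    exact ⟨⟨g3, g2⟩, g1⟩

lemma IsAdmissible.isApproximable_commutator (hX : HasAlmostGeodesics X)
    (h : IsAdmissible μ W Z) (hW : MeasurableSet W) {A : BL2 (μ.restrict W)}
    (hA : A ∈ localizedRoe μ W) :
    IsApproximable (chi μ Z * extHom μ hW A - extHom μ hW A * chi μ Z) := by
  have hA' : A ∈ closure (localizedSet μ W) := by rw [← coe_localizedRoe hX hW]; exact hA
  have hc : IsClosed {A : BL2 (μ.restrict W) |
      IsApproximable (chi μ Z * extHom μ hW A - extHom μ hW A * chi μ Z)} :=
    isClosed_closure.preimage (((continuous_const_mul _).comp (continuous_extHom hW)).sub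
      ((continuous_mul_const _).comp (continuous_extHom hW)))
  exact closure_minimal (fun A hA => h.isApproximable_commutator_of_mem hX hW hA) hc hA'

end Commutators

/-! ### The index homomorphism. -/

section UnitizationRep

variable {A B : Type*} [NonUnitalCStarAlgebra A] [CStarAlgebra B] {m n : ℕ}
variable (ρ : Unitization ℂ A →⋆ₐ[ℂ] B)

lemma map_unitization_mul (a b : Matrix (Fin n) (Fin n) (Unitization ℂ A)) :
    (a * b).map ρ = a.map ρ * b.map ρ :=
  Matrix.map_mul (f := (ρ : Unitization ℂ A →+* B))

lemma map_unitization_one : (1 : Matrix (Fin n) (Fin n) (Unitization ℂ A)).map ρ = 1 :=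
  Matrix.map_one _ (map_zero _) (map_one _)

lemma map_unitization_blockSum (a : Matrix (Fin m) (Fin m) (Unitization ℂ A))
    (b : Matrix (Fin n) (Fin n) (Unitization ℂ A)) :
    (blockSum a b).map ρ = blockSum (a.map ρ) (b.map ρ) :=
  map_blockSum ρ a b

lemma unitary_map_unitization {u : Matrix (Fin n) (Fin n) (Unitization ℂ A)}
    (hu : u ∈ unitary (Matrix (Fin n) (Fin n) (Unitization ℂ A))) :
    u.map ρ * (star u).map ρ = 1 ∧ (star u).map ρ * u.map ρ = 1 := by
  rw [Unitary.mem_iff] at hu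
  rw [← map_unitization_mul, ← map_unitization_mul, hu.1, hu.2]
  exact ⟨map_unitization_one ρ, map_unitization_one ρ⟩

/-- A homomorphism `K₁(A) → ℤ` defined on unitaries. -/
def K1.lift (ind : ∀ n : ℕ, Matrix (Fin n) (Fin n) (Unitization ℂ A) → ℤ)
    (h₁ : ∀ (n : ℕ) (a b : Matrix (Fin n) (Fin n) (Unitization ℂ A)),
      JoinedIn (unitaryMat (Unitization ℂ A) n) a b → ind n a = ind n b)
    (h₂ : ∀ (m n : ℕ) (a : Matrix (Fin m) (Fin m) (Unitization ℂ A))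
      (b : Matrix (Fin n) (Fin n) (Unitization ℂ A)), a ∈ unitaryMat (Unitization ℂ A) m →
      b ∈ unitaryMat (Unitization ℂ A) n → ind (m + n) (blockSum a b) = ind m a + ind n b)
    (h₃ : ∀ n, ind n 1 = 0) : K1 A →+ ℤ :=
  QuotientAddGroup.lift _
    (FreeAbelianGroup.lift fun g : MatGen (Unitization ℂ A) (unitaryMat _) =>
      ind g.size g.mat.1) (by
    rw [AddSubgroup.closure_le]
    rintro x ((⟨n, a, b, hab, rfl⟩ | ⟨m, n, a, b, ⟨c, hc'⟩, hc, rfl⟩) | ⟨n, ⟨a, ha'⟩, ha, rfl⟩)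
    · rw [SetLike.mem_coe, AddMonoidHom.mem_ker, map_sub, FreeAbelianGroup.lift_apply_of,
        FreeAbelianGroup.lift_apply_of, sub_eq_zero]
      exact h₁ n _ _ hab
    · rw [SetLike.mem_coe, AddMonoidHom.mem_ker, map_sub, map_add, FreeAbelianGroup.lift_apply_of,
        FreeAbelianGroup.lift_apply_of, FreeAbelianGroup.lift_apply_of, sub_eq_zero]
      obtain rfl : c = _ := hc
      exact h₂ m n _ _ a.2 b.2
    · rw [SetLike.mem_coe, AddMonoidHom.mem_ker, FreeAbelianGroup.lift_apply_of]
      obtain rfl : a = _ := ha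
      exact h₃ n)

lemma K1.lift_mk (ind : ∀ n : ℕ, Matrix (Fin n) (Fin n) (Unitization ℂ A) → ℤ) (h₁ h₂ h₃)
    (u : Matrix (Fin n) (Fin n) (Unitization ℂ A))
    (hu : u ∈ unitary (Matrix (Fin n) (Fin n) (Unitization ℂ A))) :
    K1.lift ind h₁ h₂ h₃ (K1Unital.mk u hu) = ind n u :=
  FreeAbelianGroup.lift_apply_of _ _

lemma K1.hom_ext {θ θ' : K1 A →+ ℤ}
    (h : ∀ (n : ℕ) (u : Matrix (Fin n) (Fin n) (Unitization ℂ A))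
      (hu : u ∈ unitary (Matrix (Fin n) (Fin n) (Unitization ℂ A))),
      θ (K1Unital.mk u hu) = θ' (K1Unital.mk u hu)) : θ = θ' :=
  QuotientAddGroup.addMonoidHom_ext _
    (FreeAbelianGroup.lift_ext _ _ fun g => h g.size g.mat.1 g.mat.2)

end UnitizationRep

section IndexHom

variable {X : Type*} [MetricSpace X] [MeasurableSpace X] [BorelSpace X]
variable {μ : Measure X} {W Z : Set X} {m n : ℕ}

/-- The action of the unitization of an algebra of operators on `L²(W)` on `L²(X)`. -/
def unitalRep (μ : Measure X) (hW : MeasurableSet W)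
    (S : NonUnitalStarSubalgebra ℂ (BL2 (μ.restrict W))) : Unitization ℂ S →⋆ₐ[ℂ] BL2 μ :=
  Unitization.starLift ((extHom μ hW).comp (NonUnitalStarSubalgebraClass.subtype S))

lemma unitalRep_apply (hW : MeasurableSet W) (S : NonUnitalStarSubalgebra ℂ (BL2 (μ.restrict W)))
    (x : Unitization ℂ S) :
    unitalRep μ hW S x = x.fst • (1 : BL2 μ) + extHom μ hW (x.snd : BL2 (μ.restrict W)) := by
  change algebraMap ℂ (BL2 μ) x.fst + _ = _
  rw [Algebra.algebraMap_eq_smul_one]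
  rfl

lemma matOp_toeplitz_apply {H : Type*} [NormedAddCommGroup H] [InnerProductSpace ℂ H]
    [CompleteSpace H] (P : H →L[ℂ] H) (U : Matrix (Fin n) (Fin n) (H →L[ℂ] H)) (f : Fin n → H)
    (i : Fin n) :
    matOp (toeplitz P U) f i = f i - P (f i) + ∑ j, (P * U i j * P) (f j) := by
  have e1 : matOp (Matrix.diagonal fun _ : Fin n => P) f i = P (f i) := by
    rw [matOp_apply, Finset.sum_eq_single i]
    · simp
    · intro j _ hj
      simp [Matrix.diagonal_apply_ne _ hj.symm]
    · simp
  have e2 : matOp (1 - Matrix.diagonal fun _ : Fin n => P) f i = f i - P (f i) := by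
    have := congrArg (fun T : (Fin n → H) →L[ℂ] (Fin n → H) => T f i)
      (matOp_add (1 - Matrix.diagonal fun _ : Fin n => P) (Matrix.diagonal fun _ : Fin n => P))
    simp only [sub_add_cancel, matOp_one] at this
    rw [eq_sub_iff_add_eq, ← e1]
    exact this.symm
  rw [toeplitz, matOp_add]
  change matOp _ f i + matOp _ f i = _
  rw [e2, matOp_apply]
  congr 1
  refine Finset.sum_congr rfl fun j _ => ?_
  rw [Matrix.mul_diagonal, Matrix.diagonal_mul]

variable [ProperSpace X] [IsFiniteMeasureOnCompacts μ]

/-- The compression to `L²(Z)^n` and the Toeplitz operator on `L²(X)^n` differ by an identity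
summand. -/
lemma exists_corner_compression (hW : MeasurableSet W) (hZ : MeasurableSet Z) (hZW : Z ⊆ W)
    (u : Matrix (Fin n) (Fin n) (Unitization ℂ (localizedRoe μ W))) :
    ∃ (v : (Fin n → L2 ((μ.restrict W).restrict Z)) →L[ℂ] (Fin n → L2 μ))
      (w : (Fin n → L2 μ) →L[ℂ] (Fin n → L2 ((μ.restrict W).restrict Z))),
      w ∘L v = 1 ∧ matOp (toeplitz (chi μ Z) (u.map (unitalRep μ hW (localizedRoe μ W)))) =
        1 - v ∘L w + v ∘L compression μ W Z u ∘L w := by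
  refine ⟨ContinuousLinearMap.pi fun i =>
    (extendOp μ W ∘L extendOp (μ.restrict W) Z) ∘L ContinuousLinearMap.proj i,
    ContinuousLinearMap.pi fun i =>
      (restrictOp (μ.restrict W) Z ∘L restrictOp μ W) ∘L ContinuousLinearMap.proj i, ?_, ?_⟩
  · refine ContinuousLinearMap.ext fun f => funext fun i => ?_
    have h1 := fun x => congrArg (fun T : BL2 (μ.restrict W) => T x) (restrictOp_extendOp hW)
    have h2 := congrArg (fun T : BL2 ((μ.restrict W).restrict Z) => T (f i))
      (restrictOp_extendOp (ν := μ.restrict W) hZ)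
    change restrictOp (μ.restrict W) Z (restrictOp μ W (extendOp μ W
      (extendOp (μ.restrict W) Z (f i)))) = f i
    exact (congrArg _ (h1 _)).trans h2
  · refine ContinuousLinearMap.ext fun f => funext fun i => ?_
    have hext : ∀ A : BL2 (μ.restrict W), extHom μ hW (chi (μ.restrict W) Z * A *
        chi (μ.restrict W) Z) = chi μ Z * extHom μ hW A * chi μ Z := fun A => by
      rw [← extHom_mul_chi hW hZ, ← chi_mul_extHom hW hZ]
    have h1 : extHom μ hW 1 = chi μ W := rfl
    have hc := chi_mul_chi (ν := μ) hZ hW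
    rw [Set.inter_eq_left.2 hZW] at hc
    -- After cutting down to `Z ⊆ W` it makes no difference that a scalar acts on all of `L²(X)` in
    -- `unitalRep` but only on `L²(W)` in `compression`.
    have hchi : extHom μ hW (chi (μ.restrict W) Z) = chi μ Z := by
      have := hext 1
      rw [mul_one, chi_mul_self hZ, h1, hc, chi_mul_self hZ] at this
      exact this
    have hrep : ∀ j, chi μ Z * unitalRep μ hW (localizedRoe μ W) (u i j) * chi μ Z =
        extHom μ hW (chi (μ.restrict W) Z * ((u i j).fst • (1 : BL2 (μ.restrict W)) +
          ((u i j).snd : BL2 (μ.restrict W))) * chi (μ.restrict W) Z) := fun j => by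
      rw [hext, map_add, map_smul, h1, unitalRep_apply, mul_add, mul_add, mul_smul_comm,
        mul_smul_comm, mul_one, hc]
    rw [matOp_toeplitz_apply]
    simp only [Matrix.map_apply, hrep]
    change _ = f i - extHom μ hW (chi (μ.restrict W) Z) (f i) +
      extendOp μ W (extendOp (μ.restrict W) Z (compression μ W Z u
        (fun i => restrictOp (μ.restrict W) Z (restrictOp μ W (f i))) i))
    rw [hchi]
    congr 1
    have hcomp : ∀ g, compression μ W Z u g i = ∑ j, restrictOp (μ.restrict W) Z
      (((u i j).fst • (1 : BL2 (μ.restrict W)) + ((u i j).snd : BL2 (μ.restrict W)))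
        (extendOp (μ.restrict W) Z (g j))) := fun g => by
      simp only [compression, ContinuousLinearMap.pi_apply, sum_apply]
      rfl
    rw [hcomp, map_sum, map_sum]
    rfl

variable (hX : HasAlmostGeodesics X) (h : IsAdmissible μ W Z) (hW : MeasurableSet W)

include hX h in
lemma IsAdmissible.matApprox_commutator
    (u : Matrix (Fin n) (Fin n) (Unitization ℂ (localizedRoe μ W))) :
    MatApprox (Matrix.diagonal (fun _ => chi μ Z) * u.map (unitalRep μ hW (localizedRoe μ W)) -
      u.map (unitalRep μ hW (localizedRoe μ W)) * Matrix.diagonal (fun _ => chi μ Z)) := by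
  intro i j
  rw [Matrix.sub_apply, Matrix.diagonal_mul, Matrix.mul_diagonal, Matrix.map_apply, unitalRep_apply,
    mul_add, add_mul, mul_smul_comm, smul_mul_assoc, mul_one, one_mul, add_sub_add_left_eq_sub]
  exact h.isApproximable_commutator hX hW (u i j).snd.2

include hX h in
lemma IsAdmissible.isFredholm_toeplitz
    {u : Matrix (Fin n) (Fin n) (Unitization ℂ (localizedRoe μ W))}
    (hu : u ∈ unitary (Matrix (Fin n) (Fin n) (Unitization ℂ (localizedRoe μ W)))) :
    (matOp (toeplitz (chi μ Z) (u.map (unitalRep μ hW (localizedRoe μ W))))).IsFredholm := by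
  obtain ⟨h1, h2⟩ := unitary_map_unitization (unitalRep μ hW (localizedRoe μ W)) hu
  exact _root_.isFredholm_toeplitz (chi_mul_self h.isClosed.measurableSet) h1 h2
    (h.matApprox_commutator hX hW u)

include h in
lemma IsAdmissible.fredholmIndex_compression
    (u : Matrix (Fin n) (Fin n) (Unitization ℂ (localizedRoe μ W))) :
    fredholmIndex (compression μ W Z u) =
      fredholmIndex (matOp (toeplitz (chi μ Z) (u.map (unitalRep μ hW (localizedRoe μ W))))) := by
  obtain ⟨v, w, hvw, e⟩ := exists_corner_compression hW h.isClosed.measurableSet h.subset u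
  rw [e, fredholmIndex_corner hvw]

include hX h in
lemma IsAdmissible.isFredholm_compression
    {u : Matrix (Fin n) (Fin n) (Unitization ℂ (localizedRoe μ W))}
    (hu : u ∈ unitary (Matrix (Fin n) (Fin n) (Unitization ℂ (localizedRoe μ W)))) :
    (compression μ W Z u).IsFredholm := by
  have hF := h.isFredholm_toeplitz hX h.isHalfSpace.isClosed.measurableSet hu
  obtain ⟨v, w, hvw, e⟩ := exists_corner_compression h.isHalfSpace.isClosed.measurableSet
    h.isClosed.measurableSet h.subset u
  rw [e] at hF
  exact isFredholm_of_corner hvw hF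

lemma continuous_unitalRep (S : NonUnitalStarSubalgebra ℂ (BL2 (μ.restrict W)))
    [IsClosed (S : Set (BL2 (μ.restrict W)))] :
    Continuous (unitalRep μ hW S) :=
  AddMonoidHomClass.continuous_of_bound (unitalRep μ hW S) 1 fun x => by
    rw [one_mul]; exact NonUnitalStarAlgHom.norm_apply_le (unitalRep μ hW S) x

lemma continuous_toeplitz {H : Type*} [NormedAddCommGroup H] [InnerProductSpace ℂ H]
    [CompleteSpace H] (P : H →L[ℂ] H) :
    Continuous (toeplitz (n := n) P) :=
  continuous_const.add ((continuous_const_mul _).mul continuous_const)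

-- Along the path the Toeplitz operators vary continuously and stay Fredholm, so the index is
-- locally constant on a connected interval.
include hX h in
lemma IsAdmissible.index_eq_of_joinedIn
    {u v : Matrix (Fin n) (Fin n) (Unitization ℂ (localizedRoe μ W))}
    (huv : JoinedIn (unitaryMat (Unitization ℂ (localizedRoe μ W)) n) u v) :
    fredholmIndex (compression μ W Z u) = fredholmIndex (compression μ W Z v) := by
  have hW := h.isHalfSpace.isClosed.measurableSet
  obtain ⟨γ, hγ⟩ := huv
  have hc : Continuous fun t => matOp (toeplitz (chi μ Z)
      ((γ t).map (unitalRep μ hW (localizedRoe μ W)))) :=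
    continuous_matOp.comp ((continuous_toeplitz _).comp
      (γ.continuous.matrix_map (continuous_unitalRep hW _)))
  have hl : IsLocallyConstant fun t => fredholmIndex (matOp (toeplitz (chi μ Z)
      ((γ t).map (unitalRep μ hW (localizedRoe μ W))))) := by
    rw [IsLocallyConstant.iff_eventually_eq]
    intro t
    filter_upwards [hc.continuousAt.eventually
      (eventually_fredholm (h.isFredholm_toeplitz hX hW (hγ t)))] with s hs
    exact hs.2
  have := hl.apply_eq_of_preconnectedSpace 0 1
  simp only [γ.source, γ.target] at this
  rw [h.fredholmIndex_compression hW, h.fredholmIndex_compression hW, this]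

include hX h in
lemma IsAdmissible.index_blockSum
    {a : Matrix (Fin m) (Fin m) (Unitization ℂ (localizedRoe μ W))}
    {b : Matrix (Fin n) (Fin n) (Unitization ℂ (localizedRoe μ W))}
    (ha : a ∈ unitary (Matrix (Fin m) (Fin m) (Unitization ℂ (localizedRoe μ W))))
    (hb : b ∈ unitary (Matrix (Fin n) (Fin n) (Unitization ℂ (localizedRoe μ W)))) :
    fredholmIndex (compression μ W Z (blockSum a b)) =
      fredholmIndex (compression μ W Z a) + fredholmIndex (compression μ W Z b) := by
  have hW := h.isHalfSpace.isClosed.measurableSet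
  rw [h.fredholmIndex_compression hW, h.fredholmIndex_compression hW,
    h.fredholmIndex_compression hW, map_unitization_blockSum]
  exact fredholmIndex_toeplitz_blockSum (h.isFredholm_toeplitz hX hW ha)
    (h.isFredholm_toeplitz hX hW hb)

include h in
lemma IsAdmissible.index_one :
    fredholmIndex (compression μ W Z
      (1 : Matrix (Fin n) (Fin n) (Unitization ℂ (localizedRoe μ W)))) = 0 := by
  have hW := h.isHalfSpace.isClosed.measurableSet
  rw [h.fredholmIndex_compression hW, map_unitization_one,
    toeplitz_one (chi_mul_self h.isClosed.measurableSet), matOp_one, fredholmIndex_one]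

/-- The index homomorphism. -/
def indexHom : K1 (localizedRoe μ W) →+ ℤ :=
  K1.lift (fun _ u => fredholmIndex (compression μ W Z u))
    (fun _ _ _ hab => h.index_eq_of_joinedIn hX hab)
    (fun _ _ _ _ ha hb => h.index_blockSum hX ha hb) (fun _ => h.index_one)

lemma isIndexHom_indexHom : IsIndexHom μ W Z (indexHom hX h) :=
  fun _ _ hu => ⟨h.isFredholm_compression hX hu, K1.lift_mk _ _ _ _ _ hu⟩

lemma IsIndexHom.unique {θ θ' : K1 (localizedRoe μ W) →+ ℤ} (hθ : IsIndexHom μ W Z θ)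
    (hθ' : IsIndexHom μ W Z θ') : θ' = θ :=
  K1.hom_ext fun n u hu => (hθ' n u hu).2.trans (hθ n u hu).2.symm

end IndexHom

/-! ### Comparison of compressed exponentials modulo compact operators. -/

section CompressedExponential

variable {H : Type*} [NormedAddCommGroup H] [InnerProductSpace ℂ H] [CompleteSpace H] {n : ℕ}
variable {D a a' e e' : Matrix (Fin n) (Fin n) (H →L[ℂ] H)}

/-- By hypothesis, once the defect `e` has acted, a crossing `(1 - D) a D` is negligible. So the
factors of `a` to its right can be compressed by `D` one after the other, starting from the right
end. -/
lemma matApprox_compress_mul_pow (hD : D * D = D)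
    (h : ∀ k, MatApprox (e * a ^ k * (a * D - D * a * D))) (k : ℕ) :
    MatApprox (D * e * a ^ k * D - D * e * D * (D * a * D) ^ k) := by
  induction k with
  | zero => simpa using matApprox_zero
  | succ k ih =>
    have : D * e * a ^ (k + 1) * D - D * e * D * (D * a * D) ^ (k + 1) =
        D * (e * a ^ k * (a * D - D * a * D)) +
          (D * e * a ^ k * D - D * e * D * (D * a * D) ^ k) * (D * a * D) := by
      have h1 : D * e * a ^ k * D * (D * a * D) = D * e * a ^ k * D * a * D := by
        calc _ = D * e * a ^ k * (D * D) * a * D := by noncomm_ring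
          _ = _ := by rw [hD]
      rw [sub_mul, h1, pow_succ, pow_succ]
      noncomm_ring
    rw [this]
    exact ((h k).mul_left D).add (ih.mul_right _)

/-- The recursion `a^(k+2) = a^(k+1) - e a^k` replaces the term of highest degree by one containing
the defect. Modulo compact operators that term only involves `D e D` and `D a D`, which agree for
`a` and `a'`. -/
lemma matApprox_compress_pow_sub (hD : D * D = D) (haa' : D * a * D = D * a' * D)
    (he : e = a - a * a) (he' : e' = a' - a' * a')
    (h : ∀ k, MatApprox (e * a ^ k * (a * D - D * a * D)))
    (h' : ∀ k, MatApprox (e' * a' ^ k * (a' * D - D * a' * D)))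
    (hee' : MatApprox (D * e * D - D * e' * D)) (k : ℕ) :
    MatApprox (D * a ^ k * D - D * a' ^ k * D) := by
  -- The recursion has order two, so two consecutive powers are carried through the induction.
  have key : ∀ k, MatApprox (D * a ^ k * D - D * a' ^ k * D) ∧
      MatApprox (D * a ^ (k + 1) * D - D * a' ^ (k + 1) * D) := by
    intro k
    induction k with
    | zero =>
      rw [pow_zero, pow_zero, sub_self, zero_add, pow_one, pow_one, haa', sub_self]
      exact ⟨matApprox_zero, matApprox_zero⟩
    | succ k ih =>
      refine ⟨ih.2, ?_⟩
      have hs : ∀ {b f : Matrix (Fin n) (Fin n) (H →L[ℂ] H)}, f = b - b * b →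
          D * b ^ (k + 1 + 1) * D = D * b ^ (k + 1) * D - D * f * b ^ k * D := by
        rintro b f rfl
        rw [pow_succ' b (k + 1), pow_succ' b k]
        noncomm_ring
      have : D * a ^ (k + 1 + 1) * D - D * a' ^ (k + 1 + 1) * D =
          (D * a ^ (k + 1) * D - D * a' ^ (k + 1) * D) -
            (D * e * a ^ k * D - D * e * D * (D * a * D) ^ k) +
            (D * e' * a' ^ k * D - D * e' * D * (D * a' * D) ^ k) -
            (D * e * D - D * e' * D) * (D * a * D) ^ k := by
        rw [hs he, hs he', ← haa', sub_mul]
        abel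
      rw [this]
      exact ((ih.2.sub (matApprox_compress_mul_pow hD h k)).add
        (matApprox_compress_mul_pow hD h' k)).sub (hee'.mul_right _)
  exact (key k).1

lemma hasSum_matrix_exp (a : Matrix (Fin n) (Fin n) (H →L[ℂ] H)) :
    HasSum (fun k : ℕ => ((k.factorial : ℂ)⁻¹) • a ^ k) (NormedSpace.exp a) := by
  let _ : PartialOrder (H →L[ℂ] H) := CStarAlgebra.spectralOrder (H →L[ℂ] H)
  have _ : StarOrderedRing (H →L[ℂ] H) := CStarAlgebra.spectralOrderedRing (H →L[ℂ] H)
  let _ : NormedAlgebra ℚ (CStarMatrix (Fin n) (Fin n) (H →L[ℂ] H)) :=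
    NormedAlgebra.restrictScalars ℚ ℂ _
  exact NormedSpace.exp_series_hasSum_exp' (𝕂 := ℂ)
    (𝔸 := CStarMatrix (Fin n) (Fin n) (H →L[ℂ] H)) a

lemma matApprox_compress_exp_sub (z : ℂ) (h : ∀ k, MatApprox (D * a ^ k * D - D * a' ^ k * D)) :
    MatApprox (D * NormedSpace.exp (z • a) * D - D * NormedSpace.exp (z • a') * D) := by
  have hs : HasSum (fun k : ℕ => D * (((k.factorial : ℂ)⁻¹) • (z • a) ^ k) * D -
      D * (((k.factorial : ℂ)⁻¹) • (z • a') ^ k) * D)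
      (D * NormedSpace.exp (z • a) * D - D * NormedSpace.exp (z • a') * D) :=
    (((hasSum_matrix_exp _).mul_left D).mul_right D).sub
      (((hasSum_matrix_exp _).mul_left D).mul_right D)
  refine isClosed_matApprox.mem_of_tendsto hs (Filter.Eventually.of_forall fun s => ?_)
  refine MatApprox.sum fun k _ => ?_
  have := (h k).smul ((k.factorial : ℂ)⁻¹ * z ^ k)
  simpa only [smul_pow, smul_smul, mul_smul_comm, smul_mul_assoc, smul_sub] using this

variable {E E' s C : Matrix (Fin n) (Fin n) (H →L[ℂ] H)}

/-- The identity `hC` expresses that `s + C` is idempotent. Only the paths of `C * C` that pass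
through the complement of `E` prevent the compression from being idempotent too. -/
lemma compressed_sub_mul_self (hE : E * E = E) (hs : s * s = s) (hsE : s * E = E * s)
    (hC : C = s * C + C * s + C * C) :
    (s + E * C * E) - (s + E * C * E) * (s + E * C * E) = E * C * (1 - E) * C * E := by
  have h1 : E * C * E = E * s * C * E + E * C * s * E + E * C * C * E := by
    conv_lhs => rw [hC]
    noncomm_ring
  have h2 : E * C * E * (E * C * E) = E * C * E * C * E := by
    calc _ = E * C * (E * E) * C * E := by noncomm_ring
      _ = _ := by rw [hE]
  have h3 : s * (E * C * E) = E * s * C * E := by rw [← hsE]; noncomm_ring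
  have h4 : E * C * E * s = E * C * s * E := by rw [mul_assoc _ E s, ← hsE]; noncomm_ring
  have h5 : E * C * (1 - E) * C * E = E * C * C * E - E * C * E * C * E := by noncomm_ring
  rw [add_mul, mul_add, mul_add, hs, h2, h3, h4, h5, sub_eq_iff_eq_add]
  conv_lhs => rw [h1]
  abel

/-- The scalar part commutes with `D` and drops out, leaving the crossings of `C` from the range of
`D` into the rest of the range of `E`. -/
lemma compressed_mul_sub (hD : D * D = D) (hED : E * D = D) (hDE : D * E = D)
    (hsD : s * D = D * s) :
    (s + E * C * E) * D - D * (s + E * C * E) * D = (E - D) * C * D := by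
  have h1 : D * s * D = s * D := by rw [← hsD, mul_assoc, hD]
  have h2 : D * (E * C * E) * D = D * C * D := by
    calc _ = (D * E) * C * (E * D) := by noncomm_ring
      _ = _ := by rw [hED, hDE]
  rw [add_mul, mul_add, add_mul, h1, h2, mul_assoc _ E D, hED]
  noncomm_ring

/-- Compressing the exponentials of two compressions of the same idempotent gives the same
result up to compact operators. -/
lemma matApprox_compress_exp_compressed (z : ℂ) (hD : D * D = D) (hE : E * E = E)
    (hE' : E' * E' = E') (hED : E * D = D) (hDE : D * E = D) (hE'D : E' * D = D) (hDE' : D * E' = D)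
    (hs : s * s = s) (hsD : s * D = D * s) (hsE : s * E = E * s) (hsE' : s * E' = E' * s)
    (hC : C = s * C + C * s + C * C)
    (h : ∀ k, MatApprox ((1 - E) * (C * E * (s + E * C * E) ^ k) * (E - D) * C * D))
    (h' : ∀ k, MatApprox ((1 - E') * (C * E' * (s + E' * C * E') ^ k) * (E' - D) * C * D))
    (hEE' : MatApprox (D * C * (E' - E) * C * D)) :
    MatApprox (D * NormedSpace.exp (z • (s + E * C * E)) * D -
      D * NormedSpace.exp (z • (s + E' * C * E')) * D) := by
  have hc : ∀ {E : Matrix (Fin n) (Fin n) (H →L[ℂ] H)}, E * D = D → D * E = D →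
      ∀ S, D * (E * S * E) * D = D * S * D := fun {E} h1 h2 S => by
    calc _ = (D * E) * S * (E * D) := by noncomm_ring
      _ = _ := by rw [h1, h2]
  refine matApprox_compress_exp_sub z (matApprox_compress_pow_sub hD ?_
    (compressed_sub_mul_self hE hs hsE hC).symm (compressed_sub_mul_self hE' hs hsE' hC).symm
    (fun k => ?_) (fun k => ?_) ?_)
  · rw [mul_add, add_mul, mul_add, add_mul, hc hED hDE, hc hE'D hDE']
  · rw [compressed_mul_sub hD hED hDE hsD]
    have := (h k).mul_left (E * C)
    simpa only [mul_assoc] using this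
  · rw [compressed_mul_sub hD hE'D hDE' hsD]
    have := (h' k).mul_left (E' * C)
    simpa only [mul_assoc] using this
  · have h1 : ∀ E : Matrix (Fin n) (Fin n) (H →L[ℂ] H), E * C * (1 - E) * C * E =
        E * (C * (1 - E) * C) * E := fun E => by noncomm_ring
    rw [h1, h1, hc hED hDE, hc hE'D hDE']
    have : D * (C * (1 - E) * C) * D - D * (C * (1 - E') * C) * D = D * C * (E' - E) * C * D := by
      noncomm_ring
    rw [this]
    exact hEE'

lemma mul_exp_compressed (z : ℂ) (hE : E * E = E) (hsE : s * E = E * s) :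
    E * NormedSpace.exp (z • (s + E * C * E)) = NormedSpace.exp (z • (s + E * C * E)) * E := by
  have h0 : E * (s + E * C * E) = (s + E * C * E) * E := by
    rw [mul_add, add_mul, hsE, mul_assoc _ E E, hE, ← mul_assoc, ← mul_assoc, hE]
  have h1 := (hasSum_matrix_exp (z • (s + E * C * E))).mul_left E
  have h2 := (hasSum_matrix_exp (z • (s + E * C * E))).mul_right E
  refine h1.unique ?_
  convert h2 using 2 with k
  have : Commute E ((k.factorial : ℂ)⁻¹ • (z • (s + E * C * E)) ^ k) :=
    ((Commute.smul_right h0 z).pow_right k).smul_right _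
  exact this.eq

end CompressedExponential

/-! ### Matrix entries in subalgebras and matrices over unitizations. -/

section SubalgebraEntries

variable {B : Type*} [Ring B] [Algebra ℂ B] {S : Subalgebra ℂ B} {n : ℕ}
variable {M N : Matrix (Fin n) (Fin n) B}

lemma mul_entry_mem (hM : ∀ i j, M i j ∈ S) (hN : ∀ i j, N i j ∈ S) (i j : Fin n) :
    (M * N) i j ∈ S := by
  rw [Matrix.mul_apply]
  exact S.sum_mem fun k _ => S.mul_mem (hM i k) (hN k j)

lemma diagonal_entry_mem {b : B} (hb : b ∈ S) (i j : Fin n) :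
    Matrix.diagonal (fun _ : Fin n => b) i j ∈ S := by
  rw [Matrix.diagonal_apply]
  split_ifs
  exacts [hb, S.zero_mem]

lemma pow_entry_mem (hM : ∀ i j, M i j ∈ S) (k : ℕ) (i j : Fin n) : (M ^ k) i j ∈ S := by
  induction k generalizing i j with
  | zero =>
    rw [pow_zero, ← Matrix.diagonal_one]
    exact diagonal_entry_mem S.one_mem i j
  | succ k ih =>
    rw [pow_succ]
    exact mul_entry_mem ih hM i j

end SubalgebraEntries

section UnitizationMatrices

variable {A B : Type*} [NonUnitalCStarAlgebra A] [CStarAlgebra B] {n : ℕ}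

/-- The scalar part of a matrix over a unitization, as a matrix over `B`. -/
def fstMat (B : Type*) [CStarAlgebra B] (p : Matrix (Fin n) (Fin n) (Unitization ℂ A)) :
    Matrix (Fin n) (Fin n) B :=
  p.map fun x => x.fst • (1 : B)

/-- The image under `j` of the non-scalar part of a matrix over a unitization. -/
def sndMat (j : A →⋆ₙₐ[ℂ] B) (p : Matrix (Fin n) (Fin n) (Unitization ℂ A)) :
    Matrix (Fin n) (Fin n) B :=
  p.map fun x => j x.snd

lemma fstMat_mul_diagonal (p : Matrix (Fin n) (Fin n) (Unitization ℂ A)) (b : B) :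
    fstMat B p * Matrix.diagonal (fun _ => b) = Matrix.diagonal (fun _ => b) * fstMat B p := by
  ext i j : 1
  rw [Matrix.mul_diagonal, Matrix.diagonal_mul]
  simp [fstMat]

lemma fstMat_mul_self {p : Matrix (Fin n) (Fin n) (Unitization ℂ A)} (hp : p * p = p) :
    fstMat B p * fstMat B p = fstMat B p := by
  have e : fstMat B p = p.map ((StarAlgHom.ofId ℂ B).comp (scalarPart A)) := by
    ext i j : 1
    exact (Algebra.algebraMap_eq_smul_one _).symm
  rw [e, ← map_unitization_mul, hp]

lemma sndMat_eq {p : Matrix (Fin n) (Fin n) (Unitization ℂ A)} (hp : p * p = p) (j : A →⋆ₙₐ[ℂ] B) :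
    sndMat j p = fstMat B p * sndMat j p + sndMat j p * fstMat B p + sndMat j p * sndMat j p := by
  have e : fstMat B p + sndMat j p = p.map (Unitization.starLift j) := by
    ext i k : 1
    change _ = algebraMap ℂ B _ + _
    rw [Algebra.algebraMap_eq_smul_one]
    rfl
  have h : (fstMat B p + sndMat j p) * (fstMat B p + sndMat j p) = fstMat B p + sndMat j p := by
    rw [e, ← map_unitization_mul, hp]
  rw [add_mul, mul_add, mul_add, fstMat_mul_self hp, add_assoc, add_left_cancel_iff, ← add_assoc] at h
  exact h.symm

variable {J Q : Type*} [NonUnitalCStarAlgebra J] [NonUnitalCStarAlgebra Q]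

/-- The extension of a section of a *-homomorphism to matrices over the unitizations. -/
def liftMat (σ : A → Q) (p : Matrix (Fin n) (Fin n) (Unitization ℂ A)) :
    Matrix (Fin n) (Fin n) (Unitization ℂ Q) :=
  p.map fun x => Unitization.inl x.fst + (σ x.snd : Unitization ℂ Q)

lemma IsExtension.exists_isExpLift {ι : J →⋆ₙₐ[ℂ] Q} {q : Q →⋆ₙₐ[ℂ] A} (h : IsExtension ι q)
    {σ : A → Q} (hσ : ∀ x, q (σ x) = x) (hs : ∀ x, σ (star x) = star (σ x))
    {p : Matrix (Fin n) (Fin n) (Unitization ℂ A)} (hp : IsStarProjection p) :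
    ∃ u, IsExpLift ι q p (liftMat σ p) u := by
  have ha : IsSelfAdjoint (liftMat σ p) := by
    change star (liftMat σ p) = liftMat σ p
    ext i j : 1
    have h1 : star (p j i) = p i j := congrFun (congrFun hp.isSelfAdjoint.star_eq i) j
    rw [Matrix.star_apply, liftMat, Matrix.map_apply, Matrix.map_apply, star_add,
      ← Unitization.inl_star, ← Unitization.inr_star, ← hs, ← Unitization.fst_star,
      ← Unitization.snd_star, h1]
  have hap : (liftMat σ p).map (Unitization.starMap q) = p := by
    ext i j : 1
    rw [liftMat, Matrix.map_apply, Matrix.map_apply]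
    refine Unitization.ext ?_ ?_
    · rw [starMap_fst]
      simp
    · rw [starMap_snd]
      simp [hσ]
  obtain ⟨u, hu⟩ := h.exists_exp (a := liftMat σ p) (by rwa [hap])
  exact ⟨u, ha, hap, hu⟩

lemma map_exp_smul (ρ : Unitization ℂ Q →⋆ₐ[ℂ] B) (z : ℂ)
    (a : Matrix (Fin n) (Fin n) (Unitization ℂ Q)) :
    (NormedSpace.exp (z • a)).map ρ = NormedSpace.exp (z • a.map ρ) := by
  rw [matrix_map_star_exp]
  congr 1
  ext i j : 1
  exact map_smul ρ _ _

lemma IsExpLift.map_eq_exp {ι : J →⋆ₙₐ[ℂ] Q} {q : Q →⋆ₙₐ[ℂ] A} {p a u}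
    (h : IsExpLift (n := n) ι q p a u) (ρ : Unitization ℂ Q →⋆ₐ[ℂ] B)
    (ρ' : Unitization ℂ J →⋆ₐ[ℂ] B) (hρ : ∀ x, ρ (Unitization.starMap ι x) = ρ' x) :
    u.map ρ' = NormedSpace.exp (expFactor • a.map ρ) := by
  rw [← map_exp_smul, ← h.exp_eq]
  ext i j : 1
  exact (hρ _).symm

end UnitizationMatrices

/-! ### Compactness of crossings for operators in the Roe algebras. -/

section RoeClosure

lemma mul_mem_of_mem_closure {R : Type*} [Ring R] [TopologicalSpace R] [IsTopologicalRing R]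
    {A B C : Set R} (hC : IsClosed C) {a b c : R} (h : ∀ x ∈ A, ∀ y ∈ B, a * x * b * y * c ∈ C)
    {x y : R} (hx : x ∈ closure A) (hy : y ∈ closure B) : a * x * b * y * c ∈ C := by
  have hc : Continuous (Function.uncurry fun x y : R => a * x * b * y * c) := by
    unfold Function.uncurry
    fun_prop
  have := map_mem_closure₂ hc hx hy h
  rwa [hC.closure_eq] at this

variable {X : Type*} [MetricSpace X] [MeasurableSpace X] [BorelSpace X]
variable {μ : Measure X} {W W' Z : Set X} {n : ℕ}

/-- The algebra of operators of finite propagation. -/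
def finPropAlg (μ : Measure X) : Subalgebra ℂ (BL2 μ) where
  carrier := {T | ∃ R, FinProp μ T R}
  mul_mem' := by
    rintro S T ⟨R, hR⟩ ⟨R', hR'⟩
    exact ⟨_, hR.mul hR'⟩
  add_mem' := by
    rintro S T ⟨R, hR⟩ ⟨R', hR'⟩
    exact ⟨max R R', (hR.mono (le_max_left _ _)).add (hR'.mono (le_max_right _ _))⟩
  algebraMap_mem' c := by
    rw [Algebra.algebraMap_eq_smul_one, ← chi_univ]
    exact ⟨1, (finProp_chi MeasurableSet.univ one_pos).smul c⟩

lemma chi_mem_closure_finPropAlg {E : Set X} (hE : MeasurableSet E) :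
    chi μ E ∈ (finPropAlg μ).topologicalClosure :=
  subset_closure ⟨1, finProp_chi hE one_pos⟩

lemma mem_closure_finPropAlg_of_isRoe {T : BL2 μ} (hT : T ∈ closure {T | IsRoe μ T}) :
    T ∈ (finPropAlg μ).topologicalClosure :=
  closure_mono (fun _ h => h.finProp) hT

lemma mem_closure_isRoe [ProperSpace X] [IsFiniteMeasureOnCompacts μ] {Γ : Type*} [Group Γ] [MulAction Γ X] [IsIsometricSMul Γ X]
    [SMulInvariantMeasure Γ X μ] {T : BL2 μ} (hT : T ∈ equivariantRoe Γ μ) :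
    T ∈ closure {T | IsRoe μ T} := by
  have hT' : T ∈ closure (equivariantRoeSet Γ μ) := by rw [← coe_equivariantRoe]; exact hT
  exact closure_mono (fun A hA => (mem_equivariantRoeSet_iff.1 hA).1) hT'

/-- If `Z` is admissible in `W` and `W'`, then operators in the Roe algebra decouple `Z` and
`W' \ W` up to compact operators. -/
lemma IsAdmissible.isApproximable_chi_mul_chi_sdiff (h : IsAdmissible μ W Z)
    (h' : IsAdmissible μ W' Z) (hN : Z ∩ regCompl W' Z = Z ∩ regCompl W Z)
    {S : BL2 μ} (hS : S ∈ closure {T | IsRoe μ T}) :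
    IsApproximable (chi μ Z * S * chi μ (W' \ W)) := by
  have hZ := h.isClosed.measurableSet
  have hW := h.isHalfSpace.isClosed.measurableSet
  have hW' := h'.isHalfSpace.isClosed.measurableSet
  have hc : IsClosed {S : BL2 μ | IsApproximable (chi μ Z * S * chi μ (W' \ W))} :=
    isClosed_closure.preimage ((continuous_const_mul _).mul continuous_const)
  refine closure_minimal (fun S hS => ?_) hc hS
  obtain ⟨r, hr⟩ := hS.finProp
  -- As `Z ⊆ W`, points of `W' \ W` lie both in `Wᶜ` and in `W' \ Z`. Those within `r` of `Z` form a
  -- bounded set by `IsAdmissible.isBounded`.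
  refine hS.isApproximable_chi_mul_chi hr hZ (hW'.diff hW)
    ((h.isBounded h' hN r).subset ?_)
  rintro x ⟨h1, h2⟩
  exact ⟨⟨Metric.self_subset_cthickening _ h2.2, Metric.thickening_subset_cthickening _ _ h1⟩,
    Metric.self_subset_cthickening _ ⟨h2.1, fun hx => h2.2 (h.subset hx)⟩⟩

lemma IsAdmissible.isApproximable_chi_compl_mul_of_finProp (h : IsAdmissible μ W Z) {T S : BL2 μ}
    {t : ℝ} (ht : FinProp μ T t) (hS : IsRoe μ S) :
    IsApproximable (chi μ Wᶜ * T * chi μ (W \ Z) * S * chi μ Z) := by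
  have hZ := h.isClosed.measurableSet
  have hW := h.isHalfSpace.isClosed.measurableSet
  obtain ⟨r, hr⟩ := hS.finProp
  have hth : MeasurableSet (Metric.thickening t Wᶜ) := Metric.isOpen_thickening.measurableSet
  -- Since `T` has propagation `t`, the crossing from `W \ Z` to `Z` may be confined to points
  -- within `t` of `Wᶜ`, whatever else `T` does.
  have e : chi μ Wᶜ * T * chi μ (W \ Z) * S * chi μ Z =
      chi μ Wᶜ * T * (chi μ (Metric.thickening t Wᶜ ∩ (W \ Z)) * S * chi μ Z) := by
    rw [← chi_mul_chi hth (hW.diff hZ), ← ht.chi_mul hW.compl]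
    simp only [mul_assoc]
    rw [← mul_assoc (chi μ (Metric.thickening t Wᶜ)) (chi μ (Metric.thickening t Wᶜ)),
      chi_mul_self hth]
  rw [e]
  refine (hS.isApproximable_chi_mul_chi hr (hth.inter (hW.diff hZ)) hZ
    ((h.isBounded h rfl (|r| + |t|)).subset ?_)).mul_left _
  rintro x ⟨h1, h2⟩
  have hle : r ≤ |r| + |t| := (le_abs_self r).trans (le_add_of_nonneg_right (abs_nonneg t))
  refine ⟨⟨?_, Metric.self_subset_cthickening _ h2⟩, ?_⟩
  · exact Metric.thickening_subset_cthickening _ _ (Metric.thickening_mono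
      (add_le_add (le_abs_self r) (le_abs_self t)) _ (Metric.thickening_thickening_subset _ _ _
        (Metric.thickening_subset_of_subset _ Set.inter_subset_left h1)))
  · exact Metric.cthickening_mono hle _ (Metric.thickening_subset_cthickening _ _
      (Metric.thickening_subset_of_subset _ Set.inter_subset_right h1))

/-- Paths that leave `W` and cross from `W \ Z` to `Z` contribute compact operators only. -/
lemma IsAdmissible.isApproximable_chi_compl_mul (h : IsAdmissible μ W Z) {T S : BL2 μ}
    (hT : T ∈ closure {T | ∃ R, FinProp μ T R}) (hS : S ∈ closure {T | IsRoe μ T}) :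
    IsApproximable (chi μ Wᶜ * T * chi μ (W \ Z) * S * chi μ Z) := by
  exact mul_mem_of_mem_closure isClosed_closure (fun T hT S hS =>
    h.isApproximable_chi_compl_mul_of_finProp hT.choose_spec hS) hT hS

lemma matApprox_diagonal_mul {H : Type*} [NormedAddCommGroup H] [InnerProductSpace ℂ H]
    [CompleteSpace H] {P₁ P₂ P₃ : H →L[ℂ] H} {M N : Matrix (Fin n) (Fin n) (H →L[ℂ] H)}
    (h : ∀ i k j, IsApproximable (P₁ * M i k * P₂ * N k j * P₃)) :
    MatApprox (Matrix.diagonal (fun _ => P₁) * M * Matrix.diagonal (fun _ => P₂) * N *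
      Matrix.diagonal (fun _ => P₃)) := by
  intro i j
  rw [Matrix.mul_diagonal, Matrix.mul_apply, Finset.sum_mul]
  refine isApproximable_sum _ fun k _ => ?_
  rw [Matrix.mul_diagonal, Matrix.diagonal_mul]
  exact h i k j

end RoeClosure

/-! ### The index of the exponential of a compressed projection. -/

section IndexOfExponential

variable {X : Type*} [MetricSpace X] [MeasurableSpace X] [BorelSpace X]
variable {Γ : Type*} [Group Γ] [MulAction Γ X] [IsIsometricSMul Γ X]
variable {μ : Measure X} [SMulInvariantMeasure Γ X μ] {W W' Z : Set X} {n : ℕ}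

/-- The non-scalar part of a matrix over the unitization of the equivariant Roe algebra. -/
def roeMat (p : Matrix (Fin n) (Fin n) (Unitization ℂ (equivariantRoe Γ μ))) :
    Matrix (Fin n) (Fin n) (BL2 μ) :=
  sndMat (NonUnitalStarSubalgebraClass.subtype (equivariantRoe Γ μ)) p

lemma roeMat_apply (p : Matrix (Fin n) (Fin n) (Unitization ℂ (equivariantRoe Γ μ)))
    (i j : Fin n) : roeMat p i j = ((p i j).snd : BL2 μ) := rfl

/-- The compression to `L²(W)` of a matrix over the unitization of the equivariant Roe algebra. -/
def compressedMat (W : Set X) (p : Matrix (Fin n) (Fin n) (Unitization ℂ (equivariantRoe Γ μ))) :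
    Matrix (Fin n) (Fin n) (BL2 μ) :=
  fstMat (BL2 μ) p + Matrix.diagonal (fun _ => chi μ W) * roeMat p *
    Matrix.diagonal (fun _ => chi μ W)

lemma diagonal_chi_mul_self (hW : MeasurableSet W) :
    Matrix.diagonal (fun _ : Fin n => chi μ W) * Matrix.diagonal (fun _ => chi μ W) =
      Matrix.diagonal fun _ => chi μ W :=
  diagonal_mul_self (chi_mul_self hW)

variable [ProperSpace X] [IsFiniteMeasureOnCompacts μ]

lemma compressRoe_star (hX : HasAlmostGeodesics X) (hW : MeasurableSet W)
    (x : equivariantRoe Γ μ) : compressRoe hX hW (star x) = star (compressRoe hX hW x) :=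
  Subtype.ext (compress_star _)

lemma map_liftMat_compressRoe (hX : HasAlmostGeodesics X) (hW : MeasurableSet W)
    (p : Matrix (Fin n) (Fin n) (Unitization ℂ (equivariantRoe Γ μ))) :
    (liftMat (compressRoe hX hW) p).map (unitalRep μ hW (quasiEquivariantRoe Γ μ W)) =
      compressedMat W p := by
  ext i j : 1
  rw [compressedMat, Matrix.add_apply, Matrix.mul_diagonal, Matrix.diagonal_mul, roeMat_apply,
    Matrix.map_apply, unitalRep_apply]
  have h1 : (liftMat (compressRoe hX hW) p i j).fst = (p i j).fst := by
    simp [liftMat]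
  have h2 : (liftMat (compressRoe hX hW) p i j).snd = compressRoe hX hW (p i j).snd := by
    simp [liftMat]
  rw [h1, h2]
  rfl

lemma unitalRep_localizedIncl (hW : MeasurableSet W) (x : Unitization ℂ (localizedRoe μ W)) :
    unitalRep μ hW (quasiEquivariantRoe Γ μ W) (Unitization.starMap (localizedIncl Γ μ W) x) =
      unitalRep μ hW (localizedRoe μ W) x := by
  rw [unitalRep_apply, unitalRep_apply, starMap_fst, starMap_snd, coe_localizedIncl]

/-- The exponential map is represented by the exponential of the compression. -/
lemma exists_unitary_eq_exp (hX : HasAlmostGeodesics X) (hW : MeasurableSet W) {x₀ : X} {g : ℕ → Γ}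
    (hg : IsDeepSeq W x₀ g) {p : Matrix (Fin n) (Fin n) (Unitization ℂ (equivariantRoe Γ μ))}
    (hp : IsStarProjection p) :
    ∃ u ∈ unitary (Matrix (Fin n) (Fin n) (Unitization ℂ (localizedRoe μ W))),
      IsExpLift (localizedIncl Γ μ W) (periodization hX hW hg) p (liftMat (compressRoe hX hW) p) u ∧
      u.map (unitalRep μ hW (localizedRoe μ W)) =
        NormedSpace.exp (expFactor • compressedMat W p) := by
  have hext := isExtension_periodization (μ := μ) hX hW hg
  obtain ⟨u, hu⟩ := hext.exists_isExpLift (periodization_compressRoe hX hW hg)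
    (compressRoe_star hX hW) hp
  refine ⟨u, hu.mem_unitary hext, hu, ?_⟩
  rw [← map_liftMat_compressRoe hX hW p]
  exact hu.map_eq_exp _ _ (unitalRep_localizedIncl hW)

/-- The middle factor `C E a^k` is a norm limit of operators of finite propagation for every `k`; it
need not be locally compact, as the scalar part of `a` is not. The final factor `C` supplies the
compactness. -/
lemma IsAdmissible.matApprox_compl_mul (h : IsAdmissible μ W Z)
    (p : Matrix (Fin n) (Fin n) (Unitization ℂ (equivariantRoe Γ μ))) (k : ℕ) :
    MatApprox ((1 - Matrix.diagonal (fun _ => chi μ W)) *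
      (roeMat p * Matrix.diagonal (fun _ => chi μ W) * compressedMat W p ^ k) *
      (Matrix.diagonal (fun _ => chi μ W) - Matrix.diagonal (fun _ => chi μ Z)) * roeMat p *
      Matrix.diagonal (fun _ => chi μ Z)) := by
  have hZ := h.isClosed.measurableSet
  have hW := h.isHalfSpace.isClosed.measurableSet
  have e1 : (1 : Matrix (Fin n) (Fin n) (BL2 μ)) - Matrix.diagonal (fun _ => chi μ W) =
      Matrix.diagonal fun _ => chi μ Wᶜ := by
    rw [chi_compl hW, ← Matrix.diagonal_one, Matrix.diagonal_sub]
  have e2 : Matrix.diagonal (fun _ : Fin n => chi μ W) - Matrix.diagonal (fun _ => chi μ Z) =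
      Matrix.diagonal fun _ => chi μ (W \ Z) := by
    rw [Matrix.diagonal_sub, ← chi_add_chi_sdiff hW hZ h.subset]
    simp only [add_sub_cancel_left]
  rw [e1, e2]
  have hroe : ∀ i j, roeMat p i j ∈ closure {T | IsRoe μ T} := fun i j =>
    mem_closure_isRoe (p i j).snd.2
  have hroe' : ∀ i j, roeMat p i j ∈ (finPropAlg μ).topologicalClosure := fun i j =>
    mem_closure_finPropAlg_of_isRoe (hroe i j)
  have hchi : ∀ i j : Fin n, Matrix.diagonal (fun _ : Fin n => chi μ W) i j ∈
      (finPropAlg μ).topologicalClosure :=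
    diagonal_entry_mem (chi_mem_closure_finPropAlg hW)
  have hfst : ∀ i j, fstMat (BL2 μ) p i j ∈ (finPropAlg μ).topologicalClosure := fun i j =>
    Subalgebra.smul_mem _ (Subalgebra.one_mem _) _
  have hcomp : ∀ i j, compressedMat W p i j ∈ (finPropAlg μ).topologicalClosure := fun i j =>
    Subalgebra.add_mem _ (hfst i j) (mul_entry_mem (mul_entry_mem hchi hroe') hchi i j)
  refine matApprox_diagonal_mul fun i l j => ?_
  exact h.isApproximable_chi_compl_mul
    (mul_entry_mem (mul_entry_mem hroe' hchi) (pow_entry_mem hcomp k) i l) (hroe l j)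

lemma IsAdmissible.matApprox_mul_sub (h : IsAdmissible μ W Z) (h' : IsAdmissible μ W' Z)
    (hN : Z ∩ regCompl W' Z = Z ∩ regCompl W Z)
    (p : Matrix (Fin n) (Fin n) (Unitization ℂ (equivariantRoe Γ μ))) :
    MatApprox (Matrix.diagonal (fun _ => chi μ Z) * roeMat p *
      (Matrix.diagonal (fun _ => chi μ W') - Matrix.diagonal (fun _ => chi μ W)) * roeMat p *
      Matrix.diagonal (fun _ => chi μ Z)) := by
  have hW := h.isHalfSpace.isClosed.measurableSet
  have hW' := h'.isHalfSpace.isClosed.measurableSet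
  have hroe : ∀ i j, roeMat p i j ∈ closure {T | IsRoe μ T} := fun i j =>
    mem_closure_isRoe (p i j).snd.2
  -- The difference only involves `W' \ W` and `W \ W'`, both of which decouple from `Z`; the two
  -- cases are exchanged by swapping the half-spaces.
  have e : Matrix.diagonal (fun _ : Fin n => chi μ W') - Matrix.diagonal (fun _ => chi μ W) =
      Matrix.diagonal (fun _ => chi μ (W' \ W)) - Matrix.diagonal fun _ => chi μ (W \ W') := by
    rw [Matrix.diagonal_sub, Matrix.diagonal_sub]
    congr 1
    funext i
    have h1 := chi_add_chi_sdiff (ν := μ) hW' (hW'.inter hW) Set.inter_subset_left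
    have h2 := chi_add_chi_sdiff (ν := μ) hW (hW'.inter hW) Set.inter_subset_right
    rw [Set.sdiff_self_inter] at h1
    rw [Set.sdiff_inter_self_eq_sdiff] at h2
    rw [← h1, ← h2]
    abel
  rw [e, mul_sub, sub_mul, sub_mul]
  exact (matApprox_diagonal_mul fun i k j =>
    ((h.isApproximable_chi_mul_chi_sdiff h' hN (hroe i k)).mul_right _).mul_right _).sub
    (matApprox_diagonal_mul fun i k j =>
      ((h'.isApproximable_chi_mul_chi_sdiff h hN.symm (hroe i k)).mul_right _).mul_right _)

/-- The index of the compression to `L²(Z)` does not depend on the half-space containing `Z`. -/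
lemma IsAdmissible.index_congr (hX : HasAlmostGeodesics X) (h : IsAdmissible μ W Z)
    (h' : IsAdmissible μ W' Z) (hN : Z ∩ regCompl W' Z = Z ∩ regCompl W Z)
    (hW : MeasurableSet W) (hW' : MeasurableSet W')
    {p : Matrix (Fin n) (Fin n) (Unitization ℂ (equivariantRoe Γ μ))} (hp : IsStarProjection p)
    {u : Matrix (Fin n) (Fin n) (Unitization ℂ (localizedRoe μ W))}
    {u' : Matrix (Fin n) (Fin n) (Unitization ℂ (localizedRoe μ W'))}
    (hu : u ∈ unitary (Matrix (Fin n) (Fin n) (Unitization ℂ (localizedRoe μ W))))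
    (hup : u.map (unitalRep μ hW (localizedRoe μ W)) =
      NormedSpace.exp (expFactor • compressedMat W p))
    (hup' : u'.map (unitalRep μ hW' (localizedRoe μ W')) =
      NormedSpace.exp (expFactor • compressedMat W' p)) :
    fredholmIndex (compression μ W' Z u') = fredholmIndex (compression μ W Z u) := by
  have hZ := h.isClosed.measurableSet
  have hsub : ∀ {V : Set X}, MeasurableSet V → Z ⊆ V →
      Matrix.diagonal (fun _ : Fin n => chi μ V) * Matrix.diagonal (fun _ => chi μ Z) =
        Matrix.diagonal (fun _ => chi μ Z) ∧
      Matrix.diagonal (fun _ : Fin n => chi μ Z) * Matrix.diagonal (fun _ => chi μ V) =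
        Matrix.diagonal (fun _ => chi μ Z) := fun hV hZV => by
    rw [Matrix.diagonal_mul_diagonal, Matrix.diagonal_mul_diagonal, mul_chi_of_subset hZ hV hZV,
      chi_mul_of_subset hZ hV hZV]
    exact ⟨rfl, rfl⟩
  rw [h.fredholmIndex_compression hW, h'.fredholmIndex_compression hW']
  refine fredholmIndex_toeplitz_congr (h.isFredholm_toeplitz hX hW hu) ?_
  rw [hup, hup']
  have hpp : p * p = p := hp.isIdempotentElem
  exact matApprox_compress_exp_compressed expFactor (diagonal_chi_mul_self hZ)
    (diagonal_chi_mul_self hW) (diagonal_chi_mul_self hW') (hsub hW h.subset).1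
    (hsub hW h.subset).2 (hsub hW' h'.subset).1 (hsub hW' h'.subset).2 (fstMat_mul_self hpp)
    (fstMat_mul_diagonal p _) (fstMat_mul_diagonal p _) (fstMat_mul_diagonal p _)
    (sndMat_eq hpp _) (h.matApprox_compl_mul p) (h'.matApprox_compl_mul p)
    (h.matApprox_mul_sub h' hN p)

/-- The indices of the compressions to complementary admissible sets add up to zero. -/
lemma IsAdmissible.index_add_index_compl (hX : HasAlmostGeodesics X) (h : IsAdmissible μ W Z)
    (hW : MeasurableSet W)
    {p : Matrix (Fin n) (Fin n) (Unitization ℂ (equivariantRoe Γ μ))}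
    {u : Matrix (Fin n) (Fin n) (Unitization ℂ (localizedRoe μ W))}
    (hu : u ∈ unitary (Matrix (Fin n) (Fin n) (Unitization ℂ (localizedRoe μ W))))
    (hup : u.map (unitalRep μ hW (localizedRoe μ W)) =
      NormedSpace.exp (expFactor • compressedMat W p)) :
    fredholmIndex (compression μ W Z u) + fredholmIndex (compression μ W (regCompl W Z) u) = 0 := by
  have hZ := h.isClosed.measurableSet
  have hZ' := h.compl.isClosed.measurableSet
  have h0 : chi μ (Z ∩ regCompl W Z) = 0 := chi_of_measure_zero (hZ.inter hZ') h.measure_zero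
  have hP : chi μ Z * chi μ (regCompl W Z) = 0 := by rw [chi_mul_chi hZ hZ', h0]
  have hP' : chi μ (regCompl W Z) * chi μ Z = 0 := by
    rw [chi_mul_chi hZ' hZ, Set.inter_comm, h0]
  -- The regular complement exceeds `W \ Z` only within the null set `N`.
  have hadd : chi μ Z + chi μ (regCompl W Z) = chi μ W := by
    have hsub : regCompl W Z \ (W \ Z) ⊆ Z ∩ regCompl W Z := fun x hx =>
      ⟨by_contra fun hxZ => hx.2 ⟨regCompl_subset hx.1, hxZ⟩, hx.1⟩
    have h1 : chi μ (regCompl W Z) = chi μ (W \ Z) :=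
      chi_eq_chi_of_measure hZ' (hW.diff hZ) sdiff_subset_regCompl
        (measure_mono_null hsub h.measure_zero)
    rw [h1, chi_add_chi_sdiff hW hZ h.subset]
  obtain ⟨h1, h2⟩ := unitary_map_unitization (unitalRep μ hW (localizedRoe μ W)) hu
  rw [h.fredholmIndex_compression hW, h.compl.fredholmIndex_compression hW]
  refine fredholmIndex_toeplitz_add_eq_zero (chi_mul_self hZ) (chi_mul_self hZ') hP hP' h1 h2 ?_
    (h.matApprox_commutator hX hW u)
  rw [hadd, hup]
  exact mul_exp_compressed expFactor (diagonal_chi_mul_self hW) (fstMat_mul_diagonal p _)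

end IndexOfExponential

/-! ### Comparison through the glued half-space. -/

section Pairing

variable {J Q J' Q' B G : Type*} [NonUnitalCStarAlgebra J] [NonUnitalCStarAlgebra Q]
  [NonUnitalCStarAlgebra J'] [NonUnitalCStarAlgebra Q'] [NonUnitalCStarAlgebra B] [AddCommGroup G]
variable {ι : J →⋆ₙₐ[ℂ] Q} {q : Q →⋆ₙₐ[ℂ] B} {ι' : J' →⋆ₙₐ[ℂ] Q'} {q' : Q' →⋆ₙₐ[ℂ] B}

/-- Homomorphisms on `K₁` composed with exponential maps are compared on projections. -/
lemma IsExtension.comp_expHom_eq (h : IsExtension ι q) (h' : IsExtension ι' q') {θ : K1 J →+ G}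
    {θ' : K1 J' →+ G}
    (H : ∀ (n : ℕ) (p : Matrix (Fin n) (Fin n) (Unitization ℂ B)), IsStarProjection p →
      ∃ a u a' u', ∃ (hu : IsExpLift ι q p a u) (hu' : IsExpLift ι' q' p a' u'),
        θ (K1Unital.mk u (hu.mem_unitary h)) = θ' (K1Unital.mk u' (hu'.mem_unitary h'))) :
    θ.comp h.expHom = θ'.comp h'.expHom := by
  refine AddMonoidHom.ext fun x => ?_
  obtain ⟨n, p, hp, hx⟩ := K0.exists_eq_sub x
  obtain ⟨a, u, a', u', hu, hu', e⟩ := H n p hp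
  have e1 := (h.isExponentialMap x _).2
    ⟨n, p, hp, a, u, hu.mem_unitary h, hu.isSelfAdjoint, hu.map_eq, hu.exp_eq, hx, rfl⟩
  have e2 := (h'.isExponentialMap x _).2
    ⟨n, p, hp, a', u', hu'.mem_unitary h', hu'.isSelfAdjoint, hu'.map_eq, hu'.exp_eq, hx, rfl⟩
  rw [AddMonoidHom.comp_apply, AddMonoidHom.comp_apply, e1, e2, e]

lemma IsExtension.isUnique_expHom (h : IsExtension ι q) :
    IsUnique (IsExponentialMap ι q) h.expHom :=
  ⟨h.isExponentialMap, fun _ h' => h.isExponentialMap.unique h'⟩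

end Pairing

section Comparison

variable {X : Type*} [MetricSpace X] [MeasurableSpace X] {μ : Measure X} {W W' Wp Wp' : Set X}

/-- The regular complement of `Wp` in the half-space obtained by gluing. -/
lemma regCompl_union (hW' : IsClosed W')
    (hN : Wp ∩ regCompl W' Wp' = Wp' ∩ regCompl W' Wp') :
    regCompl (Wp ∪ regCompl W' Wp') Wp = regCompl W' Wp' := by
  have h : (Wp ∪ regCompl W' Wp') \ Wp = W' \ Wp' := by
    ext x
    constructor
    · rintro ⟨h1 | h1, h2⟩
      · exact absurd h1 h2
      · refine ⟨regCompl_subset h1, fun h3 => h2 ?_⟩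
        have : x ∈ Wp ∩ regCompl W' Wp' := hN ▸ ⟨h3, h1⟩
        exact this.1
    · intro h1
      refine ⟨Or.inr (sdiff_subset_regCompl h1), fun h2 => h1.2 ?_⟩
      have : x ∈ Wp' ∩ regCompl W' Wp' := hN ▸ ⟨h2, sdiff_subset_regCompl h1⟩
      exact this.1
  have h2 : closure (W' \ Wp') ⊆ W' := closure_minimal Set.sdiff_subset hW'
  rw [regCompl, h, regCompl, Set.inter_eq_right.2 h2, Set.inter_eq_right]
  exact Set.subset_union_right

variable [BorelSpace X] {Γ : Type*} [Group Γ] [MulAction Γ X] [IsIsometricSMul Γ X]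
variable [SMulInvariantMeasure Γ X μ] [ProperSpace X] [IsFiniteMeasureOnCompacts μ] {n : ℕ}

/-- The comparison of indices, through the half-space `Wp ∪ regCompl W' Wp'`. -/
lemma IsAdmissible.index_eq (hX : HasAlmostGeodesics X)
    (hWp : IsAdmissible μ W Wp) (hWp' : IsAdmissible μ W' Wp')
    (hN₁ : Wp ∩ regCompl W' Wp' = Wp ∩ regCompl W Wp)
    (hN₂ : Wp' ∩ regCompl W' Wp' = Wp ∩ regCompl W Wp)
    (hW₁ : IsAdmissible μ (Wp ∪ regCompl W' Wp') Wp)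
    (hW : MeasurableSet W) (hW' : MeasurableSet W') {x₀ : X} {g : ℕ → Γ}
    (hg : IsDeepSeq (Wp ∪ regCompl W' Wp') x₀ g)
    {p : Matrix (Fin n) (Fin n) (Unitization ℂ (equivariantRoe Γ μ))} (hp : IsStarProjection p)
    {u : Matrix (Fin n) (Fin n) (Unitization ℂ (localizedRoe μ W))}
    {u' : Matrix (Fin n) (Fin n) (Unitization ℂ (localizedRoe μ W'))}
    (hu : u ∈ unitary (Matrix (Fin n) (Fin n) (Unitization ℂ (localizedRoe μ W))))
    (hu' : u' ∈ unitary (Matrix (Fin n) (Fin n) (Unitization ℂ (localizedRoe μ W'))))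
    (hup : u.map (unitalRep μ hW (localizedRoe μ W)) =
      NormedSpace.exp (expFactor • compressedMat W p))
    (hup' : u'.map (unitalRep μ hW' (localizedRoe μ W')) =
      NormedSpace.exp (expFactor • compressedMat W' p)) :
    fredholmIndex (compression μ W Wp u) = fredholmIndex (compression μ W' Wp' u') := by
  have hr := regCompl_union hWp'.isHalfSpace.isClosed (hN₁.trans hN₂.symm)
  have hm := hW₁.isHalfSpace.isClosed.measurableSet
  obtain ⟨u₁, hu₁, -, hup₁⟩ := exists_unitary_eq_exp hX hm hg hp
  -- The index for `Wp` passes from `W` to the glued half-space; there it is traded for minus the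
  -- index of the complement.
  have e1 := hWp.index_congr hX hW₁ (by rw [hr, hN₁]) hW hm hp hu hup hup₁
  have e2 := hW₁.index_add_index_compl hX hm hu₁ hup₁
  have hc := hW₁.compl
  have hreg := hW₁.regular
  rw [hr] at hc e2 hreg
  -- The regular complement of `Wp` in the glued half-space is the one of `Wp'` in `W'`, so its
  -- index can be moved on to `W'`. There the same trade returns to `Wp'`.
  have e3 := hWp'.compl.index_congr hX hc (by
    rw [hreg, hWp'.regular, Set.inter_comm, hN₁, ← hN₂, Set.inter_comm]) hW' hm hp hu' hup' hup₁
  have e4 := hWp'.index_add_index_compl hX hW' hu' hup'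
  rw [e1] at e2
  rw [e3] at e2
  exact add_right_cancel (e2.trans e4.symm)

lemma isUnique_periodization (hX : HasAlmostGeodesics X) (hW : MeasurableSet W) {x₀ : X}
    {g : ℕ → Γ} (hg : IsDeepSeq W x₀ g) :
    IsUnique (IsPeriodization Γ μ W) (periodization hX hW hg) :=
  ⟨isPeriodization_periodization hX hW hg, fun _ h =>
    (isPeriodization_periodization hX hW hg).unique hX hW hg h⟩

lemma isUnique_indexHom (hX : HasAlmostGeodesics X) (h : IsAdmissible μ W Wp) :
    IsUnique (IsIndexHom μ W Wp) (indexHom hX h) :=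
  ⟨isIndexHom_indexHom hX h, fun _ h' => (isIndexHom_indexHom hX h).unique h'⟩

/-- The exponential map of the periodization extension. -/
def roeExp (hX : HasAlmostGeodesics X) (hW : MeasurableSet W) {x₀ : X} {g : ℕ → Γ}
    (hg : IsDeepSeq W x₀ g) : K0 (equivariantRoe Γ μ) →+ K1 (localizedRoe μ W) :=
  (isExtension_periodization (μ := μ) hX hW hg).expHom

lemma isUnique_roeExp (hX : HasAlmostGeodesics X) (hW : MeasurableSet W) {x₀ : X} {g : ℕ → Γ}
    (hg : IsDeepSeq W x₀ g) :
    IsUnique (IsExponentialMap (localizedIncl Γ μ W) (periodization hX hW hg))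
      (roeExp hX hW hg) :=
  (isExtension_periodization (μ := μ) hX hW hg).isUnique_expHom

set_option maxHeartbeats 1000000 in
/-- The index homomorphisms agree after composition with the exponential maps. -/
lemma IsAdmissible.indexHom_comp_roeExp (hX : HasAlmostGeodesics X)
    (hWp : IsAdmissible μ W Wp) (hWp' : IsAdmissible μ W' Wp')
    (hN₁ : Wp ∩ regCompl W' Wp' = Wp ∩ regCompl W Wp)
    (hN₂ : Wp' ∩ regCompl W' Wp' = Wp ∩ regCompl W Wp)
    (hW₁ : IsAdmissible μ (Wp ∪ regCompl W' Wp') Wp)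
    (hW : MeasurableSet W) (hW' : MeasurableSet W') {x₀ : X} {g g' g₁ : ℕ → Γ}
    (hg : IsDeepSeq W x₀ g) (hg' : IsDeepSeq W' x₀ g')
    (hg₁ : IsDeepSeq (Wp ∪ regCompl W' Wp') x₀ g₁) :
    (indexHom hX hWp).comp (roeExp hX hW hg) = (indexHom hX hWp').comp (roeExp hX hW' hg') := by
  refine IsExtension.comp_expHom_eq _ _ fun n p hp => ?_
  obtain ⟨u, hu, hlift, hup⟩ := exists_unitary_eq_exp hX hW hg hp
  obtain ⟨u', hu', hlift', hup'⟩ := exists_unitary_eq_exp hX hW' hg' hp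
  refine ⟨_, u, _, u', hlift, hlift', ?_⟩
  rw [(isIndexHom_indexHom hX hWp n u hu).2, (isIndexHom_indexHom hX hWp' n u' hu').2]
  exact hWp.index_eq hX hWp' hN₁ hN₂ hW₁ hW hW' hg₁ hp hu hu' hup hup'

end Comparison

end

theorem theorem4p10
    {d : ℕ} {X : Type*} [MetricSpace X] [CompleteSpace X] [ConnectedSpace X]
    [ChartedSpace (EuclideanSpace ℝ (Fin d)) X] [IsManifold (𝓡 d) ∞ X]
    [RiemannianBundle (fun x : X => TangentSpace (𝓡 d) x)]
    [IsContMDiffRiemannianBundle (𝓡 d) ∞ (EuclideanSpace ℝ (Fin d))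
      (fun x : X => TangentSpace (𝓡 d) x)]
    [IsRiemannianManifold (𝓡 d) X]
    [MeasurableSpace X] [BorelSpace X]
    (μ : Measure X) [IsFiniteMeasureOnCompacts μ] [μ.IsOpenPosMeasure]
    (Γ : Type*) [Group Γ] [Countable Γ] [MulAction Γ X] [FaithfulSMul Γ X] [IsIsometricSMul Γ X]
    [ProperlyDiscontinuousSMul Γ X] [CompactSpace (MulAction.orbitRel.Quotient Γ X)]
    [SMulInvariantMeasure Γ X μ]
    (W W' Wp Wp' : Set X)
    (hWp : IsAdmissible μ W Wp) (hWp' : IsAdmissible μ W' Wp')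
    (hN₁ : Wp ∩ regCompl W' Wp' = Wp ∩ regCompl W Wp)
    (hN₂ : Wp' ∩ regCompl W' Wp' = Wp ∩ regCompl W Wp)
    (hN₃ : Wp' ∩ regCompl W Wp = Wp ∩ regCompl W Wp)
    (hW₁ : IsAdmissible μ (Wp ∪ regCompl W' Wp') Wp) :
    ∃ (ϖ : quasiEquivariantRoe Γ μ W →⋆ₙₐ[ℂ] equivariantRoe Γ μ)
      (ϖ' : quasiEquivariantRoe Γ μ W' →⋆ₙₐ[ℂ] equivariantRoe Γ μ)
      (ExpW : K0 (equivariantRoe Γ μ) →+ K1 (localizedRoe μ W))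
      (ExpW' : K0 (equivariantRoe Γ μ) →+ K1 (localizedRoe μ W'))
      (θ : K1 (localizedRoe μ W) →+ ℤ)
      (θ' : K1 (localizedRoe μ W') →+ ℤ),
      IsUnique (IsPeriodization Γ μ W) ϖ ∧
      IsUnique (IsPeriodization Γ μ W') ϖ' ∧
      IsUnique (IsExponentialMap (localizedIncl Γ μ W) ϖ) ExpW ∧
      IsUnique (IsExponentialMap (localizedIncl Γ μ W') ϖ') ExpW' ∧
      IsUnique (IsIndexHom μ W Wp) θ ∧
      IsUnique (IsIndexHom μ W' Wp') θ' ∧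
      θ.comp ExpW = θ'.comp ExpW' := by
  have hX : HasAlmostGeodesics X := hasAlmostGeodesics_of_isRiemannianManifold (d := d)
  have _ : LocallyCompactSpace X := ChartedSpace.locallyCompactSpace (EuclideanSpace ℝ (Fin d)) X
  have _ : ProperSpace X := properSpace_of_cocompact Γ hX
  have hΓ : ∃ D : ℝ, 0 ≤ D ∧ ∀ x y : X, ∃ γ : Γ, dist (γ • x) y ≤ D := exists_dist_smul_le
  have x₀ : X := Classical.arbitrary X
  have hg := (exists_isDeepSeq hWp.isHalfSpace hΓ x₀).choose_spec
  have hg' := (exists_isDeepSeq hWp'.isHalfSpace hΓ x₀).choose_spec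
  have hg₁ := (exists_isDeepSeq hW₁.isHalfSpace hΓ x₀).choose_spec
  have hW := hWp.isHalfSpace.isClosed.measurableSet
  have hW' := hWp'.isHalfSpace.isClosed.measurableSet
  exact ⟨periodization hX hW hg, periodization hX hW' hg', roeExp hX hW hg, roeExp hX hW' hg',
    indexHom hX hWp, indexHom hX hWp', isUnique_periodization hX hW hg,
    isUnique_periodization hX hW' hg', isUnique_roeExp hX hW hg, isUnique_roeExp hX hW' hg',
    isUnique_indexHom hX hWp, isUnique_indexHom hX hWp',
    hWp.indexHom_comp_roeExp hX hWp' hN₁ hN₂ hW₁ hW hW' hg hg' hg₁⟩
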